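/- Let $S^4\subset\mathbb R^5$ be the unit sphere, oriented so that a frame $e_1,\dots,e_4$ of $T_xS^4$ is positive iff $\det(x,e_1,\dots,e_4)>0$, and let $\pi:\Lambda^2_-S^4\to S^4$ be the bundle of anti-self-dual 2-forms. Fix $\lambda>0$ and equip $\Lambda^2_-S^4$ with the Bryant--Salamon $G_2$-structure $$\varphi_\lambda=2s_\lambda\,d\tau+s_\lambda^{-3}\,\mathrm{vol}_{\mathcal V},\qquad s_\lambda=(\lambda+r^2)^{1/4}.$$ Here $\tau$ is the tautological 2-form, $r$ is the fibre norm for which $\omega_1=e^{12}-e^{34}$, $\omega_2=e^{13}-e^{42}$, $\omega_3=e^{14}-e^{23}$ are orthonormal for every positive orthonormal coframe $(e^i)$ of $S^4$, and $\mathrm{vol}_{\mathcal V}$ is the volume form of the fibres, extended by the Levi-Civita connection, with $(\omega_1,\omega_2,\omega_3)$ positive. A coassociative submanifold is a smooth embedded 4-dimensional submanifold which, with a suitable orientation, is calibrated by $*\varphi_\lambda$; here the metric and $*\varphi_\lambda$ are those induced by $\varphi_\lambda$, i.e. those corresponding to the Euclidean metric and $*\varphi_0=e^{4567}+e^{2367}-e^{2345}+e^{1357}+e^{1346}+e^{1256}-e^{1247}$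 on $\mathbb R^7$ under any isomorphism of the tangent space with $\mathbb R^7$ taking $\varphi_\lambda$ to $\varphi_0=e^{123}+e^{145}-e^{167}+e^{246}+e^{257}+e^{347}-e^{356}$. Let $\mathrm{SU}(2)$ act on $\mathbb R^5=\mathbb C^2\oplus\mathbb R$ (with $z_1=x_1+ix_2$, $z_2=x_3+ix_4$) by its standard action on $\mathbb C^2$ and trivially on $\mathbb R$, hence on $S^4$, and lift this action to $\Lambda^2_-S^4$. For $-1\le x_5\le 1$ and $a\in\mathbb R^3$ let $$\bigl({}^t(\sqrt{1-x_5^2},0,0,0,x_5),\,a\bigr)\in\Lambda^2_-S^4$$ be the form $\sum_i a_i\omega_i$ at the point ${}^t(\sqrt{1-x_5^2},0,0,0,x_5)$, where the $\omega_i$ are built as above from the orthonormal frame $e_1={}^t(0,1,0,0,0)$, $e_2={}^t(0,0,1,0,0)$, $e_3={}^t(0,0,0,1,0)$, $e_4={}^t(-x_5,0,0,0,\sqrt{1-x_5^2})$. For $r\ge 0$ and $-1\le x_5\le 1$ put $$F(r,x_5)=(1-3x_5)(\lambda+r^2)^{1/8}\sqrt r+\int_0^{\sqrt r}\frac{2\lambda}{(\lambda+x^4)^{7/8}}\,dx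 ,$$ and for $C\in\mathbb R$ and $v\in S^2\subset\mathbb R^3$ put $$M_{C,v}=\mathrm{SU}(2)\cdot\Bigl\{\bigl({}^t(\sqrt{1-x_5^2},0,0,0,x_5),\,rv\bigr)\ ;\ F(r,x_5)=C,\ r\ge 0,\ -1\le x_5\le 1\Bigr\}.$$ **Theorem.** Let $\lambda>0$, $C\in\mathbb R$ and $v\in S^2$. Subsets of $\Lambda^2_-S^4$ carry the subspace topology. 1. If $C\neq0$, then $M_{C,v}$ is a coassociative submanifold of $\Lambda^2_-S^4$. It is homeomorphic to $\mathbb R^4$ if $C>0$, and to the total space of the tautological line bundle $\mathcal O_{\mathbb CP^1}(-1)$ over $\mathbb CP^1$ if $C<0$. 2. If $C=0$, then $M_{0,v}$ contains the zero section, so that it is the disjoint union of the zero section and of the set $M_{0,v}\cap\{r>0\}$. Each of these two pieces is a coassociative submanifold; the zero section is homeomorphic to $S^4$, and $M_{0,v}\cap\{r>0\}$ is homeomorphic to $S^3\times\mathbb R_{>0}$. -/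

import Mathlib

open scoped Matrix ContDiff

attribute [local instance] Matrix.normedAddCommGroup Matrix.normedSpace

noncomputable section

namespace CoassS4

/-! ### The bundle of anti-self-dual two-forms over the round four-sphere

A two-form on `T_x S⁴` (with `x` a unit vector of `ℝ⁵`) is written as a skew `5 × 5` matrix `A`
with `A x = 0`, its value on tangent vectors `u, w` being `u ⬝ᵥ A *ᵥ w`. The total space is then a
smooth submanifold of the vector space `Amb = ℝ⁵ × ℝ^{5×5}`. -/

/-- The ambient vector space. (The norm on it only serves to speak of topology and smoothness; all
lengths below are computed with `⬝ᵥ` or with sums of squares.) -/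
abbrev Amb : Type := (Fin 5 → ℝ) × Matrix (Fin 5) (Fin 5) ℝ

/-- `(u ∧ w)_{ij} = u_i w_j - w_i u_j`. -/
def wedge (u w : Fin 5 → ℝ) : Matrix (Fin 5) (Fin 5) ℝ :=
  Matrix.vecMulVec u w - Matrix.vecMulVec w u

/-- Hodge star of two-forms on `T_x S⁴`, where `S⁴` has the round metric and the orientation for
which a frame `e₁, …, e₄` of `T_x S⁴` is positive iff `det (x, e₁, …, e₄) > 0`:
`(*A)_{kl} = ½ ∑_{i,j} A_{ij} det (x, E_i, E_j, E_k, E_l)`. (The formula is linear in `x`.) -/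
def hodge (x : Fin 5 → ℝ) (A : Matrix (Fin 5) (Fin 5) ℝ) : Matrix (Fin 5) (Fin 5) ℝ :=
  Matrix.of fun k l => (1 / 2) * ∑ i, ∑ j, A i j *
    Matrix.det (Matrix.of
      ![x, Pi.single i 1, Pi.single j 1, Pi.single k 1, Pi.single l 1])

/-- The total space of `Λ²₋ S⁴`. -/
def asdBundle : Set Amb :=
  {p | p.1 ⬝ᵥ p.1 = 1 ∧ p.2ᵀ = -p.2 ∧ p.2 *ᵥ p.1 = 0 ∧ hodge p.1 p.2 = -p.2}

/-- The zero section, a copy of `S⁴`. -/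
def zeroSection : Set Amb := {p | p.1 ⬝ᵥ p.1 = 1 ∧ p.2 = 0}

/-- `X` is tangent to the total space at `p` (the defining equations, differentiated). -/
def IsTangent (p X : Amb) : Prop :=
  p.1 ⬝ᵥ X.1 = 0 ∧ X.2ᵀ = -X.2 ∧ X.2 *ᵥ p.1 + p.2 *ᵥ X.1 = 0 ∧
    hodge X.1 p.2 + hodge p.1 X.2 = -X.2

/-! ### The Bryant–Salamon three-form -/

/-- `r²`, the squared fibre norm, for which `e¹² - e³⁴`, `e¹³ - e⁴²`, `e¹⁴ - e²³` are orthonormal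
for every positive orthonormal frame (each of these matrices has four entries `±1`). -/
def normSq (A : Matrix (Fin 5) (Fin 5) ℝ) : ℝ := (1 / 4) * ∑ i, ∑ j, A i j ^ 2

/-- `s_λ = (λ + r²)^{1/4}`. -/
def sFun (lam : ℝ) (A : Matrix (Fin 5) (Fin 5) ℝ) : ℝ := (lam + normSq A) ^ (1 / 4 : ℝ)

/-- The vertical part of a tangent vector `X` at `p`: the Levi-Civita covariant derivative of the
two-form along `X`. For the round sphere this is the tangential projection of the ordinary
derivative, `P Ẋ P` with `P = 1 - x xᵀ`. -/
def vert (p X : Amb) : Matrix (Fin 5) (Fin 5) ℝ :=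
  (1 - Matrix.vecMulVec p.1 p.1) * X.2 * (1 - Matrix.vecMulVec p.1 p.1)

/-- The exterior derivative of the tautological two-form
`τ = ½ ∑ A_{ij} dx_i ∧ dx_j`, that is `dτ = ½ ∑ dA_{ij} ∧ dx_i ∧ dx_j`. -/
def dTau (X : Fin 3 → Amb) : ℝ :=
  (X 1).1 ⬝ᵥ (X 0).2 *ᵥ (X 2).1 + (X 2).1 ⬝ᵥ (X 1).2 *ᵥ (X 0).1 +
    (X 0).1 ⬝ᵥ (X 2).2 *ᵥ (X 1).1

/-- The volume form of the fibres, with the fibre metric of `normSq` and with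
`ω₁ = e¹² - e³⁴`, `ω₂ = e¹³ - e⁴²`, `ω₃ = e¹⁴ - e²³` positively oriented.
As matrices `ω₁ ω₂ = ω₃` and `ω₃ ω₃ = -P`, so that `- tr (ω₁ ω₂ ω₃) / 4 = 1`. -/
def volV (p : Amb) (X : Fin 3 → Amb) : ℝ :=
  -(1 / 4) * Matrix.trace (vert p (X 0) * vert p (X 1) * vert p (X 2))

/-- The three-form `φ_λ = 2 s_λ dτ + s_λ⁻³ vol_V`. -/
def phi (lam : ℝ) (p : Amb) (X : Fin 3 → Amb) : ℝ :=
  2 * sFun lam p.2 * dTau X + (sFun lam p.2 ^ 3)⁻¹ * volV p X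

/-! ### `G₂`-structures and coassociative submanifolds -/

/-- `(e^{s 0} ∧ … ∧ e^{s (k-1)}) (u 0, …, u (k-1))` on `ℝ⁷`, coordinates being numbered from `0`. -/
def covec {k : ℕ} (s : Fin k → Fin 7) (u : Fin k → Fin 7 → ℝ) : ℝ :=
  Matrix.det (Matrix.of fun a b => u a (s b))

/-- `φ₀ = e¹²³ + e¹⁴⁵ - e¹⁶⁷ + e²⁴⁶ + e²⁵⁷ + e³⁴⁷ - e³⁵⁶` on `ℝ⁷`. -/
def phi0 (u : Fin 3 → Fin 7 → ℝ) : ℝ :=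
  covec ![0, 1, 2] u + covec ![0, 3, 4] u - covec ![0, 5, 6] u + covec ![1, 3, 5] u +
    covec ![1, 4, 6] u + covec ![2, 3, 6] u - covec ![2, 4, 5] u

/-- `*φ₀ = e⁴⁵⁶⁷ + e²³⁶⁷ - e²³⁴⁵ + e¹³⁵⁷ + e¹³⁴⁶ + e¹²⁵⁶ - e¹²⁴⁷` on `ℝ⁷`. -/
def starPhi0 (u : Fin 4 → Fin 7 → ℝ) : ℝ :=
  covec ![3, 4, 5, 6] u + covec ![1, 2, 5, 6] u - covec ![1, 2, 3, 4] u +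
    covec ![0, 2, 4, 6] u + covec ![0, 2, 3, 5] u + covec ![0, 1, 4, 5] u -
    covec ![0, 1, 3, 6] u

/-- `f` is a linear isomorphism of `ℝ⁷` onto the tangent space of `Λ²₋ S⁴` at `p` that carries `φ₀`
to `φ_λ`. The metric and the four-form `*φ_λ` at `p` are, by definition, what the Euclidean metric
and `*φ₀` become under such an isomorphism. -/
def IsG2Frame (lam : ℝ) (p : Amb) (f : (Fin 7 → ℝ) →ₗ[ℝ] Amb) : Prop :=
  Function.Injective f ∧ (∀ X, X ∈ Set.range f ↔ IsTangent p X) ∧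
    ∀ u : Fin 3 → Fin 7 → ℝ, phi lam p (fun i => f (u i)) = phi0 u

/-- The subspace `W` of the tangent space at `p` (of dimension four in all uses) is calibrated by
`*φ_λ` for one of its orientations: `*φ_λ` is, up to sign, the Riemannian volume form on `W`. -/
def IsCalibrated (lam : ℝ) (p : Amb) (W : Submodule ℝ Amb) : Prop :=
  ∃ f : (Fin 7 → ℝ) →ₗ[ℝ] Amb, IsG2Frame lam p f ∧ (∀ X ∈ W, X ∈ Set.range f) ∧
    ∀ u : Fin 4 → Fin 7 → ℝ, (∀ i, f (u i) ∈ W) →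
      |starPhi0 u| = √(Matrix.det (Matrix.of fun i j => u i ⬝ᵥ u j))

/-- `F`, on the open set `U ⊆ ℝ⁴`, is a smooth local parametrization of `L`: an immersion that is
a homeomorphism of `U` onto a relatively open subset of `L`. -/
structure IsLocalParam (L : Set Amb) (U : Set (EuclideanSpace ℝ (Fin 4)))
    (F : EuclideanSpace ℝ (Fin 4) → Amb) : Prop where
  isOpen : IsOpen U
  smooth : ContDiffOn ℝ ∞ F U
  immersive : ∀ y ∈ U, Function.Injective (fderiv ℝ F y)
  image : ∃ O : Set Amb, IsOpen O ∧ F '' U = L ∩ O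
  inverse : ∃ G : Amb → EuclideanSpace ℝ (Fin 4),
    ContinuousOn G (F '' U) ∧ ∀ y ∈ U, G (F y) = y

/-- `L` is a coassociative submanifold of `(Λ²₋ S⁴, φ_λ)`: a smooth embedded four-dimensional
submanifold all of whose tangent spaces are calibrated by `*φ_λ`. (Then `*φ_λ` has no zero on `L`,
so it orients `L`, and `L` is calibrated for this orientation.) -/
def IsCoassociative (lam : ℝ) (L : Set Amb) : Prop :=
  L ⊆ asdBundle ∧ ∀ p ∈ L, ∃ U F, IsLocalParam L U F ∧ p ∈ F '' U ∧
    ∀ y ∈ U, IsCalibrated lam (F y) (LinearMap.range (fderiv ℝ F y).toLinearMap)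

/-! ### The action of `SU(2)` and the sets `M_{C,v}` -/

/-- `g` acting on `ℂ² ⊕ ℝ = ℝ⁵`, `z₁ = x₁ + i x₂`, `z₂ = x₃ + i x₄`. -/
def rho (g : Matrix.specialUnitaryGroup (Fin 2) ℂ) : Matrix (Fin 5) (Fin 5) ℝ :=
  let a := (g : Matrix (Fin 2) (Fin 2) ℂ)
  !![(a 0 0).re, -(a 0 0).im, (a 0 1).re, -(a 0 1).im, 0;
     (a 0 0).im,  (a 0 0).re, (a 0 1).im,  (a 0 1).re, 0;
     (a 1 0).re, -(a 1 0).im, (a 1 1).re, -(a 1 1).im, 0;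
     (a 1 0).im,  (a 1 0).re, (a 1 1).im,  (a 1 1).re, 0;
     0, 0, 0, 0, 1]

/-- The lifted action on two-forms: `g` maps `(x, A)` to `(g x, (g⁻¹)^* A)`. -/
def act (g : Matrix.specialUnitaryGroup (Fin 2) ℂ) (p : Amb) : Amb :=
  (rho g *ᵥ p.1, rho g * p.2 * (rho g)ᵀ)

/-- The orthonormal frame `e₁, …, e₄` of `S⁴` away from `x₅ = ±1`. -/
def frame (x : Fin 5 → ℝ) : Fin 4 → Fin 5 → ℝ :=
  fun i => (√(1 - x 4 ^ 2))⁻¹ •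
    (![![-x 1, x 0, -x 3, x 2, 0],
       ![-x 2, x 3, x 0, -x 1, 0],
       ![-x 3, -x 2, x 1, x 0, 0],
       ![-x 0 * x 4, -x 1 * x 4, -x 2 * x 4, -x 3 * x 4, 1 - x 4 ^ 2]] i)

/-- The point `(√(1 - x₅²), 0, 0, 0, x₅)`. -/
def arc (x₅ : ℝ) : Fin 5 → ℝ := ![√(1 - x₅ ^ 2), 0, 0, 0, x₅]

/-- The frame `e₁, …, e₄` along `arc`, extended continuously to the end points `x₅ = ±1`. -/
def arcFrame (x₅ : ℝ) : Fin 4 → Fin 5 → ℝ :=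
  ![![0, 1, 0, 0, 0], ![0, 0, 1, 0, 0], ![0, 0, 0, 1, 0], ![-x₅, 0, 0, 0, √(1 - x₅ ^ 2)]]

theorem frame_arc (x₅ : ℝ) (h : x₅ ^ 2 < 1) : frame (arc x₅) = arcFrame x₅ := by
  have h0 : 0 < 1 - x₅ ^ 2 := by linarith
  have h1 : √(1 - x₅ ^ 2) ≠ 0 := (Real.sqrt_pos.mpr h0).ne'
  have h2 : (√(1 - x₅ ^ 2))⁻¹ * (1 - x₅ ^ 2) = √(1 - x₅ ^ 2) := by
    rw [inv_mul_eq_div, div_eq_iff h1, Real.mul_self_sqrt h0.le]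
  funext i j
  fin_cases i <;> fin_cases j <;> simp [frame, arc, arcFrame, h1, h2]

/-- The forms `ω₁ = e¹² - e³⁴`, `ω₂ = e¹³ - e⁴²`, `ω₃ = e¹⁴ - e²³` of an orthonormal frame. -/
def omega (e : Fin 4 → Fin 5 → ℝ) : Fin 3 → Matrix (Fin 5) (Fin 5) ℝ :=
  ![wedge (e 0) (e 1) - wedge (e 2) (e 3), wedge (e 0) (e 2) - wedge (e 3) (e 1),
    wedge (e 0) (e 3) - wedge (e 1) (e 2)]

/-- The point of `Λ²₋ S⁴` over `arc x₅` with fibre coordinates `(a₁, a₂, a₃)`. -/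
def arcPoint (x₅ : ℝ) (a : Fin 3 → ℝ) : Amb := (arc x₅, ∑ i, a i • omega (arcFrame x₅) i)

/-- `F(r, x₅) = (1 - 3 x₅)(λ + r²)^{1/8} √r + ∫_0^{√r} 2 λ / (λ + x⁴)^{7/8} dx`. -/
def bigF (lam r x₅ : ℝ) : ℝ :=
  (1 - 3 * x₅) * (lam + r ^ 2) ^ (1 / 8 : ℝ) * √r +
    ∫ x in (0 : ℝ)..√r, 2 * lam / (lam + x ^ 4) ^ (7 / 8 : ℝ)

/-- `M_{C,v}`. -/
def setM (lam C : ℝ) (v : Fin 3 → ℝ) : Set Amb :=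
  {p | ∃ (g : Matrix.specialUnitaryGroup (Fin 2) ℂ) (r x₅ : ℝ),
    0 ≤ r ∧ -1 ≤ x₅ ∧ x₅ ≤ 1 ∧ bigF lam r x₅ = C ∧ p = act g (arcPoint x₅ (r • v))}

/-! ### The tautological line bundle over `ℂP¹` -/

/-- `ℂP¹` with the quotient topology of `ℂ² ∖ {0}`. -/
instance cpOneTopology : TopologicalSpace (Projectivization ℂ (Fin 2 → ℂ)) :=
  TopologicalSpace.coinduced
    (fun w : {w : Fin 2 → ℂ // w ≠ 0} => Projectivization.mk ℂ w.1 w.2) inferInstance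

/-- The total space of `𝒪(-1)`: pairs of a line `ℓ` in `ℂ²` and a vector of `ℓ`. -/
abbrev TautBundle : Type :=
  {q : Projectivization ℂ (Fin 2 → ℂ) × (Fin 2 → ℂ) // q.2 ∈ q.1.submodule}

end CoassS4

end

open CoassS4

namespace CoassS4

open Filter Topology

/-! ### A criterion for being coassociative -/

/-! All the data are invariant under SO(5), and SU(2) acts on the first four coordinates as left
multiplication by unit quaternions. Right multiplication by an imaginary unit quaternion commutes
with this action. It turns one fibre direction into any other, so it suffices to treat `vRef`
(`image_rightMul_setM`).

Put s = √r. For s > 0 the function F is affine in x₅ with nonzero slope, so F = C is the graph x₅ =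
`xFun lam C s`. The orbit points have the explicit form `orbitPt`: the unit quaternion w enters
through √(1 - x₅²) w and through (1 + x₅)/2 times its Hopf image. So an orbit with r > 0 is a
three-sphere for |x₅| < 1, a point at x₅ = -1 and a two-sphere in the fibre at x₅ = 1.

Calibration: rotations carry the `G₂`-frame at `basePoint r` to the points of the arc. There the
tangent space is spanned by the vectors `planeVec`, made of three rotation fields and the velocity
along the level curve. It is calibrated when one bilinear relation holds (`calibratedAt_arcPoint`).
For the level curve this relation reads (λ + s⁴) s x' = (1 - x) λ + (1/2)(1 - 3x) s⁴, which is the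
differential equation obtained by differentiating F = C (`hasDerivAt_xFun`).

Topology: F(s², -1) increases from 0 and F(s², 1) decreases from 0. So the level curve lies in the
strip |x₅| ≤ 1 exactly for s ≥ c, where it enters at x₅ = -1 if C > 0 and at x₅ = 1 if C < 0; for C
= 0 and s > 0 it stays strictly inside. The entry orbit is the origin of ℝ⁴ in one case and the zero
section ℂP¹ of the tautological bundle in the other. Smoothness there comes from the base
coordinates (`south_chart`) and from blow-up coordinates (`north_chart`). -/

/-- `L` is, near `p`, an embedded four-dimensional submanifold; a chart inverse extends to a map
that is differentiable in the ambient space. -/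
def HasChart (L : Set Amb) (p : Amb) : Prop :=
  ∃ (U : Set (EuclideanSpace ℝ (Fin 4))) (F : EuclideanSpace ℝ (Fin 4) → Amb)
    (G : Amb → EuclideanSpace ℝ (Fin 4)), IsOpen U ∧ ContDiffOn ℝ ∞ F U ∧
    (∀ y ∈ U, G (F y) = y) ∧ (∀ y ∈ U, DifferentiableAt ℝ G (F y)) ∧
    (∃ O : Set Amb, IsOpen O ∧ F '' U = L ∩ O) ∧ p ∈ F '' U

/-- `ξ` is the velocity at `p` of a curve in `L`. -/
def IsVelocity (L : Set Amb) (p ξ : Amb) : Prop :=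
  ∃ γ : ℝ → Amb, γ 0 = p ∧ HasDerivAt γ ξ 0 ∧ ∀ᶠ t in 𝓝 0, γ t ∈ L

/-- Four velocities of curves in `L` span a subspace calibrated by `*φ_λ`. -/
def CalibratedAt (lam : ℝ) (L : Set Amb) (p : Amb) : Prop :=
  ∃ (f : (Fin 7 → ℝ) →ₗ[ℝ] Amb) (w : Fin 4 → Fin 7 → ℝ), IsG2Frame lam p f ∧
    (∀ i, IsVelocity L p (f (w i))) ∧
    starPhi0 w ^ 2 = Matrix.det (Matrix.of fun i j => w i ⬝ᵥ w j) ∧ starPhi0 w ≠ 0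

theorem covec_comb {k : ℕ} (s : Fin k → Fin 7) (M : Matrix (Fin k) (Fin k) ℝ)
    (w : Fin k → Fin 7 → ℝ) :
    covec s (fun i => ∑ j, M i j • w j) = M.det * covec s w := by
  unfold covec
  rw [← Matrix.det_mul]
  congr 1
  ext a b
  simp [Matrix.mul_apply]

theorem starPhi0_comb (M : Matrix (Fin 4) (Fin 4) ℝ) (w : Fin 4 → Fin 7 → ℝ) :
    starPhi0 (fun i => ∑ j, M i j • w j) = M.det * starPhi0 w := by
  simp only [starPhi0, covec_comb]
  ring

theorem gram_comb {k n : ℕ} (M : Matrix (Fin k) (Fin k) ℝ) (w : Fin k → Fin n → ℝ) :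
    Matrix.det (Matrix.of fun i j => (∑ a, M i a • w a) ⬝ᵥ (∑ b, M j b • w b)) =
      M.det ^ 2 * Matrix.det (Matrix.of fun i j => w i ⬝ᵥ w j) := by
  have h : (Matrix.of fun i j => (∑ a, M i a • w a) ⬝ᵥ (∑ b, M j b • w b)) =
      M * (Matrix.of fun i j => w i ⬝ᵥ w j) * Mᵀ := by
    ext i j
    simp only [Matrix.of_apply, Matrix.mul_apply, Matrix.transpose_apply, sum_dotProduct,
      dotProduct_sum, smul_dotProduct, dotProduct_smul, smul_eq_mul]
    exact Finset.sum_congr rfl fun b _ => mul_comm _ _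
  rw [h, Matrix.det_mul, Matrix.det_mul, Matrix.det_transpose]
  ring

theorem linearIndependent_of_gram {k n : ℕ} {w : Fin k → Fin n → ℝ}
    (h : Matrix.det (Matrix.of fun i j => w i ⬝ᵥ w j) ≠ 0) : LinearIndependent ℝ w := by
  rw [Fintype.linearIndependent_iff]
  intro c hc
  have h1 : (Matrix.of fun i j => w i ⬝ᵥ w j) *ᵥ c = 0 := by
    ext i
    have : w i ⬝ᵥ (∑ j, c j • w j) = 0 := by rw [hc, dotProduct_zero]
    rw [dotProduct_sum] at this
    simp only [dotProduct_smul, smul_eq_mul] at this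
    simp only [Matrix.mulVec, dotProduct, Matrix.of_apply, Pi.zero_apply]
    rw [← this]
    exact Finset.sum_congr rfl fun j _ => mul_comm _ _
  intro i
  exact congrFun (Matrix.eq_zero_of_mulVec_eq_zero h h1) i

/-- Near 0 the curve γ equals F ∘ G ∘ γ, and the chain rule exhibits its velocity as a value of the
differential of F. This is why the chart inverse is required to be differentiable in the ambient
space and not merely continuous on the image. -/
theorem IsVelocity.mem_range {L : Set Amb} {p ξ : Amb} (hξ : IsVelocity L p ξ)
    {U : Set (EuclideanSpace ℝ (Fin 4))} {F : EuclideanSpace ℝ (Fin 4) → Amb}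
    {G : Amb → EuclideanSpace ℝ (Fin 4)} {y : EuclideanSpace ℝ (Fin 4)} (hy : y ∈ U)
    (hF : DifferentiableAt ℝ F y) (hGF : ∀ y ∈ U, G (F y) = y)
    (hG : DifferentiableAt ℝ G (F y)) {O : Set Amb} (hO : IsOpen O)
    (hL : F '' U = L ∩ O) (hp : F y = p) :
    ξ ∈ LinearMap.range (fderiv ℝ F y).toLinearMap := by
  obtain ⟨γ, h0, hd, hm⟩ := hξ
  have hpO : γ 0 ∈ O := by
    rw [h0, ← hp]
    exact ((hL ▸ Set.mem_image_of_mem F hy : F y ∈ L ∩ O)).2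
  have hO' : ∀ᶠ t in 𝓝 (0 : ℝ), γ t ∈ O := hd.continuousAt (hO.mem_nhds hpO)
  have he : γ =ᶠ[𝓝 0] fun t => F (G (γ t)) := by
    filter_upwards [hm, hO'] with t h1 h2
    have : γ t ∈ F '' U := hL ▸ ⟨h1, h2⟩
    obtain ⟨z, hz, hzt⟩ := this
    rw [← hzt, hGF z hz]
  have hG0 : HasFDerivAt G (fderiv ℝ G (F y)) (γ 0) := by
    rw [h0, ← hp]; exact hG.hasFDerivAt
  have h1 : HasDerivAt (fun t => G (γ t)) (fderiv ℝ G (F y) ξ) 0 := hG0.comp_hasDerivAt 0 hd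
  have hF0 : HasFDerivAt F (fderiv ℝ F y) (G (γ 0)) := by
    rw [h0, ← hp, hGF y hy]; exact hF.hasFDerivAt
  have h2 : HasDerivAt (fun t => F (G (γ t))) (fderiv ℝ F y (fderiv ℝ G (F y) ξ)) 0 :=
    hF0.comp_hasDerivAt 0 h1
  have h3 := (h2.congr_of_eventuallyEq he).unique hd
  exact ⟨_, h3⟩

/-- One basis decides: under a change of basis M, `starPhi0` is multiplied by det M and the Gram
determinant by its square. The nonzero Gram determinant makes the four velocities independent, so
they span the range of D, whose dimension is at most four. -/
theorem isCalibrated_of_calibratedAt {lam : ℝ} {L : Set Amb} {p : Amb}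
    (h : CalibratedAt lam L p) {D : EuclideanSpace ℝ (Fin 4) →ₗ[ℝ] Amb}
    (hD : ∀ ξ, IsVelocity L p ξ → ξ ∈ LinearMap.range D) :
    IsCalibrated lam p (LinearMap.range D) := by
  obtain ⟨f, w, hf, hw, hg, hn⟩ := h
  have hg0 : Matrix.det (Matrix.of fun i j => w i ⬝ᵥ w j) ≠ 0 := by
    rw [← hg]; exact pow_ne_zero 2 hn
  have hli : LinearIndependent ℝ w := linearIndependent_of_gram hg0
  have hli' : LinearIndependent ℝ (f ∘ w) := hli.map' f (LinearMap.ker_eq_bot.mpr hf.1)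
  have hle : Submodule.span ℝ (Set.range (f ∘ w)) ≤ LinearMap.range D := by
    rw [Submodule.span_le]
    rintro _ ⟨i, rfl⟩
    exact hD _ (hw i)
  have heq : Submodule.span ℝ (Set.range (f ∘ w)) = LinearMap.range D := by
    refine Submodule.eq_of_le_of_finrank_le hle ?_
    rw [finrank_span_eq_card hli']
    refine (LinearMap.finrank_range_le D).trans ?_
    simp
  refine ⟨f, hf, ?_, ?_⟩
  · intro X hX
    rw [← heq, Set.range_comp, ← Submodule.map_span] at hX
    obtain ⟨u, -, rfl⟩ := hX
    exact ⟨u, rfl⟩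
  · intro u hu
    have hM : ∀ i, ∃ c : Fin 4 → ℝ, ∑ j, c j • w j = u i := by
      intro i
      have h1 := hu i
      rw [← heq, Submodule.mem_span_range_iff_exists_fun] at h1
      obtain ⟨c, hc⟩ := h1
      refine ⟨c, hf.1 ?_⟩
      rw [← hc]
      simp [map_sum]
    choose M hM using hM
    have hu' : u = fun i => ∑ j, Matrix.of M i j • w j := by
      funext i
      simp only [Matrix.of_apply, hM]
    rw [hu', starPhi0_comb, gram_comb, ← hg, ← mul_pow, Real.sqrt_sq_eq_abs]

/-- Separates the differential topology from the calibration, which may then be checked with any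
convenient curves. Immersivity comes from differentiating G ∘ F = id. -/
theorem isCoassociative_of_charts {lam : ℝ} {L : Set Amb} (hL : L ⊆ asdBundle)
    (hc : ∀ p ∈ L, HasChart L p) (hcal : ∀ p ∈ L, CalibratedAt lam L p) :
    IsCoassociative lam L := by
  refine ⟨hL, fun p hp => ?_⟩
  obtain ⟨U, F, G, hU, hF, hGF, hG, ⟨O, hO, hFU⟩, hpF⟩ := hc p hp
  have hFd : ∀ y ∈ U, DifferentiableAt ℝ F y := fun y hy =>
    (hF.contDiffAt (hU.mem_nhds hy)).differentiableAt (by simp)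
  refine ⟨U, F, ⟨hU, hF, ?_, ⟨O, hO, hFU⟩, ⟨G, ?_, hGF⟩⟩, hpF, ?_⟩
  · intro y hy
    have h1 : HasFDerivAt (fun z => G (F z)) ((fderiv ℝ G (F y)).comp (fderiv ℝ F y)) y :=
      (hG y hy).hasFDerivAt.comp y (hFd y hy).hasFDerivAt
    have h2 : HasFDerivAt (fun z => G (F z)) (ContinuousLinearMap.id ℝ _) y :=
      (hasFDerivAt_id y).congr_of_eventuallyEq
        (by filter_upwards [hU.mem_nhds hy] with z hz using hGF z hz)
    have h3 := h1.unique h2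
    intro a b hab
    have := congrArg (fun T => T a) h3
    have h4 := congrArg (fun T => T b) h3
    simp only [ContinuousLinearMap.comp_apply, ContinuousLinearMap.id_apply] at this h4
    rw [← this, hab, h4]
  · rintro _ ⟨y, hy, rfl⟩
    exact (hG y hy).continuousAt.continuousWithinAt
  · intro y hy
    have hyL : F y ∈ L := ((hFU ▸ Set.mem_image_of_mem F hy : F y ∈ L ∩ O)).1
    exact isCalibrated_of_calibratedAt (hcal _ hyL) fun ξ hξ =>
      hξ.mem_range hy (hFd y hy) hGF (hG y hy) hO hFU rfl

end CoassS4

namespace CoassS4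

open Filter Topology

/-! ### The action of `SO(5)` -/

/-- A linear map `O` of `ℝ⁵` acting on points and on two-forms. -/
def actM (O : Matrix (Fin 5) (Fin 5) ℝ) : Amb →ₗ[ℝ] Amb where
  toFun p := (O *ᵥ p.1, O * p.2 * Oᵀ)
  map_add' p q := by simp [Matrix.mulVec_add, Matrix.mul_add, Matrix.add_mul]
  map_smul' c p := by simp [Matrix.mulVec_smul]

theorem actM_fst (O : Matrix (Fin 5) (Fin 5) ℝ) (p : Amb) : (actM O p).1 = O *ᵥ p.1 := rfl

theorem actM_snd (O : Matrix (Fin 5) (Fin 5) ℝ) (p : Amb) : (actM O p).2 = O * p.2 * Oᵀ := rfl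

theorem actM_mul (O Q : Matrix (Fin 5) (Fin 5) ℝ) (p : Amb) :
    actM (O * Q) p = actM O (actM Q p) := by
  ext1
  · simp [actM_fst]
  · simp only [actM_snd, Matrix.transpose_mul, Matrix.mul_assoc]

theorem actM_one (p : Amb) : actM 1 p = p := by
  ext1 <;> simp [actM_fst, actM_snd]

theorem continuous_actM (O : Matrix (Fin 5) (Fin 5) ℝ) : Continuous (actM O) :=
  (actM O).continuous_of_finiteDimensional

/-- Membership in `SO(5)`, in the form in which it is used. -/
structure IsRot (O : Matrix (Fin 5) (Fin 5) ℝ) : Prop where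
  mul_transpose : O * Oᵀ = 1
  transpose_mul : Oᵀ * O = 1
  det_eq : O.det = 1

theorem isRot_of {O : Matrix (Fin 5) (Fin 5) ℝ} (h : O * Oᵀ = 1) (hd : O.det = 1) : IsRot O :=
  ⟨h, mul_eq_one_comm.mp h, hd⟩

theorem IsRot.transpose {O : Matrix (Fin 5) (Fin 5) ℝ} (h : IsRot O) : IsRot Oᵀ :=
  ⟨by simpa using h.transpose_mul, by simpa using h.mul_transpose, by simpa using h.det_eq⟩

theorem IsRot.mul {O Q : Matrix (Fin 5) (Fin 5) ℝ} (hO : IsRot O) (hQ : IsRot Q) :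
    IsRot (O * Q) := by
  refine isRot_of ?_ (by rw [Matrix.det_mul, hO.det_eq, hQ.det_eq, one_mul])
  rw [Matrix.transpose_mul, Matrix.mul_assoc, ← Matrix.mul_assoc Q, hQ.mul_transpose,
    Matrix.one_mul, hO.mul_transpose]

theorem IsRot.actM_actM_transpose {O : Matrix (Fin 5) (Fin 5) ℝ} (h : IsRot O) (p : Amb) :
    actM O (actM Oᵀ p) = p := by
  rw [← actM_mul, h.mul_transpose, actM_one]

theorem IsRot.actM_transpose_actM {O : Matrix (Fin 5) (Fin 5) ℝ} (h : IsRot O) (p : Amb) :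
    actM Oᵀ (actM O p) = p := by
  rw [← actM_mul, h.transpose_mul, actM_one]

theorem IsRot.dot {O : Matrix (Fin 5) (Fin 5) ℝ} (h : IsRot O) (x y : Fin 5 → ℝ) :
    (O *ᵥ x) ⬝ᵥ (O *ᵥ y) = x ⬝ᵥ y := by
  rw [Matrix.dotProduct_mulVec, Matrix.vecMul_mulVec, h.transpose_mul, Matrix.vecMul_one]

/-- The action of a rotation as a homeomorphism of the ambient space. -/
def IsRot.homeo {O : Matrix (Fin 5) (Fin 5) ℝ} (h : IsRot O) : Amb ≃ₜ Amb where
  toFun := actM O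
  invFun := actM Oᵀ
  left_inv := h.actM_transpose_actM
  right_inv := h.actM_actM_transpose
  continuous_toFun := continuous_actM O
  continuous_invFun := continuous_actM Oᵀ

theorem conj_injective {O A B : Matrix (Fin 5) (Fin 5) ℝ} (h : IsRot O)
    (hAB : O * A * Oᵀ = O * B * Oᵀ) : A = B := by
  have h1 : Oᵀ * (O * A * Oᵀ) * O = Oᵀ * (O * B * Oᵀ) * O := by rw [hAB]
  have h2 : ∀ A, Oᵀ * (O * A * Oᵀ) * O = A := fun A => by
    calc Oᵀ * (O * A * Oᵀ) * O = (Oᵀ * O) * A * (Oᵀ * O) := by simp only [Matrix.mul_assoc]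
      _ = A := by rw [h.transpose_mul, Matrix.one_mul, Matrix.mul_one]
  rwa [h2, h2] at h1

theorem det_rows_eq_sum (m : Fin 5 → Fin 5 → ℝ) (k : Fin 5) :
    Matrix.det (Matrix.of m) =
      ∑ i, m k i * Matrix.det (Matrix.of (Function.update m k (Pi.single i 1))) := by
  rw [Matrix.det_eq_sum_mul_adjugate_row (Matrix.of m) k]
  refine Finset.sum_congr rfl fun i _ => ?_
  rw [Matrix.adjugate_apply]
  rfl

theorem det_rows_expand_one (x a b c d : Fin 5 → ℝ) :
    Matrix.det (Matrix.of ![x, a, b, c, d]) =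
      ∑ i, a i * Matrix.det (Matrix.of ![x, Pi.single i 1, b, c, d]) := by
  rw [det_rows_eq_sum _ 1]
  refine Finset.sum_congr rfl fun i _ => ?_
  congr 3
  funext j
  fin_cases j <;> rfl

theorem det_rows_expand_two (x a b c d : Fin 5 → ℝ) :
    Matrix.det (Matrix.of ![x, a, b, c, d]) =
      ∑ i, b i * Matrix.det (Matrix.of ![x, a, Pi.single i 1, c, d]) := by
  rw [det_rows_eq_sum _ 2]
  refine Finset.sum_congr rfl fun i _ => ?_
  congr 3
  funext j
  fin_cases j <;> rfl

theorem det_rows_expand_three (x a b c d : Fin 5 → ℝ) :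
    Matrix.det (Matrix.of ![x, a, b, c, d]) =
      ∑ i, c i * Matrix.det (Matrix.of ![x, a, b, Pi.single i 1, d]) := by
  rw [det_rows_eq_sum _ 3]
  refine Finset.sum_congr rfl fun i _ => ?_
  congr 3
  funext j
  fin_cases j <;> rfl

theorem det_rows_expand_four (x a b c d : Fin 5 → ℝ) :
    Matrix.det (Matrix.of ![x, a, b, c, d]) =
      ∑ i, d i * Matrix.det (Matrix.of ![x, a, b, c, Pi.single i 1]) := by
  rw [det_rows_eq_sum _ 4]
  refine Finset.sum_congr rfl fun i _ => ?_
  congr 3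
  funext j
  fin_cases j <;> rfl

theorem IsRot.det_rows {O : Matrix (Fin 5) (Fin 5) ℝ} (h : IsRot O) (x a b c d : Fin 5 → ℝ) :
    Matrix.det (Matrix.of ![O *ᵥ x, O *ᵥ a, O *ᵥ b, O *ᵥ c, O *ᵥ d]) =
      Matrix.det (Matrix.of ![x, a, b, c, d]) := by
  have h1 : Matrix.of ![O *ᵥ x, O *ᵥ a, O *ᵥ b, O *ᵥ c, O *ᵥ d] =
      Matrix.of ![x, a, b, c, d] * Oᵀ := by
    ext i j
    fin_cases i <;>
      simp [Matrix.mul_apply, Matrix.mulVec, dotProduct, mul_comm]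
  rw [h1, Matrix.det_mul, Matrix.det_transpose, h.det_eq, mul_one]

/-- Multilinearity of the determinant moves O out of A on the left side and out of the indices k, l
on the right side. What remains are two contractions of the same A, with determinants that agree
because the k-th basis vector is O applied to the k-th row of O and det O = 1. -/
theorem hodge_conj {O : Matrix (Fin 5) (Fin 5) ℝ} (h : IsRot O) (x : Fin 5 → ℝ)
    (A : Matrix (Fin 5) (Fin 5) ℝ) :
    hodge (O *ᵥ x) (O * A * Oᵀ) = O * hodge x A * Oᵀ := by
  ext k l
  have hR : (O * hodge x A * Oᵀ) k l =
      (1 / 2) * ∑ a, ∑ b, A a b *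
        Matrix.det (Matrix.of ![x, Pi.single a 1, Pi.single b 1, O k, O l]) := by
    have h1 : ∀ a b, Matrix.det (Matrix.of ![x, Pi.single a 1, Pi.single b 1, O k, O l]) =
        ∑ c, ∑ d, O k c * O l d *
          Matrix.det (Matrix.of ![x, Pi.single a 1, Pi.single b 1, Pi.single c 1,
            Pi.single d 1]) := by
      intro a b
      rw [det_rows_expand_three]
      refine Finset.sum_congr rfl fun c _ => ?_
      rw [det_rows_expand_four, Finset.mul_sum]
      exact Finset.sum_congr rfl fun d _ => by ring
    simp only [h1, Matrix.mul_apply, hodge, Matrix.of_apply, Matrix.transpose_apply,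
      Finset.mul_sum, Finset.sum_mul]
    rw [Finset.sum_comm]
    calc _ = ∑ c, ∑ d, ∑ a, ∑ b, O k c * (1 / 2 * (A a b * Matrix.det (Matrix.of
          ![x, Pi.single a 1, Pi.single b 1, Pi.single c 1, Pi.single d 1]))) * O l d := rfl
      _ = ∑ c, ∑ a, ∑ d, ∑ b, O k c * (1 / 2 * (A a b * Matrix.det (Matrix.of
          ![x, Pi.single a 1, Pi.single b 1, Pi.single c 1, Pi.single d 1]))) * O l d :=
        Finset.sum_congr rfl fun c _ => Finset.sum_comm
      _ = ∑ a, ∑ c, ∑ b, ∑ d, O k c * (1 / 2 * (A a b * Matrix.det (Matrix.of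
          ![x, Pi.single a 1, Pi.single b 1, Pi.single c 1, Pi.single d 1]))) * O l d := by
        rw [Finset.sum_comm]
        exact Finset.sum_congr rfl fun a _ => Finset.sum_congr rfl fun c _ => Finset.sum_comm
      _ = _ := by
        refine Finset.sum_congr rfl fun a _ => ?_
        rw [Finset.sum_comm]
        refine Finset.sum_congr rfl fun b _ => Finset.sum_congr rfl fun c _ =>
          Finset.sum_congr rfl fun d _ => ?_
        ring
  have hL : hodge (O *ᵥ x) (O * A * Oᵀ) k l =
      (1 / 2) * ∑ a, ∑ b, A a b *
        Matrix.det (Matrix.of ![O *ᵥ x, O *ᵥ Pi.single a 1, O *ᵥ Pi.single b 1,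
          Pi.single k 1, Pi.single l 1]) := by
    have h1 : ∀ a b, Matrix.det (Matrix.of ![O *ᵥ x, O *ᵥ Pi.single a 1, O *ᵥ Pi.single b 1,
          Pi.single k 1, Pi.single l 1]) =
        ∑ i, ∑ j, O i a * O j b *
          Matrix.det (Matrix.of ![O *ᵥ x, Pi.single i 1, Pi.single j 1, Pi.single k 1,
            Pi.single l 1]) := by
      intro a b
      rw [det_rows_expand_one]
      refine Finset.sum_congr rfl fun c _ => ?_
      rw [det_rows_expand_two, Finset.mul_sum]
      refine Finset.sum_congr rfl fun d _ => ?_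
      simp only [Matrix.mulVec_single_one, Matrix.col_apply]
      ring
    simp only [h1, Matrix.mul_apply, hodge, Matrix.of_apply, Matrix.transpose_apply,
      Finset.mul_sum, Finset.sum_mul]
    calc _ = ∑ i, ∑ j, ∑ b, ∑ a, 1 / 2 * (O i a * A a b * O j b * Matrix.det (Matrix.of
          ![O *ᵥ x, Pi.single i 1, Pi.single j 1, Pi.single k 1, Pi.single l 1])) := rfl
      _ = ∑ i, ∑ b, ∑ j, ∑ a, 1 / 2 * (O i a * A a b * O j b * Matrix.det (Matrix.of
          ![O *ᵥ x, Pi.single i 1, Pi.single j 1, Pi.single k 1, Pi.single l 1])) :=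
        Finset.sum_congr rfl fun c _ => Finset.sum_comm
      _ = ∑ b, ∑ i, ∑ a, ∑ j, 1 / 2 * (O i a * A a b * O j b * Matrix.det (Matrix.of
          ![O *ᵥ x, Pi.single i 1, Pi.single j 1, Pi.single k 1, Pi.single l 1])) := by
        rw [Finset.sum_comm]
        exact Finset.sum_congr rfl fun a _ => Finset.sum_congr rfl fun c _ => Finset.sum_comm
      _ = ∑ b, ∑ a, ∑ i, ∑ j, 1 / 2 * (O i a * A a b * O j b * Matrix.det (Matrix.of
          ![O *ᵥ x, Pi.single i 1, Pi.single j 1, Pi.single k 1, Pi.single l 1])) :=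
        Finset.sum_congr rfl fun c _ => Finset.sum_comm
      _ = _ := by
        rw [Finset.sum_comm]
        refine Finset.sum_congr rfl fun b _ => Finset.sum_congr rfl fun c _ =>
          Finset.sum_congr rfl fun d _ => Finset.sum_congr rfl fun e _ => ?_
        ring
  rw [hL, hR]
  have hk : ∀ k, (Pi.single k 1 : Fin 5 → ℝ) = O *ᵥ O k := by
    intro k
    ext i
    have := congrFun (congrFun h.mul_transpose i) k
    rw [Matrix.mul_apply] at this
    simp only [Matrix.mulVec, dotProduct]
    simp only [Matrix.transpose_apply] at this
    rw [this, Matrix.one_apply, Pi.single_apply]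
  congr 1
  refine Finset.sum_congr rfl fun a _ => Finset.sum_congr rfl fun b _ => ?_
  rw [hk k, hk l, h.det_rows]

theorem trace_conj {O : Matrix (Fin 5) (Fin 5) ℝ} (h : IsRot O) (A : Matrix (Fin 5) (Fin 5) ℝ) :
    Matrix.trace (O * A * Oᵀ) = Matrix.trace A := by
  rw [Matrix.trace_mul_comm, ← Matrix.mul_assoc, h.transpose_mul, Matrix.one_mul]

theorem conj_mul {O : Matrix (Fin 5) (Fin 5) ℝ} (h : IsRot O) (A B : Matrix (Fin 5) (Fin 5) ℝ) :
    O * A * Oᵀ * (O * B * Oᵀ) = O * (A * B) * Oᵀ := by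
  calc O * A * Oᵀ * (O * B * Oᵀ) = O * A * (Oᵀ * O) * B * Oᵀ := by simp only [Matrix.mul_assoc]
    _ = _ := by rw [h.transpose_mul, Matrix.mul_one]; simp only [Matrix.mul_assoc]

theorem conj_mulVec {O : Matrix (Fin 5) (Fin 5) ℝ} (h : IsRot O) (A : Matrix (Fin 5) (Fin 5) ℝ)
    (x : Fin 5 → ℝ) : (O * A * Oᵀ) *ᵥ (O *ᵥ x) = O *ᵥ (A *ᵥ x) := by
  rw [Matrix.mulVec_mulVec, Matrix.mul_assoc, h.transpose_mul, Matrix.mul_one,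
    Matrix.mulVec_mulVec]

theorem normSq_eq_trace (A : Matrix (Fin 5) (Fin 5) ℝ) :
    normSq A = (1 / 4) * Matrix.trace (A * Aᵀ) := by
  simp [normSq, Matrix.trace, Matrix.mul_apply, sq]

theorem normSq_conj {O : Matrix (Fin 5) (Fin 5) ℝ} (h : IsRot O)
    (A : Matrix (Fin 5) (Fin 5) ℝ) : normSq (O * A * Oᵀ) = normSq A := by
  have : (O * A * Oᵀ)ᵀ = O * Aᵀ * Oᵀ := by
    simp [Matrix.transpose_mul, Matrix.mul_assoc]
  rw [normSq_eq_trace, this, conj_mul h, trace_conj h, normSq_eq_trace]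

theorem vert_conj {O : Matrix (Fin 5) (Fin 5) ℝ} (h : IsRot O) (p X : Amb) :
    vert (actM O p) (actM O X) = O * vert p X * Oᵀ := by
  have h1 : (1 : Matrix (Fin 5) (Fin 5) ℝ) - Matrix.vecMulVec (O *ᵥ p.1) (O *ᵥ p.1) =
      O * (1 - Matrix.vecMulVec p.1 p.1) * Oᵀ := by
    rw [Matrix.mul_sub, Matrix.sub_mul, Matrix.mul_one, h.mul_transpose, Matrix.mul_vecMulVec,
      Matrix.vecMulVec_mul, Matrix.vecMul_transpose]
  rw [vert, vert, actM_fst, actM_snd, h1, conj_mul h, conj_mul h]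

/-- Every ingredient is a dot product or a trace and so is unchanged. Hence the frame computed at
`basePoint r` can be transported by rotations. -/
theorem phi_actM {O : Matrix (Fin 5) (Fin 5) ℝ} (h : IsRot O) (lam : ℝ) (p : Amb)
    (X : Fin 3 → Amb) : phi lam (actM O p) (fun i => actM O (X i)) = phi lam p X := by
  have h1 : dTau (fun i => actM O (X i)) = dTau X := by
    simp only [dTau, actM_fst, actM_snd, conj_mulVec h, h.dot]
  have h2 : volV (actM O p) (fun i => actM O (X i)) = volV p X := by
    simp only [volV, vert_conj h, conj_mul h, trace_conj h]
  have h3 : sFun lam (actM O p).2 = sFun lam p.2 := by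
    simp only [sFun, actM_snd, normSq_conj h]
  rw [phi, phi, h1, h2, h3]

theorem transpose_conj_iff {O : Matrix (Fin 5) (Fin 5) ℝ} (h : IsRot O)
    (A : Matrix (Fin 5) (Fin 5) ℝ) : (O * A * Oᵀ)ᵀ = -(O * A * Oᵀ) ↔ Aᵀ = -A := by
  have h1 : (O * A * Oᵀ)ᵀ = O * Aᵀ * Oᵀ := by
    simp [Matrix.transpose_mul, Matrix.mul_assoc]
  have h2 : -(O * A * Oᵀ) = O * (-A) * Oᵀ := by simp
  rw [h1, h2]
  exact ⟨conj_injective h, fun h => by rw [h]⟩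

theorem mulVec_eq_zero_iff {O : Matrix (Fin 5) (Fin 5) ℝ} (h : IsRot O) (x : Fin 5 → ℝ) :
    O *ᵥ x = 0 ↔ x = 0 := by
  refine ⟨fun hx => ?_, fun hx => by rw [hx, Matrix.mulVec_zero]⟩
  have : Oᵀ *ᵥ (O *ᵥ x) = 0 := by rw [hx, Matrix.mulVec_zero]
  rwa [Matrix.mulVec_mulVec, h.transpose_mul, Matrix.one_mulVec] at this

theorem isTangent_actM {O : Matrix (Fin 5) (Fin 5) ℝ} (h : IsRot O) (p X : Amb) :
    IsTangent (actM O p) (actM O X) ↔ IsTangent p X := by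
  simp only [IsTangent, actM_fst, actM_snd]
  rw [h.dot, transpose_conj_iff h, conj_mulVec h, conj_mulVec h, ← Matrix.mulVec_add,
    mulVec_eq_zero_iff h, hodge_conj h, hodge_conj h, ← Matrix.add_mul, ← Matrix.mul_add,
    show -(O * X.2 * Oᵀ) = O * (-X.2) * Oᵀ by simp]
  exact and_congr_right fun _ => and_congr_right fun _ => and_congr_right fun _ =>
    ⟨conj_injective h, fun h => by rw [h]⟩

theorem actM_mem_asdBundle {O : Matrix (Fin 5) (Fin 5) ℝ} (h : IsRot O) (p : Amb) :
    actM O p ∈ asdBundle ↔ p ∈ asdBundle := by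
  simp only [asdBundle, Set.mem_ofPred_eq, actM_fst, actM_snd]
  rw [h.dot, transpose_conj_iff h, conj_mulVec h, mulVec_eq_zero_iff h, hodge_conj h,
    show -(O * p.2 * Oᵀ) = O * (-p.2) * Oᵀ by simp]
  exact and_congr_right fun _ => and_congr_right fun _ => and_congr_right fun _ =>
    ⟨conj_injective h, fun h => by rw [h]⟩

theorem IsG2Frame.rot {O : Matrix (Fin 5) (Fin 5) ℝ} (h : IsRot O) {lam : ℝ} {p : Amb}
    {f : (Fin 7 → ℝ) →ₗ[ℝ] Amb} (hf : IsG2Frame lam p f) :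
    IsG2Frame lam (actM O p) (actM O ∘ₗ f) := by
  obtain ⟨h1, h2, h3⟩ := hf
  refine ⟨?_, ?_, ?_⟩
  · exact h.homeo.injective.comp h1
  · intro X
    have hX : X = actM O (actM Oᵀ X) := (h.actM_actM_transpose X).symm
    rw [hX, isTangent_actM h, ← h2]
    constructor
    · rintro ⟨u, hu⟩
      exact ⟨u, h.homeo.injective hu⟩
    · rintro ⟨u, hu⟩
      exact ⟨u, congrArg (actM O) hu⟩
  · intro u
    rw [← h3]
    exact phi_actM h lam p _

theorem HasChart.rot {O : Matrix (Fin 5) (Fin 5) ℝ} (h : IsRot O) {L : Set Amb} {p : Amb}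
    (hp : HasChart L p) : HasChart (actM O '' L) (actM O p) := by
  obtain ⟨U, F, G, hU, hF, hGF, hG, ⟨V, hV, hFU⟩, hpF⟩ := hp
  have hs : ∀ Q, ContDiff ℝ ∞ (actM Q) := fun Q =>
    (LinearMap.toContinuousLinearMap (actM Q)).contDiff
  refine ⟨U, actM O ∘ F, G ∘ actM Oᵀ, hU, (hs O).comp_contDiffOn hF, ?_, ?_,
    ⟨actM O '' V, h.homeo.isOpenMap V hV, ?_⟩, ?_⟩
  · intro y hy
    simp only [Function.comp, h.actM_transpose_actM, hGF y hy]
  · intro y hy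
    refine DifferentiableAt.comp _ ?_ ((hs Oᵀ).differentiable (by simp) _)
    simp only [Function.comp, h.actM_transpose_actM]
    exact hG y hy
  · rw [Set.image_comp, hFU]
    exact Set.image_inter h.homeo.injective
  · rw [Set.image_comp]
    exact Set.mem_image_of_mem _ hpF

theorem IsVelocity.rot {O : Matrix (Fin 5) (Fin 5) ℝ} {L : Set Amb} {p ξ : Amb}
    (hξ : IsVelocity L p ξ) : IsVelocity (actM O '' L) (actM O p) (actM O ξ) := by
  obtain ⟨γ, h0, hd, hm⟩ := hξ
  refine ⟨fun t => actM O (γ t), congrArg (actM O) h0, ?_, ?_⟩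
  · exact (LinearMap.toContinuousLinearMap (actM O)).hasFDerivAt.comp_hasDerivAt 0 hd
  · filter_upwards [hm] with t ht using Set.mem_image_of_mem _ ht

theorem CalibratedAt.rot {O : Matrix (Fin 5) (Fin 5) ℝ} (h : IsRot O) {lam : ℝ} {L : Set Amb}
    {p : Amb} (hp : CalibratedAt lam L p) : CalibratedAt lam (actM O '' L) (actM O p) := by
  obtain ⟨f, w, hf, hw, hg, hn⟩ := hp
  exact ⟨actM O ∘ₗ f, w, hf.rot h, fun i => (hw i).rot, hg, hn⟩

end CoassS4

namespace CoassS4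

/-! ### Explicit determinants and the Hodge star in coordinates. -/

theorem det_fin_four' (A : Matrix (Fin 4) (Fin 4) ℝ) :
    A.det =
      (A 0 0 * A 1 1 - A 0 1 * A 1 0) * (A 2 2 * A 3 3 - A 2 3 * A 3 2)
      - (A 0 0 * A 1 2 - A 0 2 * A 1 0) * (A 2 1 * A 3 3 - A 2 3 * A 3 1)
      + (A 0 0 * A 1 3 - A 0 3 * A 1 0) * (A 2 1 * A 3 2 - A 2 2 * A 3 1)
      + (A 0 1 * A 1 2 - A 0 2 * A 1 1) * (A 2 0 * A 3 3 - A 2 3 * A 3 0)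
      - (A 0 1 * A 1 3 - A 0 3 * A 1 1) * (A 2 0 * A 3 2 - A 2 2 * A 3 0)
      + (A 0 2 * A 1 3 - A 0 3 * A 1 2) * (A 2 0 * A 3 1 - A 2 1 * A 3 0) := by
  rw [Matrix.det_succ_row_zero]
  simp only [Fin.sum_univ_four, Matrix.det_fin_three, Matrix.submatrix_apply]
  simp [Fin.succAbove]
  ring

theorem det_rows_five (x a b c d : Fin 5 → ℝ) :
    Matrix.det (Matrix.of ![x, a, b, c, d]) =
      x 0 * ((a 1 * b 2 - a 2 * b 1) * (c 3 * d 4 - c 4 * d 3)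
        - (a 1 * b 3 - a 3 * b 1) * (c 2 * d 4 - c 4 * d 2)
        + (a 1 * b 4 - a 4 * b 1) * (c 2 * d 3 - c 3 * d 2)
        + (a 2 * b 3 - a 3 * b 2) * (c 1 * d 4 - c 4 * d 1)
        - (a 2 * b 4 - a 4 * b 2) * (c 1 * d 3 - c 3 * d 1)
        + (a 3 * b 4 - a 4 * b 3) * (c 1 * d 2 - c 2 * d 1)) +
      x 1 * (-(a 0 * b 2 - a 2 * b 0) * (c 3 * d 4 - c 4 * d 3)
        + (a 0 * b 3 - a 3 * b 0) * (c 2 * d 4 - c 4 * d 2)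
        - (a 0 * b 4 - a 4 * b 0) * (c 2 * d 3 - c 3 * d 2)
        - (a 2 * b 3 - a 3 * b 2) * (c 0 * d 4 - c 4 * d 0)
        + (a 2 * b 4 - a 4 * b 2) * (c 0 * d 3 - c 3 * d 0)
        - (a 3 * b 4 - a 4 * b 3) * (c 0 * d 2 - c 2 * d 0)) +
      x 2 * ((a 0 * b 1 - a 1 * b 0) * (c 3 * d 4 - c 4 * d 3)
        - (a 0 * b 3 - a 3 * b 0) * (c 1 * d 4 - c 4 * d 1)
        + (a 0 * b 4 - a 4 * b 0) * (c 1 * d 3 - c 3 * d 1)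
        + (a 1 * b 3 - a 3 * b 1) * (c 0 * d 4 - c 4 * d 0)
        - (a 1 * b 4 - a 4 * b 1) * (c 0 * d 3 - c 3 * d 0)
        + (a 3 * b 4 - a 4 * b 3) * (c 0 * d 1 - c 1 * d 0)) +
      x 3 * (-(a 0 * b 1 - a 1 * b 0) * (c 2 * d 4 - c 4 * d 2)
        + (a 0 * b 2 - a 2 * b 0) * (c 1 * d 4 - c 4 * d 1)
        - (a 0 * b 4 - a 4 * b 0) * (c 1 * d 2 - c 2 * d 1)
        - (a 1 * b 2 - a 2 * b 1) * (c 0 * d 4 - c 4 * d 0)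
        + (a 1 * b 4 - a 4 * b 1) * (c 0 * d 2 - c 2 * d 0)
        - (a 2 * b 4 - a 4 * b 2) * (c 0 * d 1 - c 1 * d 0)) +
      x 4 * ((a 0 * b 1 - a 1 * b 0) * (c 2 * d 3 - c 3 * d 2)
        - (a 0 * b 2 - a 2 * b 0) * (c 1 * d 3 - c 3 * d 1)
        + (a 0 * b 3 - a 3 * b 0) * (c 1 * d 2 - c 2 * d 1)
        + (a 1 * b 2 - a 2 * b 1) * (c 0 * d 3 - c 3 * d 0)
        - (a 1 * b 3 - a 3 * b 1) * (c 0 * d 2 - c 2 * d 0)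
        + (a 2 * b 3 - a 3 * b 2) * (c 0 * d 1 - c 1 * d 0)) := by
  rw [Matrix.det_succ_row_zero]
  simp only [Fin.sum_univ_five, det_fin_four', Matrix.submatrix_apply]
  simp [Fin.succAbove]
  ring

/-- The general skew matrix of size five. -/
def skew5 (a01 a02 a03 a04 a12 a13 a14 a23 a24 a34 : ℝ) : Matrix (Fin 5) (Fin 5) ℝ :=
  !![0, a01, a02, a03, a04;
      -a01, 0, a12, a13, a14;
      -a02, -a12, 0, a23, a24;
      -a03, -a13, -a23, 0, a34;
      -a04, -a14, -a24, -a34, 0]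

/-- Keeping the last two rows c and d general means that the expansion is done once; each entry of
the Hodge star then only substitutes basis vectors for them. -/
theorem contract_skew5 (x0 x1 x2 x3 x4 a01 a02 a03 a04 a12 a13 a14 a23 a24 a34 : ℝ)
    (c d : Fin 5 → ℝ) :
    ∑ i, ∑ j, skew5 a01 a02 a03 a04 a12 a13 a14 a23 a24 a34 i j *
      Matrix.det (Matrix.of ![![x0, x1, x2, x3, x4], Pi.single i 1, Pi.single j 1, c, d]) =
      2 * (x0 * (a12 * (c 3 * d 4 - c 4 * d 3)
        - a13 * (c 2 * d 4 - c 4 * d 2)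
        + a14 * (c 2 * d 3 - c 3 * d 2)
        + a23 * (c 1 * d 4 - c 4 * d 1)
        - a24 * (c 1 * d 3 - c 3 * d 1)
        + a34 * (c 1 * d 2 - c 2 * d 1)) +
      x1 * (-a02 * (c 3 * d 4 - c 4 * d 3)
        + a03 * (c 2 * d 4 - c 4 * d 2)
        - a04 * (c 2 * d 3 - c 3 * d 2)
        - a23 * (c 0 * d 4 - c 4 * d 0)
        + a24 * (c 0 * d 3 - c 3 * d 0)
        - a34 * (c 0 * d 2 - c 2 * d 0)) +
      x2 * (a01 * (c 3 * d 4 - c 4 * d 3)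
        - a03 * (c 1 * d 4 - c 4 * d 1)
        + a04 * (c 1 * d 3 - c 3 * d 1)
        + a13 * (c 0 * d 4 - c 4 * d 0)
        - a14 * (c 0 * d 3 - c 3 * d 0)
        + a34 * (c 0 * d 1 - c 1 * d 0)) +
      x3 * (-a01 * (c 2 * d 4 - c 4 * d 2)
        + a02 * (c 1 * d 4 - c 4 * d 1)
        - a04 * (c 1 * d 2 - c 2 * d 1)
        - a12 * (c 0 * d 4 - c 4 * d 0)
        + a14 * (c 0 * d 2 - c 2 * d 0)
        - a24 * (c 0 * d 1 - c 1 * d 0)) +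
      x4 * (a01 * (c 2 * d 3 - c 3 * d 2)
        - a02 * (c 1 * d 3 - c 3 * d 1)
        + a03 * (c 1 * d 2 - c 2 * d 1)
        + a12 * (c 0 * d 3 - c 3 * d 0)
        - a13 * (c 0 * d 2 - c 2 * d 0)
        + a23 * (c 0 * d 1 - c 1 * d 0))) := by
  simp only [det_rows_five, Fin.sum_univ_five]
  simp [skew5]
  ring

theorem hodge_skew5 (x0 x1 x2 x3 x4 a01 a02 a03 a04 a12 a13 a14 a23 a24 a34 : ℝ) :
    hodge ![x0, x1, x2, x3, x4] (skew5 a01 a02 a03 a04 a12 a13 a14 a23 a24 a34) =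
      !![0, x2 * a34 - x3 * a24 + x4 * a23, -x1 * a34 + x3 * a14 - x4 * a13,
        x1 * a24 - x2 * a14 + x4 * a12, -x1 * a23 + x2 * a13 - x3 * a12;
      -x2 * a34 + x3 * a24 - x4 * a23, 0, x0 * a34 - x3 * a04 + x4 * a03,
        -x0 * a24 + x2 * a04 - x4 * a02, x0 * a23 - x2 * a03 + x3 * a02;
      x1 * a34 - x3 * a14 + x4 * a13, -x0 * a34 + x3 * a04 - x4 * a03, 0,
        x0 * a14 - x1 * a04 + x4 * a01, -x0 * a13 + x1 * a03 - x3 * a01;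
      -x1 * a24 + x2 * a14 - x4 * a12, x0 * a24 - x2 * a04 + x4 * a02, -x0 * a14 + x1 * a04 - x4 * a01, 0, x0 * a12 - x1 * a02 + x2 * a01;
      x1 * a23 - x2 * a13 + x3 * a12, -x0 * a23 + x2 * a03 - x3 * a02, x0 * a13 - x1 * a03 + x3 * a01, -x0 * a12 + x1 * a02 - x2 * a01, 0] := by
  ext k l
  rw [hodge, Matrix.of_apply, contract_skew5]
  fin_cases k <;> fin_cases l <;> simp <;> ring

theorem eq_skew5 {A : Matrix (Fin 5) (Fin 5) ℝ} (h : Aᵀ = -A) :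
    A = skew5 (A 0 1) (A 0 2) (A 0 3) (A 0 4) (A 1 2) (A 1 3) (A 1 4) (A 2 3) (A 2 4) (A 3 4) := by
  have h1 : ∀ i j, A j i = -A i j := fun i j => congrFun (congrFun h i) j
  have h2 : ∀ i, A i i = 0 := fun i => by linarith [h1 i i]
  ext i j
  fin_cases i <;> fin_cases j <;> simp [skew5, h2]
  all_goals exact h1 _ _

theorem transpose_skew5 (a01 a02 a03 a04 a12 a13 a14 a23 a24 a34 : ℝ) :
    (skew5 a01 a02 a03 a04 a12 a13 a14 a23 a24 a34)ᵀ =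
      -skew5 a01 a02 a03 a04 a12 a13 a14 a23 a24 a34 := by
  ext i j
  fin_cases i <;> fin_cases j <;> simp [skew5]

theorem normSq_skew5 (a01 a02 a03 a04 a12 a13 a14 a23 a24 a34 : ℝ) :
    normSq (skew5 a01 a02 a03 a04 a12 a13 a14 a23 a24 a34) =
      (a01 ^ 2 + a02 ^ 2 + a03 ^ 2 + a04 ^ 2 + a12 ^ 2 + a13 ^ 2 + a14 ^ 2 + a23 ^ 2 + a24 ^ 2 +
        a34 ^ 2) / 2 := by
  simp [normSq, skew5, Fin.sum_univ_five]
  ring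

/-! ### A `G₂`-frame over the first basis vector -/

/-- The point with fibre coordinates `(0, 0, -r)` over the first basis vector of `ℝ⁵`. -/
def basePoint (r : ℝ) : Amb := (![1, 0, 0, 0, 0], skew5 0 0 0 0 0 0 (-r) r 0 0)

theorem basePoint_mem (r : ℝ) : basePoint r ∈ asdBundle := by
  refine ⟨by simp [basePoint, Fin.sum_univ_five, dotProduct],
    transpose_skew5 _ _ _ _ _ _ _ _ _ _, ?_, ?_⟩
  · ext i
    fin_cases i <;> simp [basePoint, skew5, Matrix.mulVec, dotProduct, Fin.sum_univ_five]
  · rw [basePoint, hodge_skew5]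
    ext i j
    fin_cases i <;> fin_cases j <;> simp [skew5]

theorem normSq_basePoint (r : ℝ) : normSq (basePoint r).2 = r ^ 2 := by
  rw [basePoint, normSq_skew5]
  ring

/-- The frame of vertical and horizontal vectors at `basePoint r`; `s` stands for `s_λ` and `k` for
`(√2 s_λ)⁻¹`. -/
def baseFrame (r s k : ℝ) : (Fin 7 → ℝ) →ₗ[ℝ] Amb where
  toFun u := (![0, k * u 3, k * u 4, k * u 5, k * u 6],
    skew5 (-r * (k * u 6)) (r * (k * u 5)) (-r * (k * u 4)) (r * (k * u 3)) (s * u 0) (s * u 1)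
      (s * u 2) (-(s * u 2)) (s * u 1) (-(s * u 0)))
  map_add' u w := by
    ext i
    · fin_cases i <;> simp <;> ring
    · rename_i j
      fin_cases i <;> fin_cases j <;> simp [skew5] <;> ring
  map_smul' c u := by
    ext i
    · fin_cases i <;> simp <;> ring
    · rename_i j
      fin_cases i <;> fin_cases j <;> simp [skew5] <;> ring

theorem baseFrame_apply (r s k : ℝ) (u : Fin 7 → ℝ) :
    baseFrame r s k u = (![0, k * u 3, k * u 4, k * u 5, k * u 6],
    skew5 (-r * (k * u 6)) (r * (k * u 5)) (-r * (k * u 4)) (r * (k * u 3)) (s * u 0) (s * u 1)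
      (s * u 2) (-(s * u 2)) (s * u 1) (-(s * u 0))) := rfl

theorem vert_base (r : ℝ) (x : Fin 5 → ℝ) (a01 a02 a03 a04 a12 a13 a14 a23 a24 a34 : ℝ) :
    vert (basePoint r) (x, skew5 a01 a02 a03 a04 a12 a13 a14 a23 a24 a34) =
      skew5 0 0 0 0 a12 a13 a14 a23 a24 a34 := by
  have h : (1 - Matrix.vecMulVec (basePoint r).1 (basePoint r).1) =
      Matrix.diagonal ![(0 : ℝ), 1, 1, 1, 1] := by
    ext i j
    fin_cases i <;> fin_cases j <;> simp [basePoint, Matrix.vecMulVec]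
  rw [vert, h]
  ext i j
  rw [Matrix.mul_diagonal, Matrix.diagonal_mul]
  fin_cases i <;> fin_cases j <;> simp [skew5]

/-- The entries in row and column 0 are forced by the motion of the base point. The remaining block
satisfies the anti-self-duality relations of the fixed fibre, since `hodge X.1 p.2` contributes
nothing to it when `X.1` is orthogonal to the base point. This leaves four horizontal and three
vertical parameters. -/
theorem isTangent_base_iff (r : ℝ) (X : Amb) : IsTangent (basePoint r) X ↔
    X.1 0 = 0 ∧ X.2 = skew5 (-r * X.1 4) (r * X.1 3) (-r * X.1 2) (r * X.1 1) (X.2 1 2) (X.2 1 3)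
      (X.2 1 4) (-X.2 1 4) (X.2 1 3) (-X.2 1 2) := by
  have hx : X.1 = ![X.1 0, X.1 1, X.1 2, X.1 3, X.1 4] := by
    ext i
    fin_cases i <;> rfl
  constructor
  · rintro ⟨h1, h2, h3, h4⟩
    have h0 : X.1 0 = 0 := by
      simpa [basePoint, dotProduct, Fin.sum_univ_five] using h1
    refine ⟨h0, ?_⟩
    have hA := eq_skew5 h2
    rw [hx, basePoint, hA, hodge_skew5, hodge_skew5] at h4
    have e12 := congrFun (congrFun h4 1) 2
    have e13 := congrFun (congrFun h4 1) 3
    have e14 := congrFun (congrFun h4 1) 4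
    have e01 := congrFun (congrFun h4 0) 1
    have e02 := congrFun (congrFun h4 0) 2
    have e03 := congrFun (congrFun h4 0) 3
    have e04 := congrFun (congrFun h4 0) 4
    simp [skew5, h0] at e12 e13 e14 e01 e02 e03 e04
    conv_lhs => rw [hA]
    congr 1 <;> linarith
  · rintro ⟨h0, hA⟩
    refine ⟨by simp [basePoint, dotProduct, Fin.sum_univ_five, h0], ?_, ?_, ?_⟩
    · rw [hA, transpose_skew5]
    · rw [hA]
      ext i
      fin_cases i <;> simp [basePoint, skew5, dotProduct, Fin.sum_univ_five]
    · rw [hx, basePoint, hA, hodge_skew5, hodge_skew5]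
      ext i j
      fin_cases i <;> fin_cases j <;> simp [skew5, h0] <;> ring

/-- The scales are dictated by the two terms of φ_λ: vertical vectors scaled by s give s⁻³ · s³ = 1
in front of e¹²³, and one vertical with two horizontal vectors give 2s · s k² = 1 in front of the
other six terms. -/
theorem isG2Frame_base {lam r s k : ℝ} (hs : s = (lam + r ^ 2) ^ (1 / 4 : ℝ)) (hs0 : s ≠ 0)
    (hk : 2 * s ^ 2 * k ^ 2 = 1) : IsG2Frame lam (basePoint r) (baseFrame r s k) := by
  have hk0 : k ≠ 0 := by rintro rfl; simp at hk
  refine ⟨?_, ?_, ?_⟩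
  · rw [← LinearMap.ker_eq_bot, LinearMap.ker_eq_bot']
    intro u hu
    rw [baseFrame_apply, Prod.mk_eq_zero] at hu
    obtain ⟨h1, h2⟩ := hu
    have e1 := congrFun h1 1
    have e2 := congrFun h1 2
    have e3 := congrFun h1 3
    have e4 := congrFun h1 4
    have f2 := congrFun (congrFun h2 1) 2
    have f3 := congrFun (congrFun h2 1) 3
    have f4 := congrFun (congrFun h2 1) 4
    simp [skew5, hk0, hs0] at e1 e2 e3 e4 f2 f3 f4
    ext i
    fin_cases i <;> simpa
  · intro X
    rw [isTangent_base_iff]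
    constructor
    · rintro ⟨u, rfl⟩
      refine ⟨rfl, ?_⟩
      simp only [baseFrame_apply]
      rfl
    · rintro ⟨h0, hA⟩
      refine ⟨![X.2 1 2 / s, X.2 1 3 / s, X.2 1 4 / s, X.1 1 / k, X.1 2 / k, X.1 3 / k, X.1 4 / k],
        ?_⟩
      have hx : X.1 = ![0, X.1 1, X.1 2, X.1 3, X.1 4] := by
        ext i
        fin_cases i <;> first | exact h0 | rfl
      rw [baseFrame_apply]
      refine Prod.ext ?_ ?_
      · rw [hx]
        ext i
        fin_cases i <;> simp <;> field_simp
      · rw [hA]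
        simp [mul_div_cancel₀, hs0, hk0]
        simp only [skew5]
        congr
  · intro u
    have e1 : sFun lam (basePoint r).2 = s := by
      rw [sFun, normSq_basePoint, hs]
    have e2 : volV (basePoint r) (fun i => baseFrame r s k (u i)) =
        s ^ 3 * covec ![0, 1, 2] u := by
      simp only [volV, baseFrame_apply, vert_base]
      simp [Matrix.trace, Fin.sum_univ_five, skew5, covec, Matrix.det_fin_three]
      ring
    have e3 : dTau (fun i => baseFrame r s k (u i)) =
        k ^ 2 * s * (phi0 u - covec ![0, 1, 2] u) := by
      simp only [dTau, baseFrame_apply]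
      simp [Matrix.mulVec, dotProduct, Fin.sum_univ_five, skew5, phi0, covec,
        Matrix.det_fin_three]
      ring
    rw [phi, e1, e2, e3, inv_mul_cancel_left₀ (pow_ne_zero 3 hs0)]
    linear_combination (phi0 u - covec ![0, 1, 2] u) * hk

end CoassS4

namespace CoassS4

open Filter Topology

/-! ### Explicit form of the orbits -/

/-- Left multiplication by the quaternion `w` on the first four coordinates. -/
def leftMul (w : Fin 4 → ℝ) : Matrix (Fin 5) (Fin 5) ℝ :=
  !![w 0, -w 1, -w 2, -w 3, 0;
     w 1, w 0, w 3, -w 2, 0;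
     w 2, -w 3, w 0, w 1, 0;
     w 3, w 2, -w 1, w 0, 0;
     0, 0, 0, 0, 1]

theorem dot_four (w : Fin 4 → ℝ) : w ⬝ᵥ w = w 0 ^ 2 + w 1 ^ 2 + w 2 ^ 2 + w 3 ^ 2 := by
  simp [dotProduct, Fin.sum_univ_four]
  ring

theorem isRot_leftMul {w : Fin 4 → ℝ} (hw : w ⬝ᵥ w = 1) : IsRot (leftMul w) := by
  rw [dot_four] at hw
  refine isRot_of ?_ ?_
  · ext i j
    fin_cases i <;> fin_cases j <;>
      simp [leftMul, Matrix.mul_apply, Fin.sum_univ_five] <;> linarith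
  · have : (leftMul w).det = (w 0 ^ 2 + w 1 ^ 2 + w 2 ^ 2 + w 3 ^ 2) ^ 2 := by
      rw [Matrix.det_succ_row_zero]
      simp only [Fin.sum_univ_five, det_fin_four', Matrix.submatrix_apply]
      simp [Fin.succAbove, leftMul]
      ring
    rw [this, hw, one_pow]

/-- For a unitary matrix of determinant one the conjugate transpose equals the adjugate, so the
first column determines the matrix; its four real coordinates are the quaternion w. -/
theorem exists_leftMul_eq_rho (g : Matrix.specialUnitaryGroup (Fin 2) ℂ) :
    ∃ w : Fin 4 → ℝ, w ⬝ᵥ w = 1 ∧ rho g = leftMul w := by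
  obtain ⟨a, ha⟩ := g
  rw [Matrix.mem_specialUnitaryGroup_iff] at ha
  obtain ⟨hu, hd⟩ := ha
  have h1 : star a * a = 1 := Matrix.mem_unitaryGroup_iff'.mp hu
  have hadj : star a = a.adjugate := by
    calc star a = star a * (a * a.adjugate) := by rw [Matrix.mul_adjugate, hd]; simp
      _ = _ := by rw [← Matrix.mul_assoc, h1, Matrix.one_mul]
  have e00 := congrFun (congrFun hadj 0) 0
  have e01 := congrFun (congrFun hadj 0) 1
  simp only [Matrix.adjugate_fin_two, Matrix.star_apply] at e00 e01
  have e11 : a 1 1 = star (a 0 0) := by simpa using e00.symm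
  have e10 : a 0 1 = -star (a 1 0) := by
    have : star (a 1 0) = -a 0 1 := by simpa using e01
    rw [this, neg_neg]
  refine ⟨![(a 0 0).re, (a 0 0).im, (a 1 0).re, (a 1 0).im], ?_, ?_⟩
  · rw [Matrix.det_fin_two, e11, e10] at hd
    have := congrArg Complex.re hd
    rw [dot_four]
    simp at this ⊢
    linarith
  · ext i j
    fin_cases i <;> fin_cases j <;> simp [rho, leftMul, e11, e10]

theorem exists_rho_eq_leftMul {w : Fin 4 → ℝ} (hw : w ⬝ᵥ w = 1) :
    ∃ g : Matrix.specialUnitaryGroup (Fin 2) ℂ, rho g = leftMul w := by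
  rw [dot_four] at hw
  refine ⟨⟨!![⟨w 0, w 1⟩, ⟨-w 2, w 3⟩; ⟨w 2, w 3⟩, ⟨w 0, -w 1⟩], ?_⟩, ?_⟩
  · rw [Matrix.mem_specialUnitaryGroup_iff, Matrix.mem_unitaryGroup_iff]
    refine ⟨?_, ?_⟩
    · ext i j
      fin_cases i <;> fin_cases j <;>
        simp [Matrix.mul_apply, Matrix.star_apply, Complex.ext_iff] <;>
        constructor <;> linarith
    · rw [Matrix.det_fin_two]
      simp [Complex.ext_iff]
      constructor <;> linarith
  · ext i j
    fin_cases i <;> fin_cases j <;> simp [rho, leftMul]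

theorem act_eq_actM (g : Matrix.specialUnitaryGroup (Fin 2) ℂ) (p : Amb) :
    act g p = actM (rho g) p := rfl

theorem mem_setM_iff {lam C : ℝ} {v : Fin 3 → ℝ} {p : Amb} : p ∈ setM lam C v ↔
    ∃ (w : Fin 4 → ℝ) (r x : ℝ), w ⬝ᵥ w = 1 ∧ 0 ≤ r ∧ -1 ≤ x ∧ x ≤ 1 ∧ bigF lam r x = C ∧
      p = actM (leftMul w) (arcPoint x (r • v)) := by
  constructor
  · rintro ⟨g, r, x, hr, h1, h2, hF, rfl⟩
    obtain ⟨w, hw, hg⟩ := exists_leftMul_eq_rho g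
    exact ⟨w, r, x, hw, hr, h1, h2, hF, by rw [act_eq_actM, hg]⟩
  · rintro ⟨w, r, x, hw, hr, h1, h2, hF, rfl⟩
    obtain ⟨g, hg⟩ := exists_rho_eq_leftMul hw
    exact ⟨g, r, x, hr, h1, h2, hF, by rw [act_eq_actM, hg]⟩

/-- The direction `(0, 0, -1)` in the fibre, to which all others reduce. -/
def vRef : Fin 3 → ℝ := ![0, 0, -1]

/-- The two-form of norm one on `T S⁴` with the parameters of `pt`. -/
noncomputable def skewPt (y : Fin 4 → ℝ) (x : ℝ) (m : Fin 3 → ℝ) : Matrix (Fin 5) (Fin 5) ℝ :=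
  skew5 ((1 - x) / 2 - m 0) (m 2) (-m 1) (y 1) (m 1) (m 2) (-y 0) ((1 - x) / 2 + m 0) (y 3) (-y 2)

/-- A polynomial parametrization of the points of the orbits: the base point is `(y, x)`, the
norm is `r`, and `m` is `(1 + x) / 2` times the image of `y / |y|` under the Hopf map. -/
noncomputable def pt (y : Fin 4 → ℝ) (x r : ℝ) (m : Fin 3 → ℝ) : Amb :=
  (![y 0, y 1, y 2, y 3, x], r • skewPt y x m)

/-- The (homogeneous) Hopf map. -/
def hopf (w : Fin 4 → ℝ) : Fin 3 → ℝ :=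
  ![w 0 ^ 2 + w 1 ^ 2 - w 2 ^ 2 - w 3 ^ 2, 2 * (w 0 * w 2 + w 1 * w 3),
    2 * (w 0 * w 3 - w 1 * w 2)]

/-- The point of the orbit of `arcPoint x (r • vRef)` with parameter `w` in the three-sphere. -/
noncomputable def orbitPt (w : Fin 4 → ℝ) (r x : ℝ) : Amb :=
  pt (√(1 - x ^ 2) • w) x r (((1 + x) / 2) • hopf w)

theorem arcPoint_vRef (x r : ℝ) :
    arcPoint x (r • vRef) = (arc x, r • skew5 (-x) 0 0 0 0 0 (-√(1 - x ^ 2)) 1 0 0) := by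
  refine Prod.ext rfl ?_
  simp only [arcPoint, vRef, Fin.sum_univ_three]
  ext i j
  fin_cases i <;> fin_cases j <;>
    simp [omega, arcFrame, wedge, skew5]

/-- This formula governs everything below: w occurs only in the base coordinates √(1 - x²) w and in
(1 + x)/2 times its Hopf image. Both vanish at x = -1, while at x = 1 the Hopf image survives. -/
theorem actM_leftMul_arcPoint {w : Fin 4 → ℝ} (hw : w ⬝ᵥ w = 1) (r x : ℝ) :
    actM (leftMul w) (arcPoint x (r • vRef)) = orbitPt w r x := by
  rw [dot_four] at hw
  rw [arcPoint_vRef]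
  refine Prod.ext ?_ ?_
  · rw [actM_fst]
    ext i
    fin_cases i <;> simp [leftMul, arc, orbitPt, pt, mul_comm]
  · rw [actM_snd]
    simp only [orbitPt, pt, Matrix.mul_smul, Matrix.smul_mul]
    congr 1
    ext i j
    simp only [Matrix.mul_apply, Fin.sum_univ_five]
    fin_cases i <;> fin_cases j <;> simp [leftMul, skewPt, skew5, hopf] <;>
      first | ring1 | linear_combination ((1 - x) / 2) * hw | linear_combination (-(1 - x) / 2) * hw

theorem mem_setM_vRef_iff {lam C : ℝ} {p : Amb} : p ∈ setM lam C vRef ↔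
    ∃ (w : Fin 4 → ℝ) (r x : ℝ), w ⬝ᵥ w = 1 ∧ 0 ≤ r ∧ -1 ≤ x ∧ x ≤ 1 ∧ bigF lam r x = C ∧
      p = orbitPt w r x := by
  rw [mem_setM_iff]
  constructor
  · rintro ⟨w, r, x, hw, hr, h1, h2, hF, rfl⟩
    exact ⟨w, r, x, hw, hr, h1, h2, hF, actM_leftMul_arcPoint hw r x⟩
  · rintro ⟨w, r, x, hw, hr, h1, h2, hF, rfl⟩
    exact ⟨w, r, x, hw, hr, h1, h2, hF, (actM_leftMul_arcPoint hw r x).symm⟩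

/-- The rotation that moves `basePoint r` to `arcPoint x (r • vRef)`. -/
noncomputable def arcRot (x : ℝ) : Matrix (Fin 5) (Fin 5) ℝ :=
  !![√(1 - x ^ 2), 0, 0, 0, -x;
     0, 1, 0, 0, 0;
     0, 0, 1, 0, 0;
     0, 0, 0, 1, 0;
     x, 0, 0, 0, √(1 - x ^ 2)]

theorem isRot_arcRot {x : ℝ} (h1 : -1 ≤ x) (h2 : x ≤ 1) : IsRot (arcRot x) := by
  have hc : √(1 - x ^ 2) ^ 2 = 1 - x ^ 2 := Real.sq_sqrt (by nlinarith)
  refine isRot_of ?_ ?_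
  · ext i j
    fin_cases i <;> fin_cases j <;>
      simp [arcRot, Matrix.mul_apply, Fin.sum_univ_five] <;> nlinarith
  · have : (arcRot x).det = √(1 - x ^ 2) ^ 2 + x ^ 2 := by
      rw [Matrix.det_succ_row_zero]
      simp only [Fin.sum_univ_five, det_fin_four', Matrix.submatrix_apply]
      simp [Fin.succAbove, arcRot]
      ring
    rw [this, hc]
    ring

theorem actM_arcRot_basePoint {x : ℝ} (h1 : -1 ≤ x) (h2 : x ≤ 1) (r : ℝ) :
    actM (arcRot x) (basePoint r) = arcPoint x (r • vRef) := by
  have hc : √(1 - x ^ 2) ^ 2 = 1 - x ^ 2 := Real.sq_sqrt (by nlinarith)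
  rw [arcPoint_vRef]
  refine Prod.ext ?_ ?_
  · rw [actM_fst]
    ext i
    fin_cases i <;> simp [arcRot, arc, basePoint]
  · rw [actM_snd]
    ext i j
    simp only [Matrix.mul_apply, Fin.sum_univ_five]
    fin_cases i <;> fin_cases j <;> simp [arcRot, skew5, basePoint] <;> ring

theorem orbitPt_mem_asdBundle {w : Fin 4 → ℝ} (hw : w ⬝ᵥ w = 1) (r : ℝ) {x : ℝ} (h1 : -1 ≤ x)
    (h2 : x ≤ 1) : orbitPt w r x ∈ asdBundle := by
  rw [← actM_leftMul_arcPoint hw, actM_mem_asdBundle (isRot_leftMul hw),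
    ← actM_arcRot_basePoint h1 h2, actM_mem_asdBundle (isRot_arcRot h1 h2)]
  exact basePoint_mem r

theorem normSq_orbitPt {w : Fin 4 → ℝ} (hw : w ⬝ᵥ w = 1) (r : ℝ) {x : ℝ} (h1 : -1 ≤ x)
    (h2 : x ≤ 1) : normSq (orbitPt w r x).2 = r ^ 2 := by
  rw [← actM_leftMul_arcPoint hw, actM_snd, normSq_conj (isRot_leftMul hw),
    ← actM_arcRot_basePoint h1 h2, actM_snd, normSq_conj (isRot_arcRot h1 h2), normSq_basePoint]

theorem leftMul_mul {w z : Fin 4 → ℝ} : leftMul w * leftMul z =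
    leftMul ![w 0 * z 0 - w 1 * z 1 - w 2 * z 2 - w 3 * z 3,
      w 1 * z 0 + w 0 * z 1 + w 3 * z 2 - w 2 * z 3,
      w 2 * z 0 - w 3 * z 1 + w 0 * z 2 + w 1 * z 3,
      w 3 * z 0 + w 2 * z 1 - w 1 * z 2 + w 0 * z 3] := by
  ext i j
  fin_cases i <;> fin_cases j <;>
    simp [leftMul, Matrix.mul_apply, Fin.sum_univ_five] <;> ring

theorem actM_leftMul_mem_setM {w : Fin 4 → ℝ} (hw : w ⬝ᵥ w = 1) {lam C : ℝ} {v : Fin 3 → ℝ}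
    {p : Amb} (hp : p ∈ setM lam C v) : actM (leftMul w) p ∈ setM lam C v := by
  rw [mem_setM_iff] at hp ⊢
  obtain ⟨z, r, x, hz, hr, h1, h2, hF, rfl⟩ := hp
  refine ⟨_, r, x, ?_, hr, h1, h2, hF, by rw [← actM_mul, leftMul_mul]⟩
  rw [dot_four] at hw hz ⊢
  simp
  linear_combination (z 0 ^ 2 + z 1 ^ 2 + z 2 ^ 2 + z 3 ^ 2) * hw + hz

theorem transpose_leftMul (w : Fin 4 → ℝ) : (leftMul w)ᵀ = leftMul ![w 0, -w 1, -w 2, -w 3] := by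
  ext i j
  fin_cases i <;> fin_cases j <;> simp [leftMul]

theorem mem_zeroSection_actM {O : Matrix (Fin 5) (Fin 5) ℝ} (h : IsRot O) {p : Amb} :
    actM O p ∈ zeroSection ↔ p ∈ zeroSection := by
  simp only [zeroSection, Set.mem_ofPred_eq, actM_fst, actM_snd, h.dot]
  refine and_congr_right fun _ => ⟨fun h0 => ?_, fun h0 => by rw [h0]; simp⟩
  exact conj_injective h (by rw [h0]; simp)

/-- By this invariance, charts and calibrated frames are needed only at the points of the arc, where
w = (1, 0, 0, 0). -/
theorem image_leftMul_setM {w : Fin 4 → ℝ} (hw : w ⬝ᵥ w = 1) (lam C : ℝ) (v : Fin 3 → ℝ) :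
    actM (leftMul w) '' (setM lam C v \ zeroSection) = setM lam C v \ zeroSection := by
  have hr := isRot_leftMul hw
  have h1 : ∀ z : Fin 4 → ℝ, z ⬝ᵥ z = 1 → ∀ p ∈ setM lam C v \ zeroSection,
      actM (leftMul z) p ∈ setM lam C v \ zeroSection := fun z hz p hp =>
    ⟨actM_leftMul_mem_setM hz hp.1, fun h =>
      hp.2 ((mem_zeroSection_actM (isRot_leftMul hz)).mp h)⟩
  refine Set.Subset.antisymm ?_ ?_
  · rintro _ ⟨p, hp, rfl⟩
    exact h1 w hw p hp
  · intro p hp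
    refine ⟨actM (leftMul w)ᵀ p, ?_, hr.actM_actM_transpose p⟩
    rw [transpose_leftMul]
    refine h1 _ ?_ p hp
    rw [dot_four] at hw ⊢
    simpa using hw

end CoassS4

namespace CoassS4

open Filter Topology

/-! ### Calibrated tangent spaces -/

/-- Spanning vectors of the tangent spaces of `M_{C,v}`, in the coordinates of a `G₂`-frame. -/
def planeVec (a b d α β : ℝ) : Fin 4 → Fin 7 → ℝ :=
  ![![0, 0, 0, a, 0, 0, 0], ![d, 0, 0, 0, b, 0, 0], ![0, d, 0, 0, 0, b, 0],
    ![0, 0, β, 0, 0, 0, α]]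

theorem starPhi0_planeVec (a b d α β : ℝ) :
    starPhi0 (planeVec a b d α β) = a * (α * (b ^ 2 - d ^ 2) - β * (2 * b * d)) := by
  simp only [starPhi0, covec, det_fin_four', Matrix.of_apply]
  simp [planeVec]
  ring

theorem gram_planeVec (a b d α β : ℝ) :
    Matrix.det (Matrix.of fun i j => planeVec a b d α β i ⬝ᵥ planeVec a b d α β j) =
      a ^ 2 * (b ^ 2 + d ^ 2) ^ 2 * (α ^ 2 + β ^ 2) := by
  simp only [det_fin_four', Matrix.of_apply]
  simp [planeVec]
  ring

/-- The factors α (b² - d²) - 2βbd and 2αbd + β (b² - d²) are the real and imaginary parts of (α +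
iβ)(b + id)². Their squares add up to (α² + β²)(b² + d²)². Once the imaginary part vanishes, the
square of `starPhi0` is therefore the full Gram determinant. -/
theorem calibratedAt_arcPoint {lam r x s k a b d α β : ℝ} {L : Set Amb} (h1 : -1 ≤ x) (h2 : x ≤ 1)
    (hs : s = (lam + r ^ 2) ^ (1 / 4 : ℝ)) (hs0 : s ≠ 0) (hk : 2 * s ^ 2 * k ^ 2 = 1)
    (ha : a ≠ 0) (hbd : b ^ 2 + d ^ 2 ≠ 0) (hαβ : α ^ 2 + β ^ 2 ≠ 0)
    (h : α * (2 * b * d) + β * (b ^ 2 - d ^ 2) = 0)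
    (hv : ∀ i, IsVelocity L (arcPoint x (r • vRef))
      (actM (arcRot x) (baseFrame r s k (planeVec a b d α β i)))) :
    CalibratedAt lam L (arcPoint x (r • vRef)) := by
  have hsq : starPhi0 (planeVec a b d α β) ^ 2 =
      a ^ 2 * (b ^ 2 + d ^ 2) ^ 2 * (α ^ 2 + β ^ 2) := by
    rw [starPhi0_planeVec]
    linear_combination (-a ^ 2 * (α * (2 * b * d) + β * (b ^ 2 - d ^ 2))) * h
  refine ⟨actM (arcRot x) ∘ₗ baseFrame r s k, planeVec a b d α β, ?_, hv, ?_, ?_⟩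
  · rw [← actM_arcRot_basePoint h1 h2]
    exact (isG2Frame_base hs hs0 hk).rot (isRot_arcRot h1 h2)
  · rw [hsq, gram_planeVec]
  · intro h0
    rw [h0] at hsq
    have : a ^ 2 * (b ^ 2 + d ^ 2) ^ 2 * (α ^ 2 + β ^ 2) ≠ 0 :=
      mul_ne_zero (mul_ne_zero (pow_ne_zero 2 ha) (pow_ne_zero 2 hbd)) hαβ
    exact this (by linarith)

theorem conj_arcRot_skew5 {x : ℝ} (h1 : -1 ≤ x) (h2 : x ≤ 1)
    (a01 a02 a03 a04 a12 a13 a14 a23 a24 a34 : ℝ) :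
    arcRot x * skew5 a01 a02 a03 a04 a12 a13 a14 a23 a24 a34 * (arcRot x)ᵀ =
      skew5 (√(1 - x ^ 2) * a01 + x * a14) (√(1 - x ^ 2) * a02 + x * a24)
        (√(1 - x ^ 2) * a03 + x * a34) a04 a12 a13 (√(1 - x ^ 2) * a14 - x * a01) a23
        (√(1 - x ^ 2) * a24 - x * a02) (√(1 - x ^ 2) * a34 - x * a03) := by
  have hc : √(1 - x ^ 2) ^ 2 = 1 - x ^ 2 := Real.sq_sqrt (by nlinarith)
  ext i j
  simp only [Matrix.mul_apply, Fin.sum_univ_five]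
  fin_cases i <;> fin_cases j <;> simp [arcRot, skew5] <;>
    first | ring1 | linear_combination a04 * hc | linear_combination -a04 * hc

theorem actM_arcRot_baseFrame {x : ℝ} (h1 : -1 ≤ x) (h2 : x ≤ 1) (r s k : ℝ) (u : Fin 7 → ℝ) :
    actM (arcRot x) (baseFrame r s k u) =
      (![-x * (k * u 6), k * u 3, k * u 4, k * u 5, √(1 - x ^ 2) * (k * u 6)],
        skew5 (√(1 - x ^ 2) * (-r * (k * u 6)) + x * (s * u 2))
          (√(1 - x ^ 2) * (r * (k * u 5)) + x * (s * u 1))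
          (√(1 - x ^ 2) * (-r * (k * u 4)) + x * -(s * u 0)) (r * (k * u 3)) (s * u 0) (s * u 1)
          (√(1 - x ^ 2) * (s * u 2) - x * (-r * (k * u 6))) (-(s * u 2))
          (√(1 - x ^ 2) * (s * u 1) - x * (r * (k * u 5)))
          (√(1 - x ^ 2) * -(s * u 0) - x * (-r * (k * u 4)))) := by
  refine Prod.ext ?_ ?_
  · rw [actM_fst, baseFrame_apply]
    ext i
    fin_cases i <;> simp [arcRot] <;> ring
  · rw [actM_snd, baseFrame_apply, conj_arcRot_skew5 h1 h2]

theorem hasDerivAt_of_eq {E : Type*} [NormedAddCommGroup E] [NormedSpace ℝ E] {f g : ℝ → E}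
    {a b : E} {t : ℝ} (h : HasDerivAt f a t) (hg : ∀ t, g t = f t) (hb : b = a) :
    HasDerivAt g b t := by
  rw [hb, funext hg]
  exact h

/-- `skewPt` is affine in its arguments, with x entering as (1 - x)/2. Its linear part is thus
obtained by inserting `1 + x'` in the slot of x, which gives -x'/2. -/
theorem hasDerivAt_pt {y : ℝ → Fin 4 → ℝ} {x r : ℝ → ℝ} {m : ℝ → Fin 3 → ℝ} {y' : Fin 4 → ℝ}
    {x' r' : ℝ} {m' : Fin 3 → ℝ} {t : ℝ} (hy : ∀ i, HasDerivAt (fun t => y t i) (y' i) t)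
    (hx : HasDerivAt x x' t) (hr : HasDerivAt r r' t)
    (hm : ∀ i, HasDerivAt (fun t => m t i) (m' i) t) :
    HasDerivAt (fun t => pt (y t) (x t) (r t) (m t))
      (![y' 0, y' 1, y' 2, y' 3, x'],
        r' • skewPt (y t) (x t) (m t) + r t • skewPt y' (1 + x') m') t := by
  refine HasDerivAt.prodMk ?_ ?_
  · rw [hasDerivAt_pi]
    intro i
    fin_cases i
    · exact hy 0
    · exact hy 1
    · exact hy 2
    · exact hy 3
    · exact hx
  · have hx2 : HasDerivAt (fun t => (1 - x t) / 2) ((1 - (1 + x')) / 2) t := by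
      exact hasDerivAt_of_eq ((hx.const_sub 1).div_const 2) (fun _ => rfl) (by ring)
    have h : HasDerivAt (fun t => skewPt (y t) (x t) (m t)) (skewPt y' (1 + x') m') t := by
      refine hasDerivAt_pi.mpr fun i => hasDerivAt_pi.mpr fun j => ?_
      fin_cases i <;> fin_cases j
      all_goals first
        | exact hasDerivAt_const _ _
        | exact hm _
        | exact hy _
        | exact (hm _).fun_neg
        | exact (hy _).fun_neg
        | exact (hx2.fun_sub (hm _))
        | exact (hx2.fun_add (hm _))
        | exact (hx2.fun_sub (hm _)).fun_neg
        | exact (hx2.fun_add (hm _)).fun_neg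
        | exact (hy _).fun_neg.fun_neg
        | exact (hm _).fun_neg.fun_neg
    exact hasDerivAt_of_eq (hr.smul h) (fun _ => rfl) (add_comm _ _)

theorem orbitPt_mem_diff {lam C : ℝ} {w : Fin 4 → ℝ} (hw : w ⬝ᵥ w = 1) {r x : ℝ} (hr : 0 < r)
    (h1 : -1 ≤ x) (h2 : x ≤ 1) (hF : bigF lam r x = C) :
    orbitPt w r x ∈ setM lam C vRef \ zeroSection := by
  refine ⟨mem_setM_vRef_iff.mpr ⟨w, r, x, hw, hr.le, h1, h2, hF, rfl⟩, fun h => ?_⟩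
  have h3 := normSq_orbitPt hw r h1 h2
  rw [h.2] at h3
  have : normSq (0 : Matrix (Fin 5) (Fin 5) ℝ) = 0 := by simp [normSq]
  rw [this] at h3
  exact (pow_ne_zero 2 hr.ne') h3.symm

theorem orbitPt_e0 (r x : ℝ) : orbitPt ![1, 0, 0, 0] r x = arcPoint x (r • vRef) := by
  have : leftMul ![1, 0, 0, 0] = 1 := by
    ext i j
    fin_cases i <;> fin_cases j <;> simp [leftMul]
  rw [← actM_leftMul_arcPoint (by simp), this, actM_one]

/-- At (1, 0, 0, 0) the Hopf map has differential 2 (w'₀, w'₂, w'₃), so the component w'₁ along the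
Hopf fibre does not affect m. -/
theorem isVelocity_orbit {lam C : ℝ} {r x : ℝ} (hr : 0 < r)
    (h1 : -1 ≤ x) (h2 : x ≤ 1) (hF : bigF lam r x = C) {w : ℝ → Fin 4 → ℝ} {w' : Fin 4 → ℝ}
    (hw : ∀ t, w t ⬝ᵥ w t = 1) (hw0 : w 0 = ![1, 0, 0, 0])
    (hd : ∀ i, HasDerivAt (fun t => w t i) (w' i) 0) :
    IsVelocity (setM lam C vRef \ zeroSection) (arcPoint x (r • vRef))
      (![√(1 - x ^ 2) * w' 0, √(1 - x ^ 2) * w' 1, √(1 - x ^ 2) * w' 2, √(1 - x ^ 2) * w' 3, 0],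
        r • skewPt (√(1 - x ^ 2) • w') 1 ((1 + x) • ![w' 0, w' 2, w' 3])) := by
  refine ⟨fun t => orbitPt (w t) r x, ?_, ?_,
    Eventually.of_forall fun t => orbitPt_mem_diff (hw t) hr h1 h2 hF⟩
  · simp only [hw0, orbitPt_e0]
  · have hsq : ∀ i j, HasDerivAt (fun t => w t i * w t j) (w' i * w 0 j + w 0 i * w' j) 0 :=
      fun i j => (hd i).fun_mul (hd j)
    have h := hasDerivAt_pt (y := fun t => √(1 - x ^ 2) • w t) (x := fun _ => x) (r := fun _ => r)
      (m := fun t => ((1 + x) / 2) • hopf (w t)) (y' := √(1 - x ^ 2) • w') (x' := 0) (r' := 0)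
      (m' := (1 + x) • ![w' 0, w' 2, w' 3]) (t := 0)
      (fun i => (hd i).const_mul _) (hasDerivAt_const _ _) (hasDerivAt_const _ _) ?_
    · refine hasDerivAt_of_eq h (fun _ => rfl) ?_
      simp
    · intro i
      fin_cases i
      · refine hasDerivAt_of_eq ((((hsq 0 0).fun_add (hsq 1 1)).fun_sub (hsq 2 2)).fun_sub
          (hsq 3 3) |>.const_mul ((1 + x) / 2)) (fun t => ?_) ?_
        · simp [hopf, sq]
        · simp [hw0]
          ring
      · refine hasDerivAt_of_eq (((hsq 0 2).fun_add (hsq 1 3)).const_mul 2 |>.const_mul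
          ((1 + x) / 2)) (fun t => rfl) ?_
        simp [hw0]
        ring
      · refine hasDerivAt_of_eq (((hsq 0 3).fun_sub (hsq 1 2)).const_mul 2 |>.const_mul
          ((1 + x) / 2)) (fun t => rfl) ?_
        simp [hw0]
        ring

theorem hasDerivAt_sin_zero : HasDerivAt Real.sin 1 0 := by
  simpa using Real.hasDerivAt_sin 0

theorem hasDerivAt_cos_zero : HasDerivAt Real.cos 0 0 := by
  simpa using Real.hasDerivAt_cos 0

theorem isVelocity_planeVec_zero {lam C r x s k a : ℝ} (b d α β : ℝ) (hr : 0 < r)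
    (h1 : -1 ≤ x) (h2 : x ≤ 1) (hF : bigF lam r x = C) (ha : k * a = √(1 - x ^ 2)) :
    IsVelocity (setM lam C vRef \ zeroSection) (arcPoint x (r • vRef))
      (actM (arcRot x) (baseFrame r s k (planeVec a b d α β 0))) := by
  have h := isVelocity_orbit hr h1 h2 hF (w := fun t => ![Real.cos t, Real.sin t, 0, 0])
    (w' := ![0, 1, 0, 0]) (fun t => by rw [dot_four]; simp) (by simp) (fun i => by
      fin_cases i
      · exact hasDerivAt_cos_zero
      · exact hasDerivAt_sin_zero
      · exact hasDerivAt_const _ _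
      · exact hasDerivAt_const _ _)
  convert h using 1
  rw [actM_arcRot_baseFrame h1 h2]
  refine Prod.ext ?_ ?_
  · ext i
    fin_cases i <;> simp [planeVec, ha]
  · ext i j
    fin_cases i <;> fin_cases j <;> simp [planeVec, skewPt, skew5, ha]

/-- Moving w across the Hopf fibres has a horizontal part of size √(1 - x²) and a vertical part of
size r (1 + x). The hypotheses on b and d rescale these two to the `G₂`-frame. -/
theorem isVelocity_planeVec_one {lam C r x s k b d : ℝ} (a α β : ℝ) (hr : 0 < r)
    (h1 : -1 ≤ x) (h2 : x ≤ 1) (hF : bigF lam r x = C) (hb : k * b = √(1 - x ^ 2))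
    (hd : s * d = r * (1 + x)) :
    IsVelocity (setM lam C vRef \ zeroSection) (arcPoint x (r • vRef))
      (actM (arcRot x) (baseFrame r s k (planeVec a b d α β 1))) := by
  have hc : √(1 - x ^ 2) ^ 2 = 1 - x ^ 2 := Real.sq_sqrt (by nlinarith)
  have h := isVelocity_orbit hr h1 h2 hF (w := fun t => ![Real.cos t, 0, Real.sin t, 0])
    (w' := ![0, 0, 1, 0]) (fun t => by rw [dot_four]; simp) (by simp) (fun i => by
      fin_cases i
      · exact hasDerivAt_cos_zero
      · exact hasDerivAt_const _ _
      · exact hasDerivAt_sin_zero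
      · exact hasDerivAt_const _ _)
  convert h using 1
  rw [actM_arcRot_baseFrame h1 h2]
  refine Prod.ext ?_ ?_
  · ext i
    fin_cases i <;> simp [planeVec, hb]
  · ext i j
    fin_cases i <;> fin_cases j <;> simp [planeVec, skewPt, skew5, hb, hd] <;>
      first | ring1 | linear_combination r * hc | linear_combination -r * hc

theorem isVelocity_planeVec_two {lam C r x s k b d : ℝ} (a α β : ℝ) (hr : 0 < r)
    (h1 : -1 ≤ x) (h2 : x ≤ 1) (hF : bigF lam r x = C) (hb : k * b = √(1 - x ^ 2))
    (hd : s * d = r * (1 + x)) :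
    IsVelocity (setM lam C vRef \ zeroSection) (arcPoint x (r • vRef))
      (actM (arcRot x) (baseFrame r s k (planeVec a b d α β 2))) := by
  have hc : √(1 - x ^ 2) ^ 2 = 1 - x ^ 2 := Real.sq_sqrt (by nlinarith)
  have h := isVelocity_orbit hr h1 h2 hF (w := fun t => ![Real.cos t, 0, 0, Real.sin t])
    (w' := ![0, 0, 0, 1]) (fun t => by rw [dot_four]; simp) (by simp) (fun i => by
      fin_cases i
      · exact hasDerivAt_cos_zero
      · exact hasDerivAt_const _ _
      · exact hasDerivAt_const _ _
      · exact hasDerivAt_sin_zero)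
  convert h using 1
  rw [actM_arcRot_baseFrame h1 h2]
  refine Prod.ext ?_ ?_
  · ext i
    fin_cases i <;> simp [planeVec, hb]
  · ext i j
    fin_cases i <;> fin_cases j <;> simp [planeVec, skewPt, skew5, hb, hd] <;>
      first | ring1 | linear_combination r * hc | linear_combination -r * hc

end CoassS4

namespace CoassS4

open Filter Topology

/-! ### The level sets of `F` -/

/-- The eighth root of `λ + s⁴`. -/
noncomputable def qFun (lam s : ℝ) : ℝ := (lam + s ^ 4) ^ (1 / 8 : ℝ)

/-- The integral in the definition of `F`, as a function of `s = √r`. -/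
noncomputable def iFun (lam s : ℝ) : ℝ :=
  ∫ x in (0 : ℝ)..s, 2 * lam / (lam + x ^ 4) ^ (7 / 8 : ℝ)

/-- The solution `x₅` of `F(s², x₅) = C`. -/
noncomputable def xFun (lam C s : ℝ) : ℝ := (1 + (iFun lam s - C) / (qFun lam s * s)) / 3

section

variable {lam : ℝ}

theorem qFun_pow (hlam : 0 < lam) (s : ℝ) : qFun lam s ^ 8 = lam + s ^ 4 := by
  have h : 0 ≤ lam + s ^ 4 := by positivity
  rw [qFun, ← Real.rpow_natCast, ← Real.rpow_mul h]
  norm_num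

theorem qFun_pos (hlam : 0 < lam) (s : ℝ) : 0 < qFun lam s :=
  Real.rpow_pos_of_pos (by positivity) _

theorem qFun_pow_seven (hlam : 0 < lam) (s : ℝ) :
    (lam + s ^ 4) ^ (7 / 8 : ℝ) = qFun lam s ^ 7 := by
  have h : 0 ≤ lam + s ^ 4 := by positivity
  rw [qFun, ← Real.rpow_natCast ((lam + s ^ 4) ^ (1 / 8 : ℝ)), ← Real.rpow_mul h]
  norm_num

theorem contDiff_qFun (hlam : 0 < lam) : ContDiff ℝ ∞ (qFun lam) := by
  refine ContDiff.rpow_const_of_ne (by fun_prop) fun s => ?_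
  have : 0 < lam + s ^ 4 := by positivity
  exact this.ne'

theorem hasDerivAt_qFun (hlam : 0 < lam) (s : ℝ) :
    HasDerivAt (qFun lam) (s ^ 3 / (2 * qFun lam s ^ 7)) s := by
  have hd : HasDerivAt (qFun lam) (deriv (qFun lam) s) s :=
    ((contDiff_qFun hlam).differentiable (by simp) s).hasDerivAt
  have h1 := hd.fun_pow 8
  have h2 : HasDerivAt (fun t => qFun lam t ^ 8) (4 * s ^ 3) s := by
    refine hasDerivAt_of_eq (((hasDerivAt_id s).fun_pow 4).const_add lam)
      (fun t => qFun_pow hlam t) ?_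
    simp
  have h3 := h1.unique h2
  have hq := qFun_pos hlam s
  refine hasDerivAt_of_eq hd (fun _ => rfl) ?_
  rw [div_eq_iff (by positivity)]
  norm_num at h3
  linarith

theorem continuous_integrand (hlam : 0 < lam) :
    Continuous fun x : ℝ => 2 * lam / qFun lam x ^ 7 :=
  continuous_const.div ((contDiff_qFun hlam).continuous.pow 7) fun x =>
    pow_ne_zero 7 (qFun_pos hlam x).ne'

theorem iFun_eq (hlam : 0 < lam) (s : ℝ) :
    iFun lam s = ∫ x in (0 : ℝ)..s, 2 * lam / qFun lam x ^ 7 := by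
  simp only [iFun, qFun_pow_seven hlam]

theorem hasDerivAt_iFun (hlam : 0 < lam) (s : ℝ) :
    HasDerivAt (iFun lam) (2 * lam / qFun lam s ^ 7) s := by
  refine hasDerivAt_of_eq ?_ (iFun_eq hlam) rfl
  exact (continuous_integrand hlam).integral_hasStrictDerivAt 0 s |>.hasDerivAt

theorem contDiff_iFun (hlam : 0 < lam) : ContDiff ℝ ∞ (iFun lam) := by
  rw [contDiff_infty_iff_deriv]
  refine ⟨fun s => (hasDerivAt_iFun hlam s).differentiableAt, ?_⟩
  have : deriv (iFun lam) = fun s => 2 * lam / qFun lam s ^ 7 :=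
    funext fun s => (hasDerivAt_iFun hlam s).deriv
  rw [this]
  exact contDiff_const.div ((contDiff_qFun hlam).pow 7) fun x =>
    pow_ne_zero 7 (qFun_pos hlam x).ne'

theorem bigF_sq {s : ℝ} (hs : 0 ≤ s) (x : ℝ) :
    bigF lam (s ^ 2) x = (1 - 3 * x) * (qFun lam s * s) + iFun lam s := by
  rw [bigF, Real.sqrt_sq hs, qFun, iFun, ← pow_mul, mul_assoc]

/-- In x the function is affine with slope -3 `qFun lam s` s, which is nonzero for s > 0: the level
set is a graph over s. -/
theorem bigF_eq_iff (hlam : 0 < lam) {C s x : ℝ} (hs : 0 < s) :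
    bigF lam (s ^ 2) x = C ↔ x = xFun lam C s := by
  have hB : qFun lam s * s ≠ 0 := (mul_pos (qFun_pos hlam s) hs).ne'
  rw [bigF_sq hs.le, xFun]
  constructor
  · intro h
    have : iFun lam s - C = (3 * x - 1) * (qFun lam s * s) := by linarith
    rw [this, mul_div_cancel_right₀ _ hB]
    ring
  · rintro rfl
    have := div_mul_cancel₀ (iFun lam s - C) hB
    linear_combination -this

theorem iFun_sub (hlam : 0 < lam) (C : ℝ) {s : ℝ} (hs : 0 < s) :
    iFun lam s - C = (3 * xFun lam C s - 1) * (qFun lam s * s) := by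
  have := (bigF_eq_iff hlam hs).mpr (rfl : xFun lam C s = xFun lam C s)
  rw [bigF_sq hs.le] at this
  linarith

theorem contDiffOn_xFun (hlam : 0 < lam) (C : ℝ) : ContDiffOn ℝ ∞ (xFun lam C) (Set.Ioi 0) := by
  have hq := (contDiff_qFun hlam).contDiffOn (s := Set.Ioi 0)
  refine (contDiffOn_const.add (ContDiffOn.div
    ((contDiff_iFun hlam).contDiffOn.sub contDiffOn_const) (hq.mul contDiffOn_id) ?_)).div_const 3
  intro s hs
  exact (mul_pos (qFun_pos hlam s) hs).ne'

theorem continuousOn_xFun (hlam : 0 < lam) (C : ℝ) : ContinuousOn (xFun lam C) (Set.Ioi 0) :=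
  (contDiffOn_xFun hlam C).continuousOn

/-- The derivative of `xFun`. -/
noncomputable def xDer (lam C s : ℝ) : ℝ :=
  (3 * (1 - xFun lam C s) * lam + (3 / 2) * (1 - 3 * xFun lam C s) * s ^ 4) /
    (3 * qFun lam s ^ 8 * s)

theorem hasDerivAt_prod (hlam : 0 < lam) (s : ℝ) : HasDerivAt (fun s => qFun lam s * s)
    ((lam + 3 / 2 * s ^ 4) / qFun lam s ^ 7) s := by
  have hq := qFun_pos hlam s
  refine hasDerivAt_of_eq ((hasDerivAt_qFun hlam s).mul (hasDerivAt_id s)) (fun _ => rfl) ?_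
  simp only [id]
  field_simp
  linear_combination (-2 : ℝ) * qFun_pow hlam s

/-- Eliminating the integral by `iFun_sub` leaves an expression in s and `xFun lam C s` in which C
no longer appears explicitly. All level curves thus solve one differential equation, the one
required for calibration. -/
theorem hasDerivAt_xFun (hlam : 0 < lam) (C : ℝ) {s : ℝ} (hs : 0 < s) :
    HasDerivAt (xFun lam C) (xDer lam C s) s := by
  have hq := qFun_pos hlam s
  have hB : qFun lam s * s ≠ 0 := (mul_pos hq hs).ne'
  refine hasDerivAt_of_eq (((((hasDerivAt_iFun hlam s).sub_const C).fun_div (hasDerivAt_prod hlam s)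
    hB).const_add 1).div_const 3) (fun _ => rfl) ?_
  rw [iFun_sub hlam C hs, xDer]
  field_simp
  ring

/-! ### Where the level curves cross x₅ = -1 and x₅ = 1. -/

theorem xFun_lt_iff (hlam : 0 < lam) (C : ℝ) {s : ℝ} (hs : 0 < s) (x : ℝ) :
    xFun lam C s < x ↔ bigF lam (s ^ 2) x < C := by
  have hB : 0 < qFun lam s * s := mul_pos (qFun_pos hlam s) hs
  rw [bigF_sq hs.le]
  have h := iFun_sub hlam C hs
  constructor
  · intro h1
    nlinarith
  · intro h1
    by_contra! h2
    nlinarith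

theorem lt_xFun_iff (hlam : 0 < lam) (C : ℝ) {s : ℝ} (hs : 0 < s) (x : ℝ) :
    x < xFun lam C s ↔ C < bigF lam (s ^ 2) x := by
  have hB : 0 < qFun lam s * s := mul_pos (qFun_pos hlam s) hs
  rw [bigF_sq hs.le]
  have h := iFun_sub hlam C hs
  constructor
  · intro h1
    nlinarith
  · intro h1
    by_contra! h2
    nlinarith

theorem strictMono_iFun (hlam : 0 < lam) : StrictMono (iFun lam) := by
  refine strictMono_of_deriv_pos fun s => ?_
  rw [(hasDerivAt_iFun hlam s).deriv]
  have := qFun_pos hlam s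
  positivity

theorem strictMono_prod (hlam : 0 < lam) : StrictMono fun s => qFun lam s * s := by
  refine strictMono_of_deriv_pos fun s => ?_
  rw [(hasDerivAt_prod hlam s).deriv]
  have := qFun_pos hlam s
  positivity

theorem iFun_zero : iFun lam 0 = 0 := by simp [iFun]

theorem strictMonoOn_bigF_neg_one (hlam : 0 < lam) :
    StrictMonoOn (fun s => bigF lam (s ^ 2) (-1)) (Set.Ici 0) := by
  intro a ha b hb hab
  simp only [bigF_sq (Set.mem_Ici.mp ha), bigF_sq (Set.mem_Ici.mp hb)]
  have h1 := strictMono_iFun hlam hab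
  have h2 := strictMono_prod hlam hab
  simp only at h2
  linarith

/-- At x = 1 the derivative of -2 `qFun lam s` s contributes -2λ in the numerator, which cancels the
integrand exactly. Only -3 s⁴ / `qFun lam s` ^ 7 is left. -/
theorem strictAntiOn_bigF_one (hlam : 0 < lam) :
    StrictAntiOn (fun s => bigF lam (s ^ 2) 1) (Set.Ici 0) := by
  have hd : ∀ s, HasDerivAt (fun s => (1 - 3 * 1) * (qFun lam s * s) + iFun lam s)
      (-3 * s ^ 4 / qFun lam s ^ 7) s := fun s => by
    refine hasDerivAt_of_eq (((hasDerivAt_prod hlam s).const_mul (1 - 3 * 1)).fun_add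
      (hasDerivAt_iFun hlam s)) (fun _ => rfl) ?_
    ring
  have h : StrictAntiOn (fun s => (1 - 3 * 1) * (qFun lam s * s) + iFun lam s) (Set.Ici 0) := by
    refine strictAntiOn_of_deriv_neg (convex_Ici 0)
      (fun s _ => (hd s).continuousAt.continuousWithinAt) fun s hs => ?_
    rw [interior_Ici] at hs
    have := qFun_pos hlam s
    have hs : 0 < s := hs
    rw [(hd s).deriv, neg_mul, neg_div]
    exact neg_neg_of_pos (by positivity)
  exact h.congr fun s hs => (bigF_sq hs 1).symm

theorem continuousOn_bigF (hlam : 0 < lam) (x : ℝ) :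
    ContinuousOn (fun s => bigF lam (s ^ 2) x) (Set.Ici 0) := by
  have : Continuous fun s => (1 - 3 * x) * (qFun lam s * s) + iFun lam s :=
    (continuous_const.mul ((contDiff_qFun hlam).continuous.mul continuous_id)).add
      (contDiff_iFun hlam).continuous
  exact this.continuousOn.congr fun s hs => bigF_sq hs x

theorem bigF_zero (x : ℝ) : bigF lam 0 x = 0 := by
  simp [bigF]

theorem qFun_mono (hlam : 0 < lam) {a b : ℝ} (ha : 0 ≤ a) (hab : a ≤ b) :
    qFun lam a ≤ qFun lam b := by
  rw [← pow_le_pow_iff_left₀ (qFun_pos hlam a).le (qFun_pos hlam b).le (n := 8) (by norm_num),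
    qFun_pow hlam, qFun_pow hlam]
  gcongr

theorem iFun_le (hlam : 0 < lam) {s : ℝ} (hs : 0 ≤ s) : iFun lam s ≤ 2 * qFun lam 0 * s := by
  have hq := qFun_pos hlam 0
  have h0 : 2 * lam / qFun lam 0 ^ 7 = 2 * qFun lam 0 := by
    rw [div_eq_iff (by positivity)]
    linear_combination (-2 : ℝ) * qFun_pow hlam 0
  have h1 : ∀ x ∈ Set.Icc 0 s, 2 * lam / qFun lam x ^ 7 ≤ 2 * qFun lam 0 := by
    intro x hx
    rw [← h0]
    have := qFun_mono hlam le_rfl hx.1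
    gcongr
  rw [iFun_eq hlam]
  refine (intervalIntegral.integral_mono_on hs ((continuous_integrand hlam).intervalIntegrable _ _)
    (continuous_const.intervalIntegrable _ _) h1).trans_eq ?_
  rw [intervalIntegral.integral_const, smul_eq_mul]
  ring

theorem exists_bigF_neg_one_eq (hlam : 0 < lam) {C : ℝ} (hC : 0 < C) :
    ∃ s, 0 < s ∧ bigF lam (s ^ 2) (-1) = C := by
  have hq := qFun_pos hlam 0
  set b := C / qFun lam 0 with hb
  have hb0 : 0 < b := div_pos hC hq
  have h1 : C ≤ bigF lam (b ^ 2) (-1) := by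
    rw [bigF_sq hb0.le]
    have h2 := strictMono_iFun hlam hb0
    rw [iFun_zero] at h2
    have h3 := mul_le_mul_of_nonneg_right (qFun_mono hlam le_rfl hb0.le) hb0.le
    have h4 : qFun lam 0 * b = C := by rw [hb, mul_div_cancel₀ _ hq.ne']
    linarith
  have h0 : (fun s => bigF lam (s ^ 2) (-1)) 0 = 0 := by simp [bigF_zero]
  obtain ⟨s, hs, hsC⟩ := intermediate_value_Icc hb0.le
    ((continuousOn_bigF hlam (-1)).mono Set.Icc_subset_Ici_self) ⟨h0.trans_le hC.le, h1⟩
  refine ⟨s, lt_of_le_of_ne hs.1 ?_, hsC⟩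
  rintro rfl
  rw [h0] at hsC
  exact hC.ne hsC

theorem exists_bigF_one_eq (hlam : 0 < lam) {C : ℝ} (hC : C < 0) :
    ∃ s, 0 < s ∧ bigF lam (s ^ 2) 1 = C := by
  have hq := qFun_pos hlam 0
  -- The three summands have separate roles: 1 gives b ≤ b⁴, 255 λ then gives λ + b⁴ ≥ 256 λ and so
  -- q(b) ≥ 2 q(0), and the last makes -2 q(0) b ≤ C. Together with the bound 2 q(0) b on the
  -- integral they give F(b², 1) ≤ C.
  set b := 1 + 255 * lam + -C / (2 * qFun lam 0) with hb
  have hC' : 0 < -C / (2 * qFun lam 0) := div_pos (by linarith) (by linarith)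
  have hb1 : 1 ≤ b := by linarith
  have hb0 : 0 < b := by linarith
  have h1 : bigF lam (b ^ 2) 1 ≤ C := by
    rw [bigF_sq hb0.le]
    have h2 := iFun_le hlam hb0.le
    have h3 : 2 * qFun lam 0 ≤ qFun lam b := by
      rw [← pow_le_pow_iff_left₀ (by positivity) (qFun_pos hlam b).le (n := 8) (by norm_num),
        mul_pow, qFun_pow hlam, qFun_pow hlam]
      have : b ≤ b ^ 4 := le_self_pow₀ hb1 (by norm_num)
      norm_num
      linarith
    have h4 := mul_le_mul_of_nonneg_right h3 hb0.le
    have h5 : -C / (2 * qFun lam 0) ≤ b := by linarith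
    rw [div_le_iff₀ (by positivity)] at h5
    linarith
  have h0 : (fun s => bigF lam (s ^ 2) 1) 0 = 0 := by simp [bigF_zero]
  obtain ⟨s, hs, hsC⟩ := intermediate_value_Icc' hb0.le
    ((continuousOn_bigF hlam 1).mono Set.Icc_subset_Ici_self) ⟨h1, hC.le.trans_eq h0.symm⟩
  refine ⟨s, lt_of_le_of_ne hs.1 ?_, hsC⟩
  rintro rfl
  rw [h0] at hsC
  exact hC.ne hsC.symm

theorem bigF_neg_one_pos (hlam : 0 < lam) {s : ℝ} (hs : 0 < s) : 0 < bigF lam (s ^ 2) (-1) := by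
  have := strictMonoOn_bigF_neg_one hlam Set.self_mem_Ici hs.le hs
  simpa [bigF_zero] using this

theorem bigF_one_neg (hlam : 0 < lam) {s : ℝ} (hs : 0 < s) : bigF lam (s ^ 2) 1 < 0 := by
  have := strictAntiOn_bigF_one hlam Set.self_mem_Ici hs.le hs
  simpa [bigF_zero] using this

theorem xFun_lt_one (hlam : 0 < lam) {C s : ℝ} (hC : 0 ≤ C) (hs : 0 < s) : xFun lam C s < 1 :=
  (xFun_lt_iff hlam C hs 1).mpr ((bigF_one_neg hlam hs).trans_le hC)

theorem neg_one_lt_xFun (hlam : 0 < lam) {C s : ℝ} (hC : C ≤ 0) (hs : 0 < s) :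
    -1 < xFun lam C s :=
  (lt_xFun_iff hlam C hs (-1)).mpr (hC.trans_lt (bigF_neg_one_pos hlam hs))

theorem exists_threshold_of_pos (hlam : 0 < lam) {C : ℝ} (hC : 0 < C) :
    ∃ s₀, 0 < s₀ ∧ xFun lam C s₀ = -1 ∧
      ∀ s, 0 < s → (-1 ≤ xFun lam C s ↔ s₀ ≤ s) ∧ (-1 < xFun lam C s ↔ s₀ < s) := by
  obtain ⟨s₀, h0, h1⟩ := exists_bigF_neg_one_eq hlam hC
  refine ⟨s₀, h0, ((bigF_eq_iff hlam h0).mp h1).symm, fun s hs => ⟨?_, ?_⟩⟩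
  · rw [← not_lt, xFun_lt_iff hlam C hs, ← h1, not_lt]
    exact (strictMonoOn_bigF_neg_one hlam).le_iff_le h0.le hs.le
  · rw [lt_xFun_iff hlam C hs, ← h1]
    exact (strictMonoOn_bigF_neg_one hlam).lt_iff_lt h0.le hs.le

theorem exists_threshold_of_neg (hlam : 0 < lam) {C : ℝ} (hC : C < 0) :
    ∃ s₁, 0 < s₁ ∧ xFun lam C s₁ = 1 ∧
      ∀ s, 0 < s → (xFun lam C s ≤ 1 ↔ s₁ ≤ s) ∧ (xFun lam C s < 1 ↔ s₁ < s) := by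
  obtain ⟨s₁, h0, h1⟩ := exists_bigF_one_eq hlam hC
  refine ⟨s₁, h0, ((bigF_eq_iff hlam h0).mp h1).symm, fun s hs => ⟨?_, ?_⟩⟩
  · rw [← not_lt, lt_xFun_iff hlam C hs, ← h1, not_lt]
    exact (strictAntiOn_bigF_one hlam).le_iff_ge hs.le h0.le
  · rw [xFun_lt_iff hlam C hs, ← h1]
    exact (strictAntiOn_bigF_one hlam).lt_iff_gt hs.le h0.le

/-- A smooth local inverse of `xFun`. -/
theorem exists_local_inverse (hlam : 0 < lam) (C : ℝ) {s₀ : ℝ} (hs : 0 < s₀)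
    (hd : xDer lam C s₀ ≠ 0) :
    ∃ (V T : Set ℝ) (S : ℝ → ℝ), IsOpen V ∧ IsOpen T ∧ s₀ ∈ V ∧ V ⊆ Set.Ioi 0 ∧
      ContDiffOn ℝ ∞ S T ∧ Set.MapsTo (xFun lam C) V T ∧ Set.MapsTo S T V ∧
      (∀ s ∈ V, S (xFun lam C s) = s) ∧ ∀ x ∈ T, xFun lam C (S x) = x := by
  have hc : ∀ s, 0 < s → ContDiffAt ℝ ∞ (xFun lam C) s := fun s h =>
    (contDiffOn_xFun hlam C).contDiffAt (Ioi_mem_nhds h)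
  let e0 := (hc s₀ hs).toOpenPartialHomeomorph (xFun lam C)
    (hasDerivAt_xFun hlam C hs |>.hasFDerivAt_equiv hd) (by simp)
  have he0 : ∀ s, e0 s = xFun lam C s := fun s => rfl
  have hs0 : s₀ ∈ e0.source := (hc s₀ hs).mem_toOpenPartialHomeomorph_source _ (by simp)
  have hcx : ContinuousOn (xDer lam C) (Set.Ioi 0) := by
    have h1 := continuousOn_xFun hlam C
    refine ContinuousOn.div ?_ ?_ ?_
    · fun_prop
    · exact (continuousOn_const.mul ((contDiff_qFun hlam).continuous.continuousOn.pow 8)).mul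
        continuousOn_id
    · intro s hs
      have := qFun_pos hlam s
      have hs : 0 < s := hs
      positivity
  -- The source is cut down to the points where the derivative is nonzero, so that the inverse is
  -- smooth on its whole domain and not only at the image of s₀.
  have hW : IsOpen (Set.Ioi 0 ∩ xDer lam C ⁻¹' {0}ᶜ) :=
    hcx.isOpen_inter_preimage isOpen_Ioi isOpen_compl_singleton
  let e := e0.restrOpen _ hW
  have hsrc : e.source = e0.source ∩ (Set.Ioi 0 ∩ xDer lam C ⁻¹' {0}ᶜ) := rfl
  have hval : ∀ s, e s = xFun lam C s := fun s => rfl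
  refine ⟨e.source, e.target, e.symm, e.open_source, e.open_target, ⟨hs0, hs, hd⟩, ?_, ?_,
    e.mapsTo, e.symm.mapsTo, fun s hs => e.left_inv hs, fun x hx => e.right_inv hx⟩
  · rw [hsrc]
    exact fun s hs => hs.2.1
  · intro x hx
    have hm : e.symm x ∈ e.source := e.map_target hx
    rw [hsrc] at hm
    exact (e.contDiffAt_symm_deriv hm.2.2 hx (hasDerivAt_xFun hlam C hm.2.1)
      (hc _ hm.2.1)).contDiffWithinAt

end

end CoassS4

namespace CoassS4

open Filter Topology

/-! ### Charts -/

theorem mem_setM_diff_iff {lam C : ℝ} (hlam : 0 < lam) {p : Amb} :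
    p ∈ setM lam C vRef \ zeroSection ↔ ∃ (w : Fin 4 → ℝ) (s : ℝ), w ⬝ᵥ w = 1 ∧ 0 < s ∧
      -1 ≤ xFun lam C s ∧ xFun lam C s ≤ 1 ∧ p = orbitPt w (s ^ 2) (xFun lam C s) := by
  constructor
  · rintro ⟨hp, h0⟩
    obtain ⟨w, r, x, hw, hr, h1, h2, hF, rfl⟩ := mem_setM_vRef_iff.mp hp
    have hx : x ^ 2 ≤ 1 := by nlinarith
    have hr0 : r ≠ 0 := by
      rintro rfl
      have hm := orbitPt_mem_asdBundle hw 0 h1 h2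
      exact h0 ⟨hm.1, by simp [orbitPt, pt]⟩
    have hs : 0 < √r := Real.sqrt_pos.mpr (lt_of_le_of_ne hr hr0.symm)
    have hsr : √r ^ 2 = r := Real.sq_sqrt hr
    have hxe : x = xFun lam C √r := (bigF_eq_iff hlam hs).mp (by rw [hsr, hF])
    exact ⟨w, √r, hw, hs, hxe ▸ h1, hxe ▸ h2, by rw [hsr, ← hxe]⟩
  · rintro ⟨w, s, hw, hs, h1, h2, rfl⟩
    exact orbitPt_mem_diff hw (pow_pos hs 2) h1 h2 ((bigF_eq_iff hlam hs).mpr rfl)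

/-- The square root of the fibre norm. -/
noncomputable def sPar (p : Amb) : ℝ := normSq p.2 ^ (1 / 4 : ℝ)

theorem contDiff_normSq : ContDiff ℝ ∞ normSq := by
  unfold normSq
  refine contDiff_const.mul (ContDiff.sum fun i _ => ContDiff.sum fun j _ => ContDiff.pow ?_ 2)
  exact (contDiff_apply_apply ℝ ℝ i j : ContDiff ℝ ∞ fun A : Fin 5 → Fin 5 → ℝ => A i j)

theorem continuous_sPar : Continuous sPar :=
  (contDiff_normSq.continuous.comp continuous_snd).rpow_const fun _ => Or.inr (by norm_num)

theorem differentiableAt_sPar {p : Amb} (h : normSq p.2 ≠ 0) : DifferentiableAt ℝ sPar p := by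
  refine DifferentiableAt.rpow_const ?_ (Or.inl h)
  exact (contDiff_normSq.differentiable (by simp) p.2).comp p differentiableAt_snd

theorem sPar_eq {p : Amb} {s : ℝ} (hs : 0 ≤ s) (h : normSq p.2 = (s ^ 2) ^ 2) : sPar p = s := by
  rw [sPar, h, ← pow_mul, ← Real.rpow_natCast, ← Real.rpow_mul hs]
  norm_num

theorem sPar_orbitPt {w : Fin 4 → ℝ} (hw : w ⬝ᵥ w = 1) {s : ℝ} (hs : 0 ≤ s) {x : ℝ} (h1 : -1 ≤ x)
    (h2 : x ≤ 1) : sPar (orbitPt w (s ^ 2) x) = s :=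
  sPar_eq hs (normSq_orbitPt hw _ h1 h2)

theorem contDiffOn_pt {E : Type*} [NormedAddCommGroup E] [NormedSpace ℝ E] {U : Set E}
    {y : E → Fin 4 → ℝ} {x r : E → ℝ} {m : E → Fin 3 → ℝ}
    (hy : ∀ i, ContDiffOn ℝ ∞ (fun t => y t i) U) (hx : ContDiffOn ℝ ∞ x U)
    (hr : ContDiffOn ℝ ∞ r U) (hm : ∀ i, ContDiffOn ℝ ∞ (fun t => m t i) U) :
    ContDiffOn ℝ ∞ (fun t => pt (y t) (x t) (r t) (m t)) U := by
  refine ContDiffOn.prodMk ?_ ?_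
  · rw [contDiffOn_pi]
    intro i
    fin_cases i
    · exact hy 0
    · exact hy 1
    · exact hy 2
    · exact hy 3
    · exact hx
  · have hx2 : ContDiffOn ℝ ∞ (fun t => (1 - x t) / 2) U := (contDiffOn_const.sub hx).div_const 2
    refine contDiffOn_pi.mpr fun i => contDiffOn_pi.mpr fun j => hr.mul ?_
    fin_cases i <;> fin_cases j
    all_goals first
      | exact contDiffOn_const
      | exact hm _
      | exact hy _
      | exact (hm _).neg
      | exact (hy _).neg
      | exact (hx2.sub (hm _))
      | exact (hx2.add (hm _))
      | exact (hx2.sub (hm _)).neg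
      | exact (hx2.add (hm _)).neg
      | exact (hy _).neg.neg
      | exact (hm _).neg.neg

theorem norm_sq_eq_dot (y : EuclideanSpace ℝ (Fin 4)) : ‖y‖ ^ 2 = y.ofLp ⬝ᵥ y.ofLp := by
  rw [EuclideanSpace.real_norm_sq_eq, dot_four, Fin.sum_univ_four]

theorem dot_smul_self (c : ℝ) (w : Fin 4 → ℝ) : (c • w) ⬝ᵥ (c • w) = c ^ 2 * (w ⬝ᵥ w) := by
  simp only [smul_dotProduct, dotProduct_smul, smul_eq_mul]
  ring

theorem norm_toLp_smul {w : Fin 4 → ℝ} (hw : w ⬝ᵥ w = 1) {s : ℝ} (hs : 0 ≤ s) :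
    ‖(WithLp.toLp 2 (s • w) : EuclideanSpace ℝ (Fin 4))‖ = s := by
  rw [← pow_left_inj₀ (norm_nonneg _) hs two_ne_zero, norm_sq_eq_dot, dot_smul_self, hw, mul_one]

theorem dot_inv_norm_smul {y : EuclideanSpace ℝ (Fin 4)} (hy : y ≠ 0) :
    (‖y‖⁻¹ • y.ofLp) ⬝ᵥ (‖y‖⁻¹ • y.ofLp) = 1 := by
  rw [dot_smul_self, ← norm_sq_eq_dot, ← mul_pow, inv_mul_cancel₀ (norm_ne_zero_iff.mpr hy),
    one_pow]

theorem contDiff_coord (i : Fin 4) :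
    ContDiff ℝ ∞ fun y : EuclideanSpace ℝ (Fin 4) => y.ofLp i := contDiff_piLp_apply 2

theorem differentiable_fst_apply (i : Fin 5) : Differentiable ℝ fun p : Amb => p.1 i := by
  have : Differentiable ℝ fun x : Fin 5 → ℝ => x i := differentiable_apply i
  exact this.comp differentiable_fst

theorem differentiable_snd_apply (i j : Fin 5) : Differentiable ℝ fun p : Amb => p.2 i j := by
  have : Differentiable ℝ fun A : Fin 5 → Fin 5 → ℝ => A i j := fun A =>
    (differentiable_pi.mp (differentiable_pi.mp differentiable_id i) j) A
  exact this.comp differentiable_snd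

theorem contDiffOn_hopf {E : Type*} [NormedAddCommGroup E] [NormedSpace ℝ E] {U : Set E}
    {w : E → Fin 4 → ℝ} (hw : ∀ i, ContDiffOn ℝ ∞ (fun t => w t i) U) (j : Fin 3) :
    ContDiffOn ℝ ∞ (fun t => hopf (w t) j) U := by
  fin_cases j
  · exact ((((hw 0).pow 2).add ((hw 1).pow 2)).sub ((hw 2).pow 2)).sub ((hw 3).pow 2)
  · exact contDiffOn_const.mul (((hw 0).mul (hw 2)).add ((hw 1).mul (hw 3)))
  · exact contDiffOn_const.mul (((hw 0).mul (hw 3)).sub ((hw 1).mul (hw 2)))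

/-- Polar coordinates on ℝ⁴ minus the origin: the norm of y is s and its direction is w. The inverse
reads s from the fibre norm and w from the base coordinates divided by √(1 - x²), which is nonzero
strictly inside the strip. -/
theorem hasChart_of_mem_Ioo {lam C s : ℝ} (hlam : 0 < lam) (hs : 0 < s)
    (h1 : -1 < xFun lam C s) (h2 : xFun lam C s < 1) :
    HasChart (setM lam C vRef \ zeroSection) (arcPoint (xFun lam C s) (s ^ 2 • vRef)) := by
  set U : Set (EuclideanSpace ℝ (Fin 4)) :=
    {0}ᶜ ∩ (fun y => xFun lam C ‖y‖) ⁻¹' Set.Ioo (-1) 1 with hU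
  set F : EuclideanSpace ℝ (Fin 4) → Amb := fun y =>
    orbitPt (‖y‖⁻¹ • y.ofLp) (‖y‖ ^ 2) (xFun lam C ‖y‖) with hF
  set G : Amb → EuclideanSpace ℝ (Fin 4) := fun p =>
    WithLp.toLp 2 fun i => sPar p * (√(1 - p.1 4 ^ 2))⁻¹ * p.1 i.castSucc with hG
  have hpos : ∀ y ∈ U, 0 < ‖y‖ := fun y hy => norm_pos_iff.mpr hy.1
  have hc : ∀ x ∈ Set.Ioo (-1 : ℝ) 1, 0 < 1 - x ^ 2 := fun x hx => by nlinarith [hx.1, hx.2]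
  have hnorm : ContDiffOn ℝ ∞ (fun y : EuclideanSpace ℝ (Fin 4) => ‖y‖) {0}ᶜ := fun y hy =>
    (contDiffAt_norm ℝ hy).contDiffWithinAt
  have hX : ContDiffOn ℝ ∞ (fun y : EuclideanSpace ℝ (Fin 4) => xFun lam C ‖y‖) {0}ᶜ :=
    (contDiffOn_xFun hlam C).comp hnorm fun y hy => norm_pos_iff.mpr hy
  have hUo : IsOpen U :=
    hX.continuousOn.isOpen_inter_preimage isOpen_compl_singleton isOpen_Ioo
  have hsubU : U ⊆ {0}ᶜ := Set.inter_subset_left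
  have hFmem : ∀ y ∈ U, F y ∈ setM lam C vRef \ zeroSection := fun y hy =>
    (mem_setM_diff_iff hlam).mpr ⟨_, ‖y‖, dot_inv_norm_smul hy.1, hpos y hy, hy.2.1.le, hy.2.2.le,
      rfl⟩
  have hsP : ∀ y ∈ U, sPar (F y) = ‖y‖ := fun y hy =>
    sPar_orbitPt (dot_inv_norm_smul hy.1) (norm_nonneg _) hy.2.1.le hy.2.2.le
  have hnS : ∀ y ∈ U, normSq (F y).2 = (‖y‖ ^ 2) ^ 2 := fun y hy =>
    normSq_orbitPt (dot_inv_norm_smul hy.1) _ hy.2.1.le hy.2.2.le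
  have hGF : ∀ y ∈ U, G (F y) = y := by
    intro y hy
    have h3 : √(1 - xFun lam C ‖y‖ ^ 2) ≠ 0 := (Real.sqrt_pos.mpr (hc _ hy.2)).ne'
    have h4 := (hpos y hy).ne'
    have h5 := hsP y hy
    ext i
    simp only [hG, h5]
    fin_cases i <;> simp [hF, orbitPt, pt] <;> field_simp
  have key : F '' U = (setM lam C vRef \ zeroSection) ∩
      ((fun p : Amb => p.1 4) ⁻¹' Set.Ioo (-1) 1) := by
    ext p
    constructor
    · rintro ⟨y, hy, rfl⟩
      exact ⟨hFmem y hy, hy.2⟩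
    · rintro ⟨hp, hx⟩
      obtain ⟨w, t, hw, ht, h3, h4, rfl⟩ := (mem_setM_diff_iff hlam).mp hp
      have hn : ‖(WithLp.toLp 2 (t • w) : EuclideanSpace ℝ (Fin 4))‖ = t :=
        norm_toLp_smul hw ht.le
      refine ⟨WithLp.toLp 2 (t • w), ⟨?_, ?_⟩, ?_⟩
      · exact norm_pos_iff.mp (by rw [hn]; exact ht)
      · rw [Set.mem_preimage, hn]
        exact hx
      · simp only [hF, hn]
        rw [smul_smul, inv_mul_cancel₀ ht.ne', one_smul]
  refine ⟨U, F, G, hUo, ?_, hGF, ?_, ⟨_, isOpen_Ioo.preimage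
    ((continuous_apply 4).comp continuous_fst), key⟩, ?_⟩
  · have hXU := hX.mono hsubU
    have hnU := hnorm.mono hsubU
    have hw : ∀ i, ContDiffOn ℝ ∞ (fun y : EuclideanSpace ℝ (Fin 4) => (‖y‖⁻¹ • y.ofLp) i) U :=
      fun i => (hnU.inv fun y hy => (hpos y hy).ne').mul (contDiff_coord i).contDiffOn
    refine contDiffOn_pt (fun i => ?_) hXU (hnU.pow 2) (fun i => ?_)
    · refine ContDiffOn.mul (ContDiffOn.sqrt (contDiffOn_const.sub (hXU.pow 2)) ?_) (hw i)
      exact fun y hy => (hc _ hy.2).ne'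
    · exact ((contDiffOn_const.add hXU).div_const 2).mul (contDiffOn_hopf hw i)
  · intro y hy
    have hx : (F y).1 4 = xFun lam C ‖y‖ := rfl
    refine (PiLp.contDiff_toLp (n := 1)).differentiable (by simp) _ |>.comp _ ?_
    refine differentiableAt_pi.mpr fun i => ?_
    refine ((differentiableAt_sPar ?_).mul (DifferentiableAt.inv (DifferentiableAt.sqrt ?_ ?_)
      ?_)).mul (differentiable_fst_apply _ _)
    · rw [hnS y hy]
      exact (pow_pos (pow_pos (hpos y hy) 2) 2).ne'
    · exact (differentiableAt_const _).sub ((differentiable_fst_apply 4 _).pow 2)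
    · rw [hx]
      exact (hc _ hy.2).ne'
    · rw [hx]
      exact (Real.sqrt_pos.mpr (hc _ hy.2)).ne'
  · rw [key, ← orbitPt_e0]
    refine ⟨(mem_setM_diff_iff hlam).mpr ⟨_, s, by simp, hs, h1.le, h2.le, rfl⟩, h1, h2⟩

end CoassS4

namespace CoassS4

open Filter Topology

/-! ### Charts at the exceptional orbits -/

theorem exists_unit_of_dot {y : Fin 4 → ℝ} {x : ℝ} (hy : y ⬝ᵥ y = 1 - x ^ 2) :
    ∃ w : Fin 4 → ℝ, w ⬝ᵥ w = 1 ∧ y = √(1 - x ^ 2) • w := by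
  have h0 : 0 ≤ 1 - x ^ 2 := by
    rw [← hy, dot_four]
    positivity
  rcases h0.eq_or_lt with h | h
  · refine ⟨![1, 0, 0, 0], by simp, ?_⟩
    rw [← h, Real.sqrt_zero, zero_smul]
    rw [← h] at hy
    exact dotProduct_self_eq_zero.mp hy
  · have hc : √(1 - x ^ 2) ≠ 0 := (Real.sqrt_pos.mpr h).ne'
    refine ⟨(√(1 - x ^ 2))⁻¹ • y, ?_, ?_⟩
    · rw [dot_smul_self, hy, inv_pow, Real.sq_sqrt h0, inv_mul_cancel₀ h.ne']
    · rw [smul_smul, mul_inv_cancel₀ hc, one_smul]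

theorem hopf_smul (c : ℝ) (w : Fin 4 → ℝ) : hopf (c • w) = c ^ 2 • hopf w := by
  ext j
  fin_cases j <;> simp [hopf] <;> ring

/-- The Hopf map is quadratic, so (1 + x)/2 times the image of w equals 1/(2(1 - x)) times the image
of y. This form depends on y alone and stays smooth across x = -1, where w is not determined. -/
theorem orbitPt_eq_pt {w y : Fin 4 → ℝ} {x : ℝ} (h1 : -1 ≤ x) (h2 : x < 1)
    (hy : y = √(1 - x ^ 2) • w) (r : ℝ) :
    orbitPt w r x = pt y x r ((2 * (1 - x))⁻¹ • hopf y) := by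
  have h : 0 ≤ 1 - x ^ 2 := by nlinarith
  have h3 : 1 - x ≠ 0 := by linarith
  rw [orbitPt, hy, hopf_smul, Real.sq_sqrt h, smul_smul]
  congr 2
  field_simp
  ring

theorem hasDerivAt_sqrt_one_sub (c : ℝ) : HasDerivAt (fun t : ℝ => √(1 - c * t ^ 2)) 0 0 := by
  have h : HasDerivAt (fun t : ℝ => 1 - c * t ^ 2) 0 0 := by
    refine hasDerivAt_of_eq ((((hasDerivAt_id (0 : ℝ)).fun_pow 2).const_mul c).const_sub 1)
      (fun _ => rfl) ?_
    simp
  exact hasDerivAt_of_eq (h.sqrt (by simp)) (fun _ => rfl) (by simp)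

/-- Near the point orbit the set is a graph over the base. The coordinate y fixes x = -√(1 - ‖y‖²),
and s is a smooth function of x because `xDer` is positive at x = -1. At y = 0 both x and the Hopf
term have zero derivative, so velocities are linear in e. -/
theorem south_chart {lam C s₀ : ℝ} (hlam : 0 < lam) (hs : 0 < s₀) (hx : xFun lam C s₀ = -1) :
    HasChart (setM lam C vRef \ zeroSection) (arcPoint (-1) (s₀ ^ 2 • vRef)) ∧
    ∀ e : Fin 4 → ℝ, e ⬝ᵥ e = 1 →
      IsVelocity (setM lam C vRef \ zeroSection) (arcPoint (-1) (s₀ ^ 2 • vRef))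
        (![e 0, e 1, e 2, e 3, 0], s₀ ^ 2 • skewPt e 1 0) := by
  obtain ⟨V, T, S, hV, hT, hsV, hV0, hS, hXm, hSm, hSX, hXS⟩ :=
    exists_local_inverse hlam C hs (by
      rw [xDer, hx]
      have := qFun_pos hlam s₀
      positivity)
  have hT0 : (-1 : ℝ) ∈ T := hx ▸ hXm hsV
  have hS0 : S (-1) = s₀ := by rw [← hx, hSX _ hsV]
  set X : EuclideanSpace ℝ (Fin 4) → ℝ := fun y => -√(1 - ‖y‖ ^ 2) with hXdef
  set U : Set (EuclideanSpace ℝ (Fin 4)) := Metric.ball 0 1 ∩ X ⁻¹' T with hU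
  set F : EuclideanSpace ℝ (Fin 4) → Amb := fun y =>
    pt y.ofLp (X y) (S (X y) ^ 2) ((2 * (1 - X y))⁻¹ • hopf y.ofLp) with hF
  set G : Amb → EuclideanSpace ℝ (Fin 4) := fun p =>
    WithLp.toLp 2 fun i => p.1 i.castSucc with hG
  have hlt : ∀ y ∈ U, 0 < 1 - ‖y‖ ^ 2 := fun y hy => by
    have : ‖y‖ < 1 := mem_ball_zero_iff.mp hy.1
    nlinarith [norm_nonneg y]
  have hXneg : ∀ y ∈ U, X y < 0 := fun y hy => neg_neg_of_pos (Real.sqrt_pos.mpr (hlt y hy))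
  have hXge : ∀ y, -1 ≤ X y := fun y => by
    have : √(1 - ‖y‖ ^ 2) ≤ 1 := Real.sqrt_le_one.mpr (by nlinarith [norm_nonneg y])
    simp only [hXdef]
    linarith
  have hXc : Continuous X := by fun_prop
  have hUo : IsOpen U := Metric.isOpen_ball.inter (hT.preimage hXc)
  have hXs : ContDiffOn ℝ ∞ X U := by
    refine (ContDiffOn.sqrt (contDiffOn_const.sub (contDiff_norm_sq ℝ).contDiffOn) ?_).neg
    exact fun y hy => (hlt y hy).ne'
  have hSs : ContDiffOn ℝ ∞ (fun y => S (X y)) U := hS.comp hXs fun y hy => hy.2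
  have hFmem : ∀ y ∈ U, F y ∈ setM lam C vRef \ zeroSection ∧ sPar (F y) ∈ V := by
    intro y hy
    have hy1 : y.ofLp ⬝ᵥ y.ofLp = 1 - X y ^ 2 := by
      rw [← norm_sq_eq_dot]
      simp only [hXdef, neg_sq, Real.sq_sqrt (hlt y hy).le]
      ring
    obtain ⟨w, hw, hyw⟩ := exists_unit_of_dot hy1
    have hsV := hSm hy.2
    have hlt1 : X y < 1 := (hXneg y hy).trans one_pos
    have hFo : F y = orbitPt w (S (X y) ^ 2) (X y) :=
      (orbitPt_eq_pt (hXge y) hlt1 hyw _).symm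
    refine ⟨(mem_setM_diff_iff hlam).mpr ⟨w, S (X y), hw, hV0 hsV, ?_⟩, ?_⟩
    · rw [hXS _ hy.2]
      exact ⟨hXge y, hlt1.le, hFo⟩
    · rw [hFo, sPar_orbitPt hw (hV0 hsV).le (hXge y) hlt1.le]
      exact hsV
  have hGF : ∀ y ∈ U, G (F y) = y := by
    intro y hy
    ext i
    fin_cases i <;> rfl
  have hX0 : X 0 = -1 := by simp [hXdef]
  have h0U : (0 : EuclideanSpace ℝ (Fin 4)) ∈ U := by
    refine ⟨Metric.mem_ball_self one_pos, ?_⟩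
    rw [Set.mem_preimage, hX0]
    exact hT0
  have hF0 : F 0 = arcPoint (-1) (s₀ ^ 2 • vRef) := by
    rw [← orbitPt_e0, orbitPt_eq_pt (y := 0) le_rfl (by norm_num) (by simp)]
    simp [hF, hX0, hS0]
  -- Negativity of the last coordinate selects the lower hemisphere, and `sPar` in V the part of the
  -- level curve on which S inverts `xFun`.
  have key : F '' U = (setM lam C vRef \ zeroSection) ∩
      (((fun p : Amb => p.1 4) ⁻¹' Set.Iio 0) ∩ sPar ⁻¹' V) := by
    ext p
    constructor
    · rintro ⟨y, hy, rfl⟩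
      exact ⟨(hFmem y hy).1, hXneg y hy, (hFmem y hy).2⟩
    · rintro ⟨hp, hp4, hpV⟩
      obtain ⟨w, t, hw, ht, h3, h4, rfl⟩ := (mem_setM_diff_iff hlam).mp hp
      rw [Set.mem_preimage, sPar_orbitPt hw ht.le h3 h4] at hpV
      set x := xFun lam C t with hxdef
      have hx0 : x < 0 := hp4
      have hsq : 0 ≤ 1 - x ^ 2 := by nlinarith
      set y : EuclideanSpace ℝ (Fin 4) := WithLp.toLp 2 (√(1 - x ^ 2) • w) with hy
      have hyn : ‖y‖ ^ 2 = 1 - x ^ 2 := by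
        rw [hy, norm_toLp_smul hw (Real.sqrt_nonneg _), Real.sq_sqrt hsq]
      have hXy : X y = x := by
        simp only [hXdef, hyn, sub_sub_cancel, Real.sqrt_sq_eq_abs, abs_of_neg hx0, neg_neg]
      have hSt : S x = t := hSX _ hpV
      refine ⟨y, ⟨?_, ?_⟩, ?_⟩
      · rw [mem_ball_zero_iff, ← sq_lt_one_iff₀ (norm_nonneg _), hyn]
        nlinarith
      · rw [Set.mem_preimage, hXy]
        exact hXm hpV
      · simp only [hF, hXy, hSt]
        exact (orbitPt_eq_pt h3 (hx0.trans one_pos) rfl _).symm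
  refine ⟨⟨U, F, G, hUo, ?_, hGF, ?_, ⟨_, ?_, key⟩, ⟨0, h0U, hF0⟩⟩, ?_⟩
  · refine contDiffOn_pt (fun i => (contDiff_coord i).contDiffOn) hXs (hSs.pow 2) fun i => ?_
    refine ContDiffOn.mul (ContDiffOn.inv (contDiffOn_const.mul (contDiffOn_const.sub hXs)) ?_)
      (contDiffOn_hopf (fun i => (contDiff_coord i).contDiffOn) i)
    intro y hy
    have := hXneg y hy
    have : 0 < 2 * (1 - X y) := by linarith
    exact this.ne'
  · intro y _
    refine (PiLp.contDiff_toLp (n := 1)).differentiable (by simp) _ |>.comp _ ?_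
    exact differentiableAt_pi.mpr fun i => differentiable_fst_apply _ _
  · exact (isOpen_Iio.preimage ((continuous_apply 4).comp continuous_fst)).inter
      (hV.preimage continuous_sPar)
  · intro e he
    refine ⟨fun t => F (WithLp.toLp 2 (t • e)), ?_, ?_, ?_⟩
    · simpa using hF0
    · have hn : ∀ t : ℝ, ‖(WithLp.toLp 2 (t • e) : EuclideanSpace ℝ (Fin 4))‖ ^ 2 = 1 * t ^ 2 :=
        fun t => by rw [norm_sq_eq_dot, dot_smul_self, he, one_mul, mul_one]
      have hXd : HasDerivAt (fun t : ℝ => X (WithLp.toLp 2 (t • e))) 0 0 :=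
        hasDerivAt_of_eq (hasDerivAt_sqrt_one_sub 1).fun_neg (fun t => by
          simp only [hXdef, hn]) (by simp)
      have hX00 : X (WithLp.toLp 2 ((0 : ℝ) • e)) = -1 := by
        rw [zero_smul]
        exact hX0
      have hSd : HasDerivAt (fun t : ℝ => S (X (WithLp.toLp 2 (t • e)))) 0 0 := by
        have h1 : DifferentiableAt ℝ S (X (WithLp.toLp 2 ((0 : ℝ) • e))) := by
          rw [hX00]
          exact (hS.contDiffAt (hT.mem_nhds hT0)).differentiableAt (by simp)
        exact hasDerivAt_of_eq (h1.hasDerivAt.comp (0 : ℝ) hXd) (fun _ => rfl) (by simp)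
      have h := hasDerivAt_pt (y := fun t => t • e)
        (x := fun t => X (WithLp.toLp 2 (t • e)))
        (r := fun t => S (X (WithLp.toLp 2 (t • e))) ^ 2)
        (m := fun t => (2 * (1 - X (WithLp.toLp 2 (t • e))))⁻¹ • hopf (t • e))
        (y' := e) (x' := 0) (r' := 0) (m' := 0) (t := 0) ?_ hXd ?_ ?_
      · refine hasDerivAt_of_eq h (fun _ => rfl) ?_
        simp only [hX00, hS0]
        rw [zero_smul ℝ (skewPt _ _ _), zero_add, add_zero]
      · intro i
        exact hasDerivAt_of_eq ((hasDerivAt_id (0 : ℝ)).mul_const (e i)) (fun _ => rfl) (by simp)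
      · exact hasDerivAt_of_eq (hSd.fun_pow 2) (fun _ => rfl) (by simp)
      · intro i
        have hi : HasDerivAt (fun t : ℝ => (2 * (1 - X (WithLp.toLp 2 (t • e))))⁻¹)
            (-(2 * -0) / (2 * (1 - X (WithLp.toLp 2 ((0 : ℝ) • e)))) ^ 2) 0 :=
          ((hXd.const_sub 1).const_mul 2).fun_inv (by rw [hX00]; norm_num)
        have h2 : HasDerivAt (fun t : ℝ => t ^ 2 * hopf e i) 0 0 :=
          hasDerivAt_of_eq (((hasDerivAt_id (0 : ℝ)).fun_pow 2).mul_const (hopf e i))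
            (fun _ => rfl) (by simp)
        refine hasDerivAt_of_eq (hi.fun_mul h2) (fun t => ?_) (by simp)
        rw [hopf_smul]
        rfl
    · have hc : Continuous fun t : ℝ => (WithLp.toLp 2 (t • e) : EuclideanSpace ℝ (Fin 4)) :=
        (PiLp.continuous_toLp 2 _).comp (continuous_id.smul continuous_const)
      have : ∀ᶠ t : ℝ in 𝓝 0, (WithLp.toLp 2 (t • e) : EuclideanSpace ℝ (Fin 4)) ∈ U :=
        hc.continuousAt.eventually (hUo.mem_nhds (by simpa using h0U))
      filter_upwards [this] with t ht using (hFmem _ ht).1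

/-- The affine chart of the blow-up of `ℂ²` at the origin. -/
def blowUp (y : Fin 4 → ℝ) : Fin 4 → ℝ :=
  ![y 0, y 1, y 0 * y 2 - y 1 * y 3, y 0 * y 3 + y 1 * y 2]

theorem blowUp_dot (y : Fin 4 → ℝ) :
    blowUp y ⬝ᵥ blowUp y = (y 0 ^ 2 + y 1 ^ 2) * (1 + y 2 ^ 2 + y 3 ^ 2) := by
  simp [blowUp]
  ring

/-- In complex notation `blowUp` is (z, zζ). The vector w spans the line of (1, ζ) with the phase of
z. Its Hopf image depends on the line only, hence on ζ only, and is smooth through z = 0, where the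
phase is lost. -/
theorem exists_unit_blowUp {y : Fin 4 → ℝ} {x : ℝ} (hy : blowUp y ⬝ᵥ blowUp y = 1 - x ^ 2) :
    ∃ w : Fin 4 → ℝ, w ⬝ᵥ w = 1 ∧ blowUp y = √(1 - x ^ 2) • w ∧
      hopf w = (1 + y 2 ^ 2 + y 3 ^ 2)⁻¹ • hopf ![1, 0, y 2, y 3] ∧
      (w 0 ^ 2 + w 1 ^ 2) * (1 + y 2 ^ 2 + y 3 ^ 2) = 1 := by
  have hN : 0 < 1 + y 2 ^ 2 + y 3 ^ 2 := by positivity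
  have hN0 : √(1 + y 2 ^ 2 + y 3 ^ 2) ≠ 0 := (Real.sqrt_pos.mpr hN).ne'
  have hN2 := Real.sq_sqrt hN.le
  set N := √(1 + y 2 ^ 2 + y 3 ^ 2) with hNdef
  obtain ⟨a, b, ρ, hab, hρ, ha, hb⟩ : ∃ a b ρ : ℝ, a ^ 2 + b ^ 2 = 1 ∧ 0 ≤ ρ ∧ y 0 = ρ * a ∧
      y 1 = ρ * b := by
    have h0 : 0 ≤ y 0 ^ 2 + y 1 ^ 2 := by positivity
    rcases h0.eq_or_lt with h | h
    -- For z = 0 any phase serves; 1 is taken.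
    · refine ⟨1, 0, 0, by norm_num, le_rfl, ?_, ?_⟩ <;> nlinarith [sq_nonneg (y 0), sq_nonneg (y 1)]
    · have h3 : √(y 0 ^ 2 + y 1 ^ 2) ≠ 0 := (Real.sqrt_pos.mpr h).ne'
      refine ⟨y 0 / √(y 0 ^ 2 + y 1 ^ 2), y 1 / √(y 0 ^ 2 + y 1 ^ 2), √(y 0 ^ 2 + y 1 ^ 2), ?_,
        Real.sqrt_nonneg _, (mul_div_cancel₀ _ h3).symm, (mul_div_cancel₀ _ h3).symm⟩
      rw [div_pow, div_pow, ← add_div, Real.sq_sqrt h0, div_self h.ne']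
  have hc : √(1 - x ^ 2) = ρ * N := by
    rw [← hy, blowUp_dot, ha, hb, ← hN2]
    rw [show ((ρ * a) ^ 2 + (ρ * b) ^ 2) * N ^ 2 = (ρ * N) ^ 2 by
      linear_combination ρ ^ 2 * N ^ 2 * hab]
    exact Real.sqrt_sq (mul_nonneg hρ (Real.sqrt_nonneg _))
  refine ⟨N⁻¹ • blowUp ![a, b, y 2, y 3], ?_, ?_, ?_, ?_⟩
  · rw [dot_smul_self, blowUp_dot, inv_pow, hN2]
    simp [hab, hN.ne']
  · rw [smul_smul, hc, mul_assoc, mul_inv_cancel₀ hN0, mul_one]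
    ext i
    fin_cases i <;> simp [blowUp, ha, hb] <;> ring
  · rw [hopf_smul, inv_pow, hN2]
    congr 1
    ext i
    fin_cases i <;> simp [blowUp, hopf]
    · linear_combination (1 - y 2 ^ 2 - y 3 ^ 2) * hab
    · linear_combination y 2 * hab
    · linear_combination y 3 * hab
  · simp only [Pi.smul_apply, smul_eq_mul, mul_pow, inv_pow, hN2]
    simp [blowUp]
    field_simp
    linarith

end CoassS4

namespace CoassS4

open Filter Topology

/-! ### The chart at the north pole. -/

theorem hopf_ref (a b : ℝ) : hopf ![1, 0, a, b] = ![1 - a ^ 2 - b ^ 2, 2 * a, 2 * b] := by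
  ext i
  fin_cases i <;> simp [hopf]

theorem skew5_coords (r : ℝ) (y : Fin 4 → ℝ) (x : ℝ) (m : Fin 3 → ℝ) :
    (pt y x r m).2 1 2 = r * m 1 ∧ (pt y x r m).2 1 3 = r * m 2 ∧
      ((pt y x r m).2 2 3 - (pt y x r m).2 0 1) / 2 = r * m 0 := by
  refine ⟨rfl, rfl, ?_⟩
  change (r * ((1 - x) / 2 + m 0) - r * ((1 - x) / 2 - m 0)) / 2 = _
  ring

/-- The denominator of the inverse of the chart at the north pole. -/
noncomputable def northDen (p : Amb) : ℝ :=
  (p.2 2 3 - p.2 0 1) / 2 + sPar p ^ 2 * (1 + p.1 4) / 2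

/-- For a unit vector, 1 plus the first Hopf coordinate is 2 (w₀² + w₁²). For s > 0 and x > -1 the
denominator therefore vanishes exactly off the affine chart of ℂP¹ in which the first complex
coordinate is nonzero. -/
theorem northDen_orbitPt {w : Fin 4 → ℝ} (hw : w ⬝ᵥ w = 1) {s : ℝ} (hs : 0 ≤ s) {x : ℝ}
    (h1 : -1 ≤ x) (h2 : x ≤ 1) :
    northDen (orbitPt w (s ^ 2) x) = s ^ 2 * (1 + x) * (w 0 ^ 2 + w 1 ^ 2) := by
  have h3 : (orbitPt w (s ^ 2) x).1 4 = x := rfl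
  rw [northDen, sPar_orbitPt hw hs h1 h2, h3, orbitPt, (skew5_coords _ _ _ _).2.2]
  rw [dot_four] at hw
  simp [hopf]
  linear_combination (-s ^ 2 * (1 + x) / 2) * hw

/-- At x = 1 the orbit is a two-sphere, and the set looks like the blow-up of ℂ² along it. The
coordinates are z, the first complex base coordinate, and the affine coordinate ζ of the line,
recovered as a quotient of Hopf components by `northDen`. Here `xDer` is negative, so s is again a
smooth function of x. Only velocities in the z direction are recorded, since the two along the
sphere come from the group action. -/
theorem north_chart {lam C s₀ : ℝ} (hlam : 0 < lam) (hs : 0 < s₀) (hx : xFun lam C s₀ = 1) :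
    HasChart (setM lam C vRef \ zeroSection) (arcPoint 1 (s₀ ^ 2 • vRef)) ∧
    ∀ a b : ℝ, a ^ 2 + b ^ 2 = 1 →
      IsVelocity (setM lam C vRef \ zeroSection) (arcPoint 1 (s₀ ^ 2 • vRef))
        (![a, b, 0, 0, 0], s₀ ^ 2 • skewPt ![a, b, 0, 0] 1 0) := by
  obtain ⟨V, T, S, hV, hT, hsV, hV0, hS, hXm, hSm, hSX, hXS⟩ :=
    exists_local_inverse hlam C hs (by
      rw [xDer, hx]
      have := qFun_pos hlam s₀
      have h1 : 3 * (1 - 1) * lam + 3 / 2 * (1 - 3 * 1) * s₀ ^ 4 = -(3 * s₀ ^ 4) := by ring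
      rw [h1]
      exact div_ne_zero (neg_ne_zero.mpr (by positivity)) (by positivity))
  have hT0 : (1 : ℝ) ∈ T := hx ▸ hXm hsV
  have hS0 : S 1 = s₀ := by rw [← hx, hSX _ hsV]
  set N : EuclideanSpace ℝ (Fin 4) → ℝ := fun y =>
    (y 0 ^ 2 + y 1 ^ 2) * (1 + y 2 ^ 2 + y 3 ^ 2) with hN
  have hNc : ContDiff ℝ ∞ N := by
    have h := contDiff_coord
    exact (((h 0).pow 2).add ((h 1).pow 2)).mul ((contDiff_const.add ((h 2).pow 2)).add
      ((h 3).pow 2))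
  have hN0 : ∀ y, 0 ≤ N y := fun y => by simp only [hN]; positivity
  have hdot : ∀ y : EuclideanSpace ℝ (Fin 4), blowUp y.ofLp ⬝ᵥ blowUp y.ofLp = N y := fun y =>
    blowUp_dot _
  set X : EuclideanSpace ℝ (Fin 4) → ℝ := fun y => √(1 - N y) with hXdef
  set U : Set (EuclideanSpace ℝ (Fin 4)) := N ⁻¹' Set.Iio 1 ∩ X ⁻¹' T with hU
  set M : EuclideanSpace ℝ (Fin 4) → Fin 3 → ℝ := fun y =>
    ((1 + X y) / 2) • (1 + y 2 ^ 2 + y 3 ^ 2)⁻¹ • hopf ![1, 0, y 2, y 3] with hM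
  set F : EuclideanSpace ℝ (Fin 4) → Amb := fun y =>
    pt (blowUp y.ofLp) (X y) (S (X y) ^ 2) (M y) with hF
  set G : Amb → EuclideanSpace ℝ (Fin 4) := fun p =>
    WithLp.toLp 2 ![p.1 0, p.1 1, p.2 1 2 * (northDen p)⁻¹, p.2 1 3 * (northDen p)⁻¹] with hG
  have hlt : ∀ y ∈ U, 0 < 1 - N y := fun y hy => sub_pos.mpr hy.1
  have hXpos : ∀ y ∈ U, 0 < X y := fun y hy => Real.sqrt_pos.mpr (hlt y hy)
  have hXle : ∀ y, X y ≤ 1 := fun y => Real.sqrt_le_one.mpr (by linarith [hN0 y])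
  have hXc : Continuous X := (continuous_const.sub hNc.continuous).sqrt
  have hUo : IsOpen U := (isOpen_Iio.preimage hNc.continuous).inter (hT.preimage hXc)
  have hXs : ContDiffOn ℝ ∞ X U :=
    ContDiffOn.sqrt (contDiffOn_const.sub hNc.contDiffOn) fun y hy => (hlt y hy).ne'
  have hSs : ContDiffOn ℝ ∞ (fun y => S (X y)) U := hS.comp hXs fun y hy => hy.2
  have hFmem : ∀ y ∈ U, ∃ w : Fin 4 → ℝ, w ⬝ᵥ w = 1 ∧
      (w 0 ^ 2 + w 1 ^ 2) * (1 + y 2 ^ 2 + y 3 ^ 2) = 1 ∧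
      F y = orbitPt w (S (X y) ^ 2) (X y) := by
    intro y hy
    have hy1 : blowUp y.ofLp ⬝ᵥ blowUp y.ofLp = 1 - X y ^ 2 := by
      rw [hdot]
      simp only [hXdef, Real.sq_sqrt (hlt y hy).le]
      ring
    obtain ⟨w, hw, hyw, hwH, hw1⟩ := exists_unit_blowUp hy1
    refine ⟨w, hw, hw1, ?_⟩
    simp only [hF, hM, orbitPt]
    rw [hyw, hwH]
  have hFL : ∀ y ∈ U, F y ∈ setM lam C vRef \ zeroSection := by
    intro y hy
    obtain ⟨w, hw, -, hFo⟩ := hFmem y hy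
    refine (mem_setM_diff_iff hlam).mpr ⟨w, S (X y), hw, hV0 (hSm hy.2), ?_⟩
    rw [hXS _ hy.2]
    exact ⟨by linarith [hXpos y hy], hXle y, hFo⟩
  have hsP : ∀ y ∈ U, sPar (F y) = S (X y) := by
    intro y hy
    obtain ⟨w, hw, -, hFo⟩ := hFmem y hy
    rw [hFo, sPar_orbitPt hw (hV0 (hSm hy.2)).le (by linarith [hXpos y hy]) (hXle y)]
  have hden : ∀ y ∈ U,
      northDen (F y) * (1 + y 2 ^ 2 + y 3 ^ 2) = S (X y) ^ 2 * (1 + X y) := by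
    intro y hy
    obtain ⟨w, hw, hw1, hFo⟩ := hFmem y hy
    rw [hFo, northDen_orbitPt hw (hV0 (hSm hy.2)).le (by linarith [hXpos y hy]) (hXle y), mul_assoc,
      hw1, mul_one]
  have hden0 : ∀ y ∈ U, northDen (F y) ≠ 0 := by
    intro y hy h0
    have h1 := hden y hy
    have h2 : 0 < S (X y) := hV0 (hSm hy.2)
    have h3 := hXpos y hy
    rw [h0, zero_mul] at h1
    have : 0 < S (X y) ^ 2 * (1 + X y) := by positivity
    linarith
  have hGF : ∀ y ∈ U, G (F y) = y := by
    intro y hy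
    have h1 := hden y hy
    have h0 := hden0 y hy
    have hp : 0 < 1 + y 2 ^ 2 + y 3 ^ 2 := by positivity
    obtain ⟨e1, e2, -⟩ := skew5_coords (S (X y) ^ 2) (blowUp y.ofLp) (X y) (M y)
    have f1 : (F y).2 1 2 * (northDen (F y))⁻¹ = y 2 := by
      rw [← div_eq_mul_inv, div_eq_iff h0]
      refine e1.trans ?_
      simp only [hM, hopf_ref]
      simp
      field_simp
      linear_combination -y 2 * h1
    have f2 : (F y).2 1 3 * (northDen (F y))⁻¹ = y 3 := by
      rw [← div_eq_mul_inv, div_eq_iff h0]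
      refine e2.trans ?_
      simp only [hM, hopf_ref]
      simp
      field_simp
      linear_combination -y 3 * h1
    ext i
    fin_cases i
    · rfl
    · rfl
    · exact f1
    · exact f2
  have hX0 : X 0 = 1 := by simp [hXdef, hN]
  have h0U : (0 : EuclideanSpace ℝ (Fin 4)) ∈ U := by
    refine ⟨by simp [hN], ?_⟩
    rw [Set.mem_preimage, hX0]
    exact hT0
  have hF0 : F 0 = arcPoint 1 (s₀ ^ 2 • vRef) := by
    rw [← orbitPt_e0]
    simp only [hF, hX0, hS0, orbitPt, hM]
    congr 1
    · ext i
      fin_cases i <;> simp [blowUp]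
    · ext i
      fin_cases i <;> simp [hopf]
  have hnDc : Continuous northDen := by
    have h1 : ∀ i j : Fin 5, Continuous fun p : Amb => p.2 i j := fun i j =>
      (differentiable_snd_apply i j).continuous
    exact (((h1 2 3).sub (h1 0 1)).div_const 2).add (((continuous_sPar.pow 2).mul
      (continuous_const.add (differentiable_fst_apply 4).continuous)).div_const 2)
  have key : F '' U = (setM lam C vRef \ zeroSection) ∩
      ((((fun p : Amb => p.1 4) ⁻¹' Set.Ioi 0) ∩ sPar ⁻¹' V) ∩ northDen ⁻¹' {0}ᶜ) := by
    ext p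
    constructor
    · rintro ⟨y, hy, rfl⟩
      refine ⟨hFL y hy, ⟨hXpos y hy, ?_⟩, hden0 y hy⟩
      rw [Set.mem_preimage, hsP y hy]
      exact hSm hy.2
    · rintro ⟨hp, ⟨hp4, hpV⟩, hpD⟩
      obtain ⟨w, t, hw, ht, h3, h4, rfl⟩ := (mem_setM_diff_iff hlam).mp hp
      rw [Set.mem_preimage, sPar_orbitPt hw ht.le h3 h4] at hpV
      rw [Set.mem_preimage, northDen_orbitPt hw ht.le h3 h4] at hpD
      set x := xFun lam C t with hxdef
      have hx0 : 0 < x := hp4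
      have hsq : 0 ≤ 1 - x ^ 2 := by nlinarith
      have hSt : S x = t := hSX _ hpV
      have hz0 : w 0 ^ 2 + w 1 ^ 2 ≠ 0 := fun h0 => hpD (by rw [h0]; simp)
      have hw4 := hw
      rw [dot_four] at hw4
      set c := √(1 - x ^ 2) with hcdef
      -- The real numbers ζ and ξ are the real and imaginary parts of (w₂ + i w₃)/(w₀ + i w₁).
      set ζ := (w 0 * w 2 + w 1 * w 3) / (w 0 ^ 2 + w 1 ^ 2) with hζ
      set ξ := (w 0 * w 3 - w 1 * w 2) / (w 0 ^ 2 + w 1 ^ 2) with hξ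
      set y : EuclideanSpace ℝ (Fin 4) := WithLp.toLp 2 ![c * w 0, c * w 1, ζ, ξ] with hy
      have hw2 : w 0 * ζ - w 1 * ξ = w 2 := by
        rw [hζ, hξ]
        field_simp
        ring
      have hw3 : w 0 * ξ + w 1 * ζ = w 3 := by
        rw [hζ, hξ]
        field_simp
        ring
      have hB : blowUp y.ofLp = c • w := by
        ext i
        fin_cases i <;> simp [hy, blowUp]
        · linear_combination c * hw2
        · linear_combination c * hw3
      have hNy : N y = 1 - x ^ 2 := by
        rw [← hdot, hB, dot_smul_self, hw, mul_one, hcdef, Real.sq_sqrt hsq]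
      have hXy : X y = x := by
        simp only [hXdef, hNy, sub_sub_cancel, Real.sqrt_sq_eq_abs, abs_of_pos hx0]
      have hinv : (w 0 ^ 2 + w 1 ^ 2) * (1 + ζ ^ 2 + ξ ^ 2) = 1 := by
        rw [← hw2, ← hw3] at hw4
        linear_combination hw4
      refine ⟨y, ⟨?_, ?_⟩, ?_⟩
      · rw [Set.mem_preimage, hNy, Set.mem_Iio]
        nlinarith
      · rw [Set.mem_preimage, hXy]
        exact hXm hpV
      · simp only [hF, hM, hXy, hSt, hB, orbitPt]
        have hH : (1 + y 2 ^ 2 + y 3 ^ 2)⁻¹ • hopf ![1, 0, y 2, y 3] = hopf w := by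
          have e2 : y 2 = ζ := rfl
          have e3 : y 3 = ξ := rfl
          rw [e2, e3, ← eq_inv_of_mul_eq_one_left hinv, hopf_ref]
          ext i
          fin_cases i <;> simp [hopf]
          · rw [← hw2, ← hw3]
            ring
          · rw [hζ]
            field_simp
          · rw [hξ]
            field_simp
        rw [hH]
  refine ⟨⟨U, F, G, hUo, ?_, hGF, ?_, ⟨_, ?_, key⟩, ⟨0, h0U, hF0⟩⟩, ?_⟩
  · have h := fun i => (contDiff_coord i).contDiffOn (s := U)
    refine contDiffOn_pt (fun i => ?_) hXs (hSs.pow 2) fun i => ?_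
    · fin_cases i
      · exact h 0
      · exact h 1
      · exact ((h 0).mul (h 2)).sub ((h 1).mul (h 3))
      · exact ((h 0).mul (h 3)).add ((h 1).mul (h 2))
    · refine ContDiffOn.mul ((contDiffOn_const.add hXs).div_const 2) (ContDiffOn.mul
        (ContDiffOn.inv ((contDiffOn_const.add ((h 2).pow 2)).add ((h 3).pow 2)) ?_)
        (contDiffOn_hopf (fun i => ?_) i))
      · intro y _
        positivity
      · fin_cases i
        · exact contDiffOn_const
        · exact contDiffOn_const
        · exact h 2
        · exact h 3
  · intro y hy
    have hn : normSq (F y).2 ≠ 0 := by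
      obtain ⟨w, hw, -, hFo⟩ := hFmem y hy
      rw [hFo, normSq_orbitPt hw _ (by linarith [hXpos y hy]) (hXle y)]
      have h2 : 0 < S (X y) := hV0 (hSm hy.2)
      positivity
    have a1 : DifferentiableAt ℝ (fun p : Amb => sPar p ^ 2) (F y) :=
      (differentiableAt_sPar hn).pow 2
    have a2 : DifferentiableAt ℝ (fun p : Amb => 1 + p.1 4) (F y) :=
      (differentiable_fst_apply 4 _).const_add 1
    have a3 : DifferentiableAt ℝ (fun p : Amb => p.2 2 3 - p.2 0 1) (F y) :=
      (differentiable_snd_apply 2 3 _).sub (differentiable_snd_apply 0 1 _)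
    have a4 : DifferentiableAt ℝ (fun p : Amb => sPar p ^ 2 * (1 + p.1 4)) (F y) := a1.mul a2
    have hD : DifferentiableAt ℝ northDen (F y) := by
      unfold northDen
      simp only [div_eq_mul_inv]
      exact (a3.mul_const _).add (a4.mul_const _)
    refine (PiLp.contDiff_toLp (n := 1)).differentiable (by simp) _ |>.comp _ ?_
    refine differentiableAt_pi.mpr fun i => ?_
    fin_cases i
    · exact differentiable_fst_apply 0 _
    · exact differentiable_fst_apply 1 _
    · exact (differentiable_snd_apply 1 2 _).mul (hD.inv (hden0 y hy))
    · exact (differentiable_snd_apply 1 3 _).mul (hD.inv (hden0 y hy))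
  · exact ((isOpen_Ioi.preimage (differentiable_fst_apply 4).continuous).inter
      (hV.preimage continuous_sPar)).inter (isOpen_compl_singleton.preimage hnDc)
  · intro a b hab
    set γ : ℝ → EuclideanSpace ℝ (Fin 4) := fun t => WithLp.toLp 2 ![t * a, t * b, 0, 0] with hγ
    have hγ0 : γ 0 = 0 := by
      ext i
      fin_cases i <;> simp [hγ]
    refine ⟨fun t => F (γ t), ?_, ?_, ?_⟩
    · simp only [hγ0, hF0]
    · have hn : ∀ t : ℝ, N (γ t) = 1 * t ^ 2 := fun t => by
        simp [hN, hγ]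
        linear_combination t ^ 2 * hab
      have hXd : HasDerivAt (fun t : ℝ => X (γ t)) 0 0 :=
        hasDerivAt_of_eq (hasDerivAt_sqrt_one_sub 1) (fun t => by simp only [hXdef, hn]) (by simp)
      have hX00 : X (γ 0) = 1 := by
        rw [hγ0]
        exact hX0
      have hSd : HasDerivAt (fun t : ℝ => S (X (γ t))) 0 0 := by
        have h1 : DifferentiableAt ℝ S (X (γ 0)) := by
          rw [hX00]
          exact (hS.contDiffAt (hT.mem_nhds hT0)).differentiableAt (by simp)
        exact hasDerivAt_of_eq (h1.hasDerivAt.comp (0 : ℝ) hXd) (fun _ => rfl) (by simp)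
      have h := hasDerivAt_pt (y := fun t => blowUp (γ t).ofLp)
        (x := fun t => X (γ t)) (r := fun t => S (X (γ t)) ^ 2)
        (m := fun t => M (γ t)) (y' := ![a, b, 0, 0]) (x' := 0) (r' := 0) (m' := 0) (t := 0)
        ?_ hXd ?_ ?_
      · refine hasDerivAt_of_eq h (fun _ => rfl) ?_
        simp only [hX00, hS0]
        rw [zero_smul ℝ (skewPt _ _ _), zero_add, add_zero]
        simp
      · have hid := fun c : ℝ => (hasDerivAt_id (0 : ℝ)).mul_const c
        intro i
        fin_cases i
        · exact hasDerivAt_of_eq (hid a) (fun _ => rfl) (by simp)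
        · exact hasDerivAt_of_eq (hid b) (fun _ => rfl) (by simp)
        · exact hasDerivAt_of_eq (hasDerivAt_const _ (0 : ℝ)) (fun _ => by simp [blowUp, hγ]) rfl
        · exact hasDerivAt_of_eq (hasDerivAt_const _ (0 : ℝ)) (fun _ => by simp [blowUp, hγ]) rfl
      · exact hasDerivAt_of_eq (hSd.fun_pow 2) (fun _ => rfl) (by simp)
      · intro i
        refine hasDerivAt_of_eq (((hXd.const_add 1).div_const 2).mul_const
          ((1 + (0 : ℝ) ^ 2 + 0 ^ 2)⁻¹ * hopf ![1, 0, 0, 0] i)) (fun t => rfl) (by simp)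
    · have hc : Continuous γ := by
        refine (PiLp.continuous_toLp 2 _).comp (continuous_pi fun i => ?_)
        fin_cases i
        · exact continuous_id.mul continuous_const
        · exact continuous_id.mul continuous_const
        · exact continuous_const
        · exact continuous_const
      have : ∀ᶠ t : ℝ in 𝓝 0, γ t ∈ U :=
        hc.continuousAt.eventually (hUo.mem_nhds (by rw [hγ0]; exact h0U))
      filter_upwards [this] with t ht using hFL _ ht

end CoassS4

namespace CoassS4

open Filter Topology

/-! ### Coassociativity -/

/-- The scale factor `s_λ` on forms of norm `r`, and the factor of horizontal vectors. -/
theorem exists_scale {lam : ℝ} (hlam : 0 < lam) (r : ℝ) :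
    ∃ S k : ℝ, S = (lam + r ^ 2) ^ (1 / 4 : ℝ) ∧ 0 < S ∧ 0 < k ∧ 2 * S ^ 2 * k ^ 2 = 1 ∧
      S ^ 4 = lam + r ^ 2 := by
  have h : 0 < lam + r ^ 2 := by positivity
  refine ⟨_, (√2 * (lam + r ^ 2) ^ (1 / 4 : ℝ))⁻¹, rfl, Real.rpow_pos_of_pos h _, ?_, ?_, ?_⟩
  · have := Real.rpow_pos_of_pos h (1 / 4)
    positivity
  · have := Real.rpow_pos_of_pos h (1 / 4)
    rw [inv_pow, mul_pow, Real.sq_sqrt (by norm_num)]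
    field_simp
  · rw [← Real.rpow_natCast, ← Real.rpow_mul h.le]
    norm_num

/-- With the lengths of the orbit vectors and of the velocity along the level curve inserted, the
relation of `calibratedAt_arcPoint` carries the factor 2s (1 + x)/S³. What is left of it is the
differential equation `hode`. -/
theorem calibratedAt_of_mem_Ioo {lam C s : ℝ} (hlam : 0 < lam) (hs : 0 < s)
    (h1 : -1 < xFun lam C s) (h2 : xFun lam C s < 1) :
    CalibratedAt lam (setM lam C vRef \ zeroSection) (arcPoint (xFun lam C s) (s ^ 2 • vRef)) := by
  obtain ⟨S, k, hS, hS0, hk0, hk, hS4⟩ := exists_scale hlam (s ^ 2)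
  have hr : 0 < s ^ 2 := pow_pos hs 2
  have hF := (bigF_eq_iff hlam hs).mpr (rfl : xFun lam C s = xFun lam C s)
  have hX := hasDerivAt_xFun hlam C hs
  have hq := qFun_pow hlam s
  have hden : 0 < 3 * qFun lam s ^ 8 * s := by
    have := qFun_pos hlam s
    positivity
  have hode : 3 * qFun lam s ^ 8 * s * xDer lam C s =
      3 * (1 - xFun lam C s) * lam + (3 / 2) * (1 - 3 * xFun lam C s) * s ^ 4 := by
    rw [xDer, mul_div_cancel₀ _ hden.ne']
  set x := xFun lam C s with hx
  set c := √(1 - x ^ 2) with hc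
  have hc2 : 0 < 1 - x ^ 2 := by nlinarith
  have hc0 : 0 < c := Real.sqrt_pos.mpr hc2
  have hcsq : c ^ 2 = 1 - x ^ 2 := Real.sq_sqrt hc2.le
  have hkc : k * (c / k) = c := mul_div_cancel₀ _ hk0.ne'
  have hSd : S * (s ^ 2 * (1 + x) / S) = s ^ 2 * (1 + x) := mul_div_cancel₀ _ hS0.ne'
  have hkinv : k ^ 2 = 1 / (2 * S ^ 2) := by
    field_simp
    linarith
  -- The arc moves on the sphere with speed x'/c, and r = s² changes at rate 2s. Dividing by the
  -- frame scales k and S gives α and β; the minus sign is that of `vRef`.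
  refine calibratedAt_arcPoint (a := c / k) (b := c / k) (d := s ^ 2 * (1 + x) / S)
    (α := xDer lam C s / (c * k)) (β := -(2 * s) / S) h1.le h2.le hS hS0.ne' hk
    (div_pos hc0 hk0).ne' ?_ ?_ ?_ ?_
  · positivity
  · have : -(2 * s) / S ≠ 0 := div_ne_zero (neg_ne_zero.mpr (by positivity)) hS0.ne'
    positivity
  · have e1 : xDer lam C s / (c * k) * (2 * (c / k) * (s ^ 2 * (1 + x) / S)) =
        4 * S * s ^ 2 * (1 + x) * xDer lam C s := by
      have : xDer lam C s / (c * k) * (2 * (c / k) * (s ^ 2 * (1 + x) / S)) =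
        2 * s ^ 2 * (1 + x) * xDer lam C s / (S * k ^ 2) := by
        field_simp
      rw [this, hkinv]
      field_simp
      ring
    have e2 : -(2 * s) / S * ((c / k) ^ 2 - (s ^ 2 * (1 + x) / S) ^ 2) =
        -(2 * s) * (1 + x) * (2 * S ^ 4 * (1 - x) - s ^ 4 * (1 + x)) / S ^ 3 := by
      rw [div_pow, hkinv, hcsq]
      field_simp
      ring
    rw [e1, e2]
    have e3 : 4 * S * s ^ 2 * (1 + x) * xDer lam C s =
        2 * s * (1 + x) * (2 * (S ^ 4 * s * xDer lam C s)) / S ^ 3 := by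
      field_simp
      ring
    have e4 : S ^ 4 = qFun lam s ^ 8 := by
      rw [hS4, hq]
      ring
    have e5 : S ^ 4 * s * xDer lam C s =
        (1 - x) * lam + (1 / 2) * (1 - 3 * x) * s ^ 4 := by
      rw [e4]
      linarith
    rw [e3, e5, hS4, ← add_div]
    refine div_eq_zero_iff.mpr (Or.inl ?_)
    ring
  · intro i
    fin_cases i
    · exact isVelocity_planeVec_zero _ _ _ _ hr h1.le h2.le hF hkc
    · exact isVelocity_planeVec_one _ _ _ hr h1.le h2.le hF hkc hSd
    · exact isVelocity_planeVec_two _ _ _ hr h1.le h2.le hF hkc hSd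
    · have hev : ∀ᶠ t in 𝓝 s, xFun lam C t ∈ Set.Ioo (-1) 1 ∧ 0 < t :=
        (hX.continuousAt.eventually (isOpen_Ioo.mem_nhds ⟨h1, h2⟩)).and (lt_mem_nhds hs)
      have hsh : HasDerivAt (fun t : ℝ => s + t) 1 0 := by
        simpa using (hasDerivAt_id (0 : ℝ)).const_add s
      have hsh0 : Tendsto (fun t : ℝ => s + t) (𝓝 0) (𝓝 s) := by
        have := hsh.continuousAt.tendsto
        simpa using this
      have hXt : HasDerivAt (fun t : ℝ => xFun lam C (s + t)) (xDer lam C s) 0 := by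
        have hX' : HasDerivAt (xFun lam C) (xDer lam C s) (s + 0) := by rwa [add_zero]
        exact hasDerivAt_of_eq (hX'.comp (0 : ℝ) hsh) (fun _ => rfl) (by simp)
      have hct : HasDerivAt (fun t : ℝ => √(1 - xFun lam C (s + t) ^ 2))
          (-x * (xDer lam C s / c)) 0 := by
        refine hasDerivAt_of_eq (((hXt.fun_pow 2).const_sub 1).sqrt ?_) (fun _ => rfl) ?_
        · rw [add_zero]
          exact hc2.ne'
        · simp only [add_zero, ← hx, ← hc]
          field_simp
          norm_num
          ring
      refine ⟨fun t => orbitPt ![1, 0, 0, 0] ((s + t) ^ 2) (xFun lam C (s + t)), ?_, ?_, ?_⟩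
      · simp only [add_zero, orbitPt_e0]
        rfl
      · have h := hasDerivAt_pt
          (y := fun t : ℝ => √(1 - xFun lam C (s + t) ^ 2) • ![1, 0, 0, 0])
          (x := fun t => xFun lam C (s + t)) (r := fun t => (s + t) ^ 2)
          (m := fun t => ((1 + xFun lam C (s + t)) / 2) • hopf ![1, 0, 0, 0])
          (y' := ![-x * (xDer lam C s / c), 0, 0, 0]) (x' := xDer lam C s) (r' := 2 * s)
          (m' := ![xDer lam C s / 2, 0, 0]) (t := 0) ?_ hXt ?_ ?_
        · refine hasDerivAt_of_eq h (fun _ => rfl) ?_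
          simp only [add_zero, ← hx, ← hc]
          rw [actM_arcRot_baseFrame h1.le h2.le, ← hc]
          have ek : k * (xDer lam C s / (c * k)) = xDer lam C s / c := by field_simp
          have es : S * (-(2 * s) / S) = -(2 * s) := mul_div_cancel₀ _ hS0.ne'
          have ec : c * (xDer lam C s / c) = xDer lam C s := mul_div_cancel₀ _ hc0.ne'
          refine Prod.ext ?_ ?_
          · ext i
            fin_cases i <;> simp [planeVec, ek, ec]
          · ext i j
            fin_cases i <;> fin_cases j <;>
              simp [planeVec, skewPt, skew5, hopf, ek, es] <;>
              first | ring1 | linear_combination (s ^ 2) * ec | linear_combination (-s ^ 2) * ec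
        · intro i
          refine hasDerivAt_of_eq (hct.mul_const ((![1, 0, 0, 0] : Fin 4 → ℝ) i)) (fun _ => rfl) ?_
          fin_cases i <;> simp
        · exact hasDerivAt_of_eq (hsh.fun_pow 2) (fun _ => rfl) (by simp)
        · intro i
          refine hasDerivAt_of_eq (((hXt.const_add 1).div_const 2).mul_const
            (hopf ![1, 0, 0, 0] i)) (fun _ => rfl) ?_
          fin_cases i <;> simp [hopf]
      · filter_upwards [hsh0.eventually hev] with t ht
        exact orbitPt_mem_diff (by simp) (pow_pos ht.2 2) ht.1.1.le ht.1.2.le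
          ((bigF_eq_iff hlam ht.2).mpr rfl)

/-- At the point orbit the tangent space is the whole horizontal space, the case d = β = 0. -/
theorem calibratedAt_south {lam C s : ℝ} (hlam : 0 < lam) (hs : 0 < s)
    (hx : xFun lam C s = -1) :
    CalibratedAt lam (setM lam C vRef \ zeroSection) (arcPoint (-1) (s ^ 2 • vRef)) := by
  obtain ⟨S, k, hS, hS0, hk0, hk, -⟩ := exists_scale hlam (s ^ 2)
  have hv := (south_chart hlam hs hx).2
  have hkk : k * (1 / k) = 1 := mul_one_div_cancel hk0.ne'
  refine calibratedAt_arcPoint (a := 1 / k) (b := 1 / k) (d := 0) (α := 1 / k) (β := 0) le_rfl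
    (by norm_num) hS hS0.ne' hk (by positivity) (by positivity) (by positivity) (by ring) ?_
  intro i
  rw [actM_arcRot_baseFrame le_rfl (by norm_num)]
  fin_cases i
  · convert hv ![0, 1, 0, 0] (by simp) using 1
    refine Prod.ext (by simp [planeVec]; simpa using hkk) ?_
    ext i j
    fin_cases i <;> fin_cases j <;> simp [planeVec, skewPt, skew5, hk0.ne']
  · convert hv ![0, 0, 1, 0] (by simp) using 1
    refine Prod.ext (by simp [planeVec]; simpa using hkk) ?_
    ext i j
    fin_cases i <;> fin_cases j <;> simp [planeVec, skewPt, skew5, hk0.ne']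
  · convert hv ![0, 0, 0, 1] (by simp) using 1
    refine Prod.ext (by simp [planeVec]; simpa using hkk) ?_
    ext i j
    fin_cases i <;> fin_cases j <;> simp [planeVec, skewPt, skew5, hk0.ne']
  · convert hv ![1, 0, 0, 0] (by simp) using 1
    refine Prod.ext (by simp [planeVec]; simpa using hkk) ?_
    ext i j
    fin_cases i <;> fin_cases j <;> simp [planeVec, skewPt, skew5, hk0.ne']

/-- The exceptional two-sphere contributes two vertical vectors, so b = 0, and the z directions two
horizontal ones, so β = 0; both terms of the calibration relation vanish. The sign of α reflects
that `arcRot 1` sends the last basis vector to minus the first. -/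
theorem calibratedAt_north {lam C s : ℝ} (hlam : 0 < lam) (hs : 0 < s)
    (hx : xFun lam C s = 1) :
    CalibratedAt lam (setM lam C vRef \ zeroSection) (arcPoint 1 (s ^ 2 • vRef)) := by
  obtain ⟨S, k, hS, hS0, hk0, hk, -⟩ := exists_scale hlam (s ^ 2)
  have hr : 0 < s ^ 2 := pow_pos hs 2
  have hF : bigF lam (s ^ 2) 1 = C := (bigF_eq_iff hlam hs).mpr hx.symm
  have hv := (north_chart hlam hs hx).2
  have hkk : k * k⁻¹ = 1 := mul_inv_cancel₀ hk0.ne'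
  have hd : S * (2 * s ^ 2 / S) = s ^ 2 * (1 + 1) := by
    rw [mul_div_cancel₀ _ hS0.ne']
    ring
  refine calibratedAt_arcPoint (a := 1 / k) (b := 0) (d := 2 * s ^ 2 / S) (α := -(1 / k)) (β := 0)
    (by norm_num) le_rfl hS hS0.ne' hk (by positivity) (by positivity) ?_ (by ring) ?_
  · rw [neg_sq]
    positivity
  intro i
  fin_cases i
  · rw [actM_arcRot_baseFrame (by norm_num) le_rfl]
    convert hv 0 1 (by norm_num) using 1
    refine Prod.ext (by simp [planeVec, hkk]) ?_
    ext i j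
    fin_cases i <;> fin_cases j <;> simp [planeVec, skewPt, skew5, hk0.ne']
  · exact isVelocity_planeVec_one _ _ _ hr (by norm_num) le_rfl hF (by simp) hd
  · exact isVelocity_planeVec_two _ _ _ hr (by norm_num) le_rfl hF (by simp) hd
  · rw [actM_arcRot_baseFrame (by norm_num) le_rfl]
    convert hv 1 0 (by norm_num) using 1
    refine Prod.ext (by simp [planeVec, hkk]) ?_
    ext i j
    fin_cases i <;> fin_cases j <;> simp [planeVec, skewPt, skew5, hk0.ne']

theorem chart_and_calibratedAt {lam : ℝ} (hlam : 0 < lam) {C : ℝ} {p : Amb}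
    (hp : p ∈ setM lam C vRef \ zeroSection) :
    HasChart (setM lam C vRef \ zeroSection) p ∧
      CalibratedAt lam (setM lam C vRef \ zeroSection) p := by
  obtain ⟨w, s, hw, hs, h1, h2, rfl⟩ := (mem_setM_diff_iff hlam).mp hp
  have h : HasChart (setM lam C vRef \ zeroSection)
      (arcPoint (xFun lam C s) (s ^ 2 • vRef)) ∧
      CalibratedAt lam (setM lam C vRef \ zeroSection)
        (arcPoint (xFun lam C s) (s ^ 2 • vRef)) := by
    rcases h1.eq_or_lt with h1' | h1'
    · rw [← h1']
      exact ⟨(south_chart hlam hs h1'.symm).1, calibratedAt_south hlam hs h1'.symm⟩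
    rcases h2.eq_or_lt with h2' | h2'
    · rw [h2']
      exact ⟨(north_chart hlam hs h2').1, calibratedAt_north hlam hs h2'⟩
    · exact ⟨hasChart_of_mem_Ioo hlam hs h1' h2', calibratedAt_of_mem_Ioo hlam hs h1' h2'⟩
  have hrot := isRot_leftMul hw
  have h3 := h.1.rot hrot
  have h4 := h.2.rot hrot
  rw [image_leftMul_setM hw, actM_leftMul_arcPoint hw] at h3 h4
  exact ⟨h3, h4⟩

theorem setM_vRef_diff_subset {lam : ℝ} (hlam : 0 < lam) (C : ℝ) :
    setM lam C vRef \ zeroSection ⊆ asdBundle := by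
  intro p hp
  obtain ⟨w, s, hw, hs, h1, h2, rfl⟩ := (mem_setM_diff_iff hlam).mp hp
  exact orbitPt_mem_asdBundle hw _ h1 h2

end CoassS4

namespace CoassS4

open Filter Topology

/-! ### The zero section -/

theorem exists_isRot (x : Fin 5 → ℝ) (hx : x ⬝ᵥ x = 1) :
    ∃ w : Fin 4 → ℝ, w ⬝ᵥ w = 1 ∧ -1 ≤ x 4 ∧ x 4 ≤ 1 ∧ leftMul w *ᵥ arc (x 4) = x := by
  have h : x 0 ^ 2 + x 1 ^ 2 + x 2 ^ 2 + x 3 ^ 2 + x 4 ^ 2 = 1 := by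
    simp only [dotProduct, Fin.sum_univ_five] at hx
    linarith
  obtain ⟨w, hw, hwx⟩ := exists_unit_of_dot (y := ![x 0, x 1, x 2, x 3]) (x := x 4) (by
    rw [dot_four]
    simp
    linarith)
  have e0 := congrFun hwx 0
  have e1 := congrFun hwx 1
  have e2 := congrFun hwx 2
  have e3 := congrFun hwx 3
  simp at e0 e1 e2 e3
  refine ⟨w, hw, by nlinarith [sq_nonneg (x 0), sq_nonneg (x 1), sq_nonneg (x 2), sq_nonneg (x 3)],
    by nlinarith [sq_nonneg (x 0), sq_nonneg (x 1), sq_nonneg (x 2), sq_nonneg (x 3)], ?_⟩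
  ext i
  fin_cases i <;> simp [leftMul, arc]
  · rw [e0, mul_comm]
  · rw [e1, mul_comm]
  · rw [e2, mul_comm]
  · rw [e3, mul_comm]

theorem arcPoint_zero (x : ℝ) : arcPoint x 0 = (arc x, 0) := by
  simp [arcPoint]

theorem image_actM_zeroSection {O : Matrix (Fin 5) (Fin 5) ℝ} (h : IsRot O) :
    actM O '' zeroSection = zeroSection := by
  refine Set.Subset.antisymm ?_ fun p hp => ?_
  · rintro _ ⟨p, hp, rfl⟩
    exact (mem_zeroSection_actM h).mpr hp
  · exact ⟨actM Oᵀ p, (mem_zeroSection_actM h.transpose).mpr hp, h.actM_actM_transpose p⟩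

theorem zeroSection_subset_setM {lam : ℝ} (v : Fin 3 → ℝ) : zeroSection ⊆ setM lam 0 v := by
  rintro ⟨x, A⟩ ⟨hx, hA⟩
  obtain ⟨w, hw, h1, h2, hwx⟩ := exists_isRot x hx
  refine mem_setM_iff.mpr ⟨w, 0, x 4, hw, le_rfl, h1, h2, bigF_zero _, ?_⟩
  simp only at hA
  rw [zero_smul, arcPoint_zero]
  refine Prod.ext hwx.symm ?_
  simp [actM_snd, hA]

theorem hasChart_zeroSection : HasChart zeroSection (basePoint 0) := by
  set F : EuclideanSpace ℝ (Fin 4) → Amb := fun y =>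
    (![√(1 - ‖y‖ ^ 2), y 0, y 1, y 2, y 3], 0) with hF
  set G : Amb → EuclideanSpace ℝ (Fin 4) := fun p => WithLp.toLp 2 fun i => p.1 i.succ with hG
  have hlt : ∀ y ∈ Metric.ball (0 : EuclideanSpace ℝ (Fin 4)) 1, 0 < 1 - ‖y‖ ^ 2 := fun y hy => by
    have : ‖y‖ < 1 := mem_ball_zero_iff.mp hy
    nlinarith [norm_nonneg y]
  have hnorm : ∀ y : EuclideanSpace ℝ (Fin 4), ‖y‖ ^ 2 = y 0 ^ 2 + y 1 ^ 2 + y 2 ^ 2 + y 3 ^ 2 :=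
    fun y => by rw [norm_sq_eq_dot, dot_four]
  have key : F '' Metric.ball 0 1 = zeroSection ∩ ((fun p : Amb => p.1 0) ⁻¹' Set.Ioi 0) := by
    ext p
    constructor
    · rintro ⟨y, hy, rfl⟩
      refine ⟨⟨?_, rfl⟩, Real.sqrt_pos.mpr (hlt y hy)⟩
      have h1 := Real.mul_self_sqrt (hlt y hy).le
      simp only [hF, dotProduct, Fin.sum_univ_five]
      simp
      rw [h1, hnorm]
      ring
    · obtain ⟨x, A⟩ := p
      rintro ⟨⟨hx, hA⟩, hx0⟩
      have hx0 : 0 < x 0 := hx0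
      have hA : A = 0 := hA
      have h : x 0 ^ 2 + x 1 ^ 2 + x 2 ^ 2 + x 3 ^ 2 + x 4 ^ 2 = 1 := by
        simp only [dotProduct, Fin.sum_univ_five] at hx
        linarith
      have hn : ‖(WithLp.toLp 2 ![x 1, x 2, x 3, x 4] : EuclideanSpace ℝ (Fin 4))‖ ^ 2 =
          1 - x 0 ^ 2 := by
        rw [hnorm]
        simp
        linarith
      refine ⟨WithLp.toLp 2 ![x 1, x 2, x 3, x 4], ?_, ?_⟩
      · rw [mem_ball_zero_iff, ← sq_lt_one_iff₀ (norm_nonneg _), hn]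
        nlinarith
      · simp only [hF, hn, sub_sub_cancel, Real.sqrt_sq hx0.le]
        refine Prod.ext ?_ hA.symm
        ext i
        fin_cases i <;> rfl
  refine ⟨Metric.ball 0 1, F, G, Metric.isOpen_ball, ?_, ?_, ?_, ⟨_, isOpen_Ioi.preimage
    (differentiable_fst_apply 0).continuous, key⟩, ?_⟩
  · refine ContDiffOn.prodMk (contDiffOn_pi.mpr fun i => ?_) contDiffOn_const
    fin_cases i
    · exact ContDiffOn.sqrt (contDiffOn_const.sub (contDiff_norm_sq ℝ).contDiffOn)
        fun y hy => (hlt y hy).ne'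
    · exact (contDiff_coord 0).contDiffOn
    · exact (contDiff_coord 1).contDiffOn
    · exact (contDiff_coord 2).contDiffOn
    · exact (contDiff_coord 3).contDiffOn
  · intro y _
    ext i
    fin_cases i <;> rfl
  · intro y _
    refine (PiLp.contDiff_toLp (n := 1)).differentiable (by simp) _ |>.comp _ ?_
    exact differentiableAt_pi.mpr fun i => differentiable_fst_apply _ _
  · rw [key]
    refine ⟨⟨by simp [basePoint], ?_⟩, by simp [basePoint]⟩
    ext i j
    fin_cases i <;> fin_cases j <;> simp [basePoint, skew5]

theorem basePoint_zero : basePoint 0 = arcPoint 0 ((0 : ℝ) • vRef) := by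
  rw [zero_smul, arcPoint_zero]
  refine Prod.ext ?_ ?_
  · ext i
    fin_cases i <;> simp [basePoint, arc]
  · ext i j
    fin_cases i <;> fin_cases j <;> simp [basePoint, skew5]

theorem isVelocity_zeroSection {e : Fin 4 → ℝ} (he : e ⬝ᵥ e = 1) :
    IsVelocity zeroSection (basePoint 0) (![0, e 0, e 1, e 2, e 3], 0) := by
  have h0 : (basePoint 0).2 = 0 := by
    rw [basePoint_zero, zero_smul, arcPoint_zero]
  rw [dot_four] at he
  refine ⟨fun t => (![Real.cos t, Real.sin t * e 0, Real.sin t * e 1, Real.sin t * e 2,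
    Real.sin t * e 3], 0), ?_, ?_, Eventually.of_forall fun t => ⟨?_, rfl⟩⟩
  · refine Prod.ext ?_ h0.symm
    ext i
    fin_cases i <;> simp [basePoint]
  · refine HasDerivAt.prodMk (hasDerivAt_pi.mpr fun i => ?_) (hasDerivAt_const _ _)
    have h := fun c => hasDerivAt_of_eq (hasDerivAt_sin_zero.mul_const c) (fun _ => rfl)
      (one_mul c).symm
    fin_cases i
    · exact hasDerivAt_cos_zero
    · exact h _
    · exact h _
    · exact h _
    · exact h _
  · simp only [dotProduct, Fin.sum_univ_five]
    simp
    linear_combination (Real.sin t) ^ 2 * he + Real.sin_sq_add_cos_sq t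

theorem calibratedAt_zeroSection {lam : ℝ} (hlam : 0 < lam) :
    CalibratedAt lam zeroSection (basePoint 0) := by
  obtain ⟨S, k, hS, hS0, hk0, hk, -⟩ := exists_scale hlam 0
  have hkk : k * k⁻¹ = 1 := mul_inv_cancel₀ hk0.ne'
  rw [basePoint_zero]
  refine calibratedAt_arcPoint (a := k⁻¹) (b := k⁻¹) (d := 0) (α := k⁻¹) (β := 0) (by norm_num)
    (by norm_num) hS hS0.ne' hk (by positivity) (by positivity) (by positivity) (by ring) ?_
  rw [← basePoint_zero]
  intro i
  rw [actM_arcRot_baseFrame (by norm_num) (by norm_num)]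
  have h := isVelocity_zeroSection (e := Pi.single i 1) (by simp)
  convert h using 1
  refine Prod.ext ?_ ?_
  · ext j
    fin_cases i <;> fin_cases j <;> simp [planeVec, hkk]
  · ext j l
    fin_cases i <;> fin_cases j <;> fin_cases l <;> simp [planeVec, skew5]

/-- SO(5) acts transitively on the zero section and preserves it, so the chart and the calibrated
plane at `basePoint 0` suffice. -/
theorem isCoassociative_zeroSection {lam : ℝ} (hlam : 0 < lam) :
    IsCoassociative lam zeroSection := by
  have key : ∀ p ∈ zeroSection, ∃ O, IsRot O ∧ actM O (basePoint 0) = p := by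
    rintro ⟨x, A⟩ ⟨hx, hA⟩
    obtain ⟨w, hw, h1, h2, hwx⟩ := exists_isRot x hx
    simp only at hA
    refine ⟨leftMul w * arcRot (x 4), (isRot_leftMul hw).mul (isRot_arcRot h1 h2), ?_⟩
    rw [actM_mul, actM_arcRot_basePoint h1 h2, zero_smul, arcPoint_zero]
    refine Prod.ext hwx ?_
    simp [actM_snd, hA]
  refine isCoassociative_of_charts ?_ ?_ ?_
  · intro p hp
    obtain ⟨O, hO, rfl⟩ := key p hp
    exact (actM_mem_asdBundle hO _).mpr (basePoint_mem 0)
  · intro p hp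
    obtain ⟨O, hO, rfl⟩ := key p hp
    have := hasChart_zeroSection.rot hO
    rwa [image_actM_zeroSection hO] at this
  · intro p hp
    obtain ⟨O, hO, rfl⟩ := key p hp
    have := (calibratedAt_zeroSection hlam).rot hO
    rwa [image_actM_zeroSection hO] at this

theorem zeroSection_homeo :
    Nonempty (zeroSection ≃ₜ Metric.sphere (0 : EuclideanSpace ℝ (Fin 5)) 1) := by
  have hn : ∀ x : Fin 5 → ℝ, ‖(WithLp.toLp 2 x : EuclideanSpace ℝ (Fin 5))‖ = 1 ↔ x ⬝ᵥ x = 1 := by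
    intro x
    rw [← pow_left_inj₀ (norm_nonneg _) zero_le_one two_ne_zero, EuclideanSpace.real_norm_sq_eq,
      one_pow]
    simp [dotProduct, sq]
  refine ⟨{
    toFun := fun p => ⟨WithLp.toLp 2 p.1.1, mem_sphere_zero_iff_norm.mpr ((hn _).mpr p.2.1)⟩
    invFun := fun x => ⟨(x.1.ofLp, 0), (hn _).mp (mem_sphere_zero_iff_norm.mp x.2), rfl⟩
    left_inv := fun p => Subtype.ext (Prod.ext rfl p.2.2.symm)
    right_inv := fun x => rfl
    continuous_toFun := ?_
    continuous_invFun := ?_ }⟩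
  · exact ((PiLp.continuous_toLp 2 _).comp (continuous_fst.comp continuous_subtype_val)).subtype_mk
      _
  · exact (((PiLp.continuous_ofLp 2 _).comp continuous_subtype_val).prodMk
      continuous_const).subtype_mk _

/-! ### Reduction to one direction in the fibre -/

/-- Right multiplication by an imaginary quaternion on the first four coordinates. -/
def rightMul (n : Fin 3 → ℝ) : Matrix (Fin 5) (Fin 5) ℝ :=
  !![0, -n 0, -n 1, -n 2, 0;
     n 0, 0, -n 2, n 1, 0;
     n 1, n 2, 0, -n 0, 0;
     n 2, -n 1, n 0, 0, 0;
     0, 0, 0, 0, 1]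

theorem dot_three (n : Fin 3 → ℝ) : n ⬝ᵥ n = n 0 ^ 2 + n 1 ^ 2 + n 2 ^ 2 := by
  simp [dotProduct, Fin.sum_univ_three]
  ring

theorem isRot_rightMul {n : Fin 3 → ℝ} (hn : n ⬝ᵥ n = 1) : IsRot (rightMul n) := by
  rw [dot_three] at hn
  refine isRot_of ?_ ?_
  · ext i j
    fin_cases i <;> fin_cases j <;>
      simp [rightMul, Matrix.mul_apply, Fin.sum_univ_five] <;> linarith
  · have : (rightMul n).det = (n 0 ^ 2 + n 1 ^ 2 + n 2 ^ 2) ^ 2 := by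
      rw [Matrix.det_succ_row_zero]
      simp only [Fin.sum_univ_five, det_fin_four', Matrix.submatrix_apply]
      simp [Fin.succAbove, rightMul]
      ring
    rw [this, hn, one_pow]

theorem leftMul_mul_rightMul_comm (w : Fin 4 → ℝ) (n : Fin 3 → ℝ) :
    leftMul w * rightMul n = rightMul n * leftMul w := by
  ext i j
  fin_cases i <;> fin_cases j <;>
    simp [leftMul, rightMul, Matrix.mul_apply, Fin.sum_univ_five] <;> ring

/-- The direction in the fibre into which `vRef` is turned. -/
def turned (n : Fin 3 → ℝ) : Fin 3 → ℝ :=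
  ![2 * n 0 * n 2, -(2 * n 0 * n 1), 1 - 2 * n 0 ^ 2]

/-- For v₂ < 1 the last coordinate gives n₀ by the half-angle formula, and the other two give n₂ and
n₁ after division by 2n₀. For v₂ = 1 one needs n₀ = 0. -/
theorem exists_turned {v : Fin 3 → ℝ} (hv : v ⬝ᵥ v = 1) :
    ∃ n : Fin 3 → ℝ, n ⬝ᵥ n = 1 ∧ turned n = v := by
  rw [dot_three] at hv
  have h2 : v 2 ≤ 1 := by nlinarith [sq_nonneg (v 0), sq_nonneg (v 1)]
  rcases h2.eq_or_lt with h | h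
  · rw [h] at hv
    have h0 : v 0 = 0 := by nlinarith [sq_nonneg (v 0), sq_nonneg (v 1)]
    have h1 : v 1 = 0 := by nlinarith [sq_nonneg (v 0), sq_nonneg (v 1)]
    refine ⟨![0, 1, 0], by simp, ?_⟩
    ext i
    fin_cases i <;> simp [turned, h0, h1, h]
  · set a := √((1 - v 2) / 2) with ha
    have ha2 : a ^ 2 = (1 - v 2) / 2 := Real.sq_sqrt (by linarith)
    have ha0 : a ≠ 0 := (Real.sqrt_pos.mpr (by linarith)).ne'
    refine ⟨![a, -v 1 / (2 * a), v 0 / (2 * a)], ?_, ?_⟩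
    · rw [dot_three]
      simp only [Matrix.cons_val_zero, Matrix.cons_val_one, Matrix.cons_val]
      have : a ^ 2 + (-v 1 / (2 * a)) ^ 2 + (v 0 / (2 * a)) ^ 2 =
          (4 * (a ^ 2) ^ 2 + v 1 ^ 2 + v 0 ^ 2) / (4 * a ^ 2) := by
        field_simp
        ring
      rw [this, ha2, div_eq_one_iff_eq (by linarith)]
      linear_combination hv
    · ext i
      fin_cases i <;> simp [turned]
      · field_simp
      · field_simp
      · rw [ha2]
        ring

/-- Right multiplication by n followed by left multiplication by its conjugate is the half-turn
about n in the imaginary quaternions. It fixes the arc pointwise and rotates e₁, e₂, e₃, and with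
them the fibre coordinates. -/
theorem turn_arcPoint {n : Fin 3 → ℝ} (hn : n ⬝ᵥ n = 1) (x r : ℝ) :
    actM (leftMul ![0, -n 0, -n 1, -n 2]) (actM (rightMul n) (arcPoint x (r • vRef))) =
      arcPoint x (r • turned n) := by
  rw [dot_three] at hn
  have hk : leftMul ![0, -n 0, -n 1, -n 2] * rightMul n =
      !![1, 0, 0, 0, 0;
         0, 2 * n 0 ^ 2 - 1, 2 * n 0 * n 1, 2 * n 0 * n 2, 0;
         0, 2 * n 0 * n 1, 2 * n 1 ^ 2 - 1, 2 * n 1 * n 2, 0;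
         0, 2 * n 0 * n 2, 2 * n 1 * n 2, 2 * n 2 ^ 2 - 1, 0;
         0, 0, 0, 0, 1] := by
    ext i j
    fin_cases i <;> fin_cases j <;>
      simp [leftMul, rightMul, Matrix.mul_apply, Fin.sum_univ_five] <;> linarith
  have hR : arcPoint x (r • turned n) = (arc x, r • skew5 (-x * (2 * n 0 ^ 2 - 1))
      (-x * (2 * n 0 * n 1)) (-x * (2 * n 0 * n 2)) 0 (2 * n 0 * n 2) (-(2 * n 0 * n 1))
      (-√(1 - x ^ 2) * (2 * n 0 ^ 2 - 1)) (2 * n 0 ^ 2 - 1) (-√(1 - x ^ 2) * (2 * n 0 * n 1))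
      (-√(1 - x ^ 2) * (2 * n 0 * n 2))) := by
    refine Prod.ext rfl ?_
    simp only [arcPoint, turned, Fin.sum_univ_three]
    ext i j
    fin_cases i <;> fin_cases j <;> simp [omega, arcFrame, wedge, skew5] <;> ring
  rw [← actM_mul, hk, arcPoint_vRef, hR]
  refine Prod.ext ?_ ?_
  · rw [actM_fst]
    ext i
    fin_cases i <;> simp [arc]
  · rw [actM_snd]
    simp only [Matrix.mul_smul, Matrix.smul_mul]
    congr 1
    ext i j
    simp only [Matrix.mul_apply, Fin.sum_univ_five]
    fin_cases i <;> fin_cases j <;> simp [skew5] <;>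
      first | ring1 | linear_combination (2 : ℝ) * hn | linear_combination (-2 : ℝ) * hn

/-- Right multiplication commutes with the SU(2)-action, so it maps orbits to orbits. By
`turn_arcPoint` it agrees with the change of fibre direction up to an element of SU(2). -/
theorem image_rightMul_setM {n : Fin 3 → ℝ} (hn : n ⬝ᵥ n = 1) (lam C : ℝ) :
    actM (rightMul n) '' setM lam C vRef = setM lam C (turned n) := by
  have hw : (![0, -n 0, -n 1, -n 2] : Fin 4 → ℝ) ⬝ᵥ ![0, -n 0, -n 1, -n 2] = 1 := by
    rw [dot_three] at hn
    rw [dot_four]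
    simpa using hn
  have hr := isRot_leftMul hw
  have hw' : (![0, n 0, n 1, n 2] : Fin 4 → ℝ) ⬝ᵥ ![0, n 0, n 1, n 2] = 1 := by
    rw [dot_three] at hn
    rw [dot_four]
    simpa using hn
  have ht : leftMul ![0, n 0, n 1, n 2] = (leftMul ![0, -n 0, -n 1, -n 2])ᵀ := by
    rw [transpose_leftMul]
    simp
  refine Set.Subset.antisymm ?_ fun p hp => ?_
  · rintro _ ⟨p, hp, rfl⟩
    obtain ⟨z, r, x, hz, hr0, h1, h2, hF, rfl⟩ := mem_setM_iff.mp hp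
    have h3 : actM (rightMul n) (arcPoint x (r • vRef)) =
        actM (leftMul ![0, n 0, n 1, n 2]) (arcPoint x (r • turned n)) := by
      rw [← turn_arcPoint hn, ht, hr.actM_transpose_actM]
    rw [← actM_mul, ← leftMul_mul_rightMul_comm, actM_mul, h3]
    refine actM_leftMul_mem_setM hz (mem_setM_iff.mpr ⟨_, r, x, hw', hr0, h1, h2, hF, rfl⟩)
  · obtain ⟨z, r, x, hz, hr0, h1, h2, hF, rfl⟩ := mem_setM_iff.mp hp
    rw [← turn_arcPoint hn, ← actM_mul (leftMul _) (rightMul n), leftMul_mul_rightMul_comm,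
      actM_mul (rightMul n), ← actM_mul (leftMul z), leftMul_mul_rightMul_comm, actM_mul]
    exact Set.mem_image_of_mem _ (actM_leftMul_mem_setM hz
      (mem_setM_iff.mpr ⟨_, r, x, hw, hr0, h1, h2, hF, rfl⟩))

/-- On the zero section r = 0, where F vanishes whatever x₅ is. -/
theorem setM_diff_eq {lam C : ℝ} (hC : C ≠ 0) (v : Fin 3 → ℝ) (hv : v ⬝ᵥ v = 1) :
    setM lam C v \ zeroSection = setM lam C v := by
  refine sdiff_eq_left.mpr (Set.disjoint_left.mpr fun p hp h0 => ?_)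
  obtain ⟨n, hn, rfl⟩ := exists_turned hv
  rw [← image_rightMul_setM hn] at hp
  obtain ⟨q, hq, rfl⟩ := hp
  rw [mem_zeroSection_actM (isRot_rightMul hn)] at h0
  obtain ⟨w, r, x, hw, hr, h1, h2, hF, rfl⟩ := mem_setM_vRef_iff.mp hq
  have h3 := normSq_orbitPt hw r h1 h2
  rw [h0.2] at h3
  have h4 : normSq (0 : Matrix (Fin 5) (Fin 5) ℝ) = 0 := by simp [normSq]
  rw [h4] at h3
  have : r = 0 := by simpa using h3.symm
  rw [this, bigF_zero] at hF
  exact hC hF.symm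

theorem image_rightMul_diff {n : Fin 3 → ℝ} (hn : n ⬝ᵥ n = 1) (lam C : ℝ) :
    actM (rightMul n) '' (setM lam C vRef \ zeroSection) =
      setM lam C (turned n) \ zeroSection := by
  have h := isRot_rightMul hn
  rw [← image_rightMul_setM hn]
  conv_rhs => rw [← image_actM_zeroSection h]
  exact Set.image_sdiff h.homeo.injective _ _

theorem isCoassociative_setM_diff {lam : ℝ} (hlam : 0 < lam) (C : ℝ) {v : Fin 3 → ℝ}
    (hv : v ⬝ᵥ v = 1) : IsCoassociative lam (setM lam C v \ zeroSection) := by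
  obtain ⟨n, hn, rfl⟩ := exists_turned hv
  have h := isRot_rightMul hn
  rw [← image_rightMul_diff hn]
  refine isCoassociative_of_charts ?_ ?_ ?_
  · rintro _ ⟨p, hp, rfl⟩
    exact (actM_mem_asdBundle h p).mpr (setM_vRef_diff_subset hlam C hp)
  · rintro _ ⟨p, hp, rfl⟩
    exact (chart_and_calibratedAt hlam hp).1.rot h
  · rintro _ ⟨p, hp, rfl⟩
    exact (chart_and_calibratedAt hlam hp).2.rot h

end CoassS4

namespace CoassS4

open Filter Topology

/-! ### Topology of the orbit spaces -/

/-- Neither parametrization need be injective. Both sets are described by the same parameters (w,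
s), with the collapses on the exceptional orbits matched automatically by f and g. -/
theorem nonempty_homeomorph_of_parametrizations {ι A B : Type*} [TopologicalSpace A]
    [TopologicalSpace B] {α : ι → A} {β : ι → B} {S : Set A} {T : Set B} {f : A → B} {g : B → A}
    (hS : S = Set.range α) (hT : T = Set.range β) (hf : ∀ d, f (α d) = β d)
    (hg : ∀ d, g (β d) = α d) (hfc : ContinuousOn f S) (hgc : ContinuousOn g T) :
    Nonempty (S ≃ₜ T) := by
  subst hS hT
  have h1 : Set.MapsTo f (Set.range α) (Set.range β) := by
    rintro _ ⟨d, rfl⟩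
    exact ⟨d, (hf d).symm⟩
  have h2 : Set.MapsTo g (Set.range β) (Set.range α) := by
    rintro _ ⟨d, rfl⟩
    exact ⟨d, (hg d).symm⟩
  refine ⟨⟨⟨h1.restrict, h2.restrict, ?_, ?_⟩, hfc.mapsToRestrict h1, hgc.mapsToRestrict h2⟩⟩
  · rintro ⟨_, d, rfl⟩
    exact Subtype.ext ((congrArg g (hf d)).trans (hg d))
  · rintro ⟨_, d, rfl⟩
    exact Subtype.ext ((congrArg f (hg d)).trans (hf d))

/-- Meant for vectors given as length times direction: on an exceptional orbit the direction has no
limit, but the length tends to zero continuously. -/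
theorem continuousOn_of_norm_eq {Z E : Type*} [TopologicalSpace Z] [NormedAddCommGroup E]
    {f : Z → E} {ν : Z → ℝ} {S : Set Z} (hν : ContinuousOn ν S) (h : ∀ z ∈ S, ‖f z‖ = ν z)
    (hc : ∀ z ∈ S, ν z ≠ 0 → ContinuousWithinAt f S z) : ContinuousOn f S := by
  intro z hz
  by_cases h0 : ν z = 0
  · have hf : f z = 0 := norm_eq_zero.mp ((h z hz).trans h0)
    rw [ContinuousWithinAt, hf]
    refine tendsto_zero_iff_norm_tendsto_zero.mpr ?_
    have := hν z hz
    rw [ContinuousWithinAt, h0] at this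
    exact this.congr' (eventually_mem_nhdsWithin.mono fun t ht => (h t ht).symm)
  · exact hc z hz h0

theorem continuous_pt : Continuous fun q : (Fin 4 → ℝ) × ℝ × ℝ × (Fin 3 → ℝ) =>
    pt q.1 q.2.1 q.2.2.1 q.2.2.2 := by
  rw [← continuousOn_univ]
  refine ContDiffOn.continuousOn (𝕜 := ℝ) (n := ∞) (contDiffOn_pt (fun i => ?_) ?_ ?_ fun i => ?_)
  all_goals exact ContDiff.contDiffOn (by fun_prop)

theorem continuous_hopf : Continuous hopf := by
  refine continuous_pi fun i => ?_
  fin_cases i <;> simp [hopf] <;> fun_prop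

/-- The first four coordinates of the base point. -/
def baseCoord (p : Amb) : Fin 4 → ℝ := fun i => p.1 i.castSucc

theorem continuous_baseCoord : Continuous baseCoord := by
  unfold baseCoord
  fun_prop

theorem baseCoord_orbitPt (w : Fin 4 → ℝ) (r x : ℝ) :
    baseCoord (orbitPt w r x) = √(1 - x ^ 2) • w := by
  ext i
  fin_cases i <;> rfl

theorem orbitPt_fst_four (w : Fin 4 → ℝ) (r x : ℝ) : (orbitPt w r x).1 4 = x := rfl

/-- The parameters of the points of `setM lam C vRef` off the zero section. -/
def Param (lam C : ℝ) : Type :=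
  {d : (Fin 4 → ℝ) × ℝ // d.1 ⬝ᵥ d.1 = 1 ∧ 0 < d.2 ∧ -1 ≤ xFun lam C d.2 ∧ xFun lam C d.2 ≤ 1}

/-- The point with given parameters. -/
noncomputable def paramPt (lam C : ℝ) (d : Param lam C) : Amb :=
  orbitPt d.1.1 (d.1.2 ^ 2) (xFun lam C d.1.2)

theorem setM_diff_eq_range {lam : ℝ} (hlam : 0 < lam) (C : ℝ) :
    setM lam C vRef \ zeroSection = Set.range (paramPt lam C) := by
  ext p
  rw [mem_setM_diff_iff hlam]
  constructor
  · rintro ⟨w, s, hw, hs, h1, h2, rfl⟩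
    exact ⟨⟨(w, s), hw, hs, h1, h2⟩, rfl⟩
  · rintro ⟨⟨⟨w, s⟩, hw, hs, h1, h2⟩, rfl⟩
    exact ⟨w, s, hw, hs, h1, h2, rfl⟩

theorem sPar_paramPt {lam C : ℝ} (d : Param lam C) : sPar (paramPt lam C d) = d.1.2 :=
  sPar_orbitPt d.2.1 d.2.2.1.le d.2.2.2.1 d.2.2.2.2

theorem sqrt_one_sub_sq_ne_zero {x : ℝ} (h1 : -1 < x) (h2 : x < 1) : √(1 - x ^ 2) ≠ 0 :=
  (Real.sqrt_pos.mpr (by nlinarith)).ne'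

/-- The level curve of C = 0 never meets x₅ = ±1, so √(1 - x₅²) can be divided out everywhere and
(w, s) are global coordinates. -/
theorem setM_zero_homeo {lam : ℝ} (hlam : 0 < lam) :
    Nonempty ((setM lam 0 vRef \ zeroSection : Set Amb) ≃ₜ
      Metric.sphere (0 : EuclideanSpace ℝ (Fin 4)) 1 × Set.Ioi (0 : ℝ)) := by
  have hX1 : ∀ s, 0 < s → -1 < xFun lam 0 s := fun s hs => neg_one_lt_xFun hlam le_rfl hs
  have hX2 : ∀ s, 0 < s → xFun lam 0 s < 1 := fun s hs => xFun_lt_one hlam le_rfl hs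
  obtain ⟨e⟩ : Nonempty ((setM lam 0 vRef \ zeroSection : Set Amb) ≃ₜ
      (Metric.sphere (0 : EuclideanSpace ℝ (Fin 4)) 1 ×ˢ Set.Ioi (0 : ℝ) : Set _)) := by
    refine nonempty_homeomorph_of_parametrizations (α := paramPt lam 0)
      (β := fun d => (WithLp.toLp 2 d.1.1, d.1.2))
      (f := fun p => (WithLp.toLp 2 ((√(1 - p.1 4 ^ 2))⁻¹ • baseCoord p), sPar p))
      (g := fun q => orbitPt q.1.ofLp (q.2 ^ 2) (xFun lam 0 q.2))
      (setM_diff_eq_range hlam 0) ?_ ?_ (fun d => rfl) ?_ ?_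
    · ext ⟨u, s⟩
      simp only [Set.mem_prod, mem_sphere_zero_iff_norm, Set.mem_Ioi, Set.mem_range]
      constructor
      · rintro ⟨hu, hs⟩
        exact ⟨⟨(u.ofLp, s), by rw [← norm_sq_eq_dot, hu, one_pow], hs, (hX1 s hs).le,
          (hX2 s hs).le⟩, rfl⟩
      · rintro ⟨⟨⟨w, t⟩, hw, ht, h1, h2⟩, h⟩
        obtain ⟨rfl, rfl⟩ := Prod.mk.inj h
        refine ⟨?_, ht⟩
        have h3 := norm_toLp_smul hw zero_le_one
        rwa [one_smul] at h3
    · intro d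
      have h0 := sqrt_one_sub_sq_ne_zero (hX1 _ d.2.2.1) (hX2 _ d.2.2.1)
      refine Prod.ext ?_ (sPar_paramPt d)
      simp only [paramPt, orbitPt_fst_four, baseCoord_orbitPt]
      rw [inv_smul_smul₀ h0]
    · refine ContinuousOn.prodMk ?_ continuous_sPar.continuousOn
      refine (PiLp.continuous_toLp 2 _).comp_continuousOn (?_ : ContinuousOn
        (fun p : Amb => (√(1 - p.1 4 ^ 2))⁻¹ • baseCoord p) _)
      refine ContinuousOn.smul (f := fun p : Amb => (√(1 - p.1 4 ^ 2))⁻¹) ?_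
        continuous_baseCoord.continuousOn
      refine ContinuousOn.inv₀ (by fun_prop) ?_
      rw [setM_diff_eq_range hlam]
      rintro _ ⟨d, rfl⟩
      exact sqrt_one_sub_sq_ne_zero (hX1 _ d.2.2.1) (hX2 _ d.2.2.1)
    · have hx : ContinuousOn (fun q : EuclideanSpace ℝ (Fin 4) × ℝ => xFun lam 0 q.2)
          (Metric.sphere (0 : EuclideanSpace ℝ (Fin 4)) 1 ×ˢ Set.Ioi (0 : ℝ)) :=
        (continuousOn_xFun hlam 0).comp continuousOn_snd fun q hq => hq.2
      have hw : Continuous fun q : EuclideanSpace ℝ (Fin 4) × ℝ => q.1.ofLp :=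
        (PiLp.continuous_ofLp 2 _).comp continuous_fst
      refine continuous_pt.comp_continuousOn (ContinuousOn.prodMk ?_ (hx.prodMk
        (ContinuousOn.prodMk (by fun_prop) ?_)))
      · exact ContinuousOn.smul ((continuousOn_const.sub (hx.pow 2)).sqrt) hw.continuousOn
      · exact ContinuousOn.smul ((continuousOn_const.add hx).div_const 2)
          (continuous_hopf.comp hw).continuousOn
  exact ⟨e.trans (Homeomorph.Set.prod _ _)⟩

/-- The curve `xFun lam C` enters the strip `[-1, 1]` at the parameter `c` and stays inside. -/
structure EntersAt (lam C c : ℝ) : Prop where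
  pos : 0 < c
  mem_Icc : ∀ s, 0 < s → (-1 ≤ xFun lam C s ∧ xFun lam C s ≤ 1 ↔ c ≤ s)
  mem_Ioo : ∀ s, 0 < s → (-1 < xFun lam C s ∧ xFun lam C s < 1 ↔ c < s)

theorem EntersAt.sqrt_eq_zero {lam C c : ℝ} (h : EntersAt lam C c) :
    √(1 - xFun lam C c ^ 2) = 0 := by
  have h1 := (h.mem_Icc c h.pos).mpr le_rfl
  have h2 := mt (h.mem_Ioo c h.pos).mp (lt_irrefl c)
  rcases h1.1.eq_or_lt with h3 | h3
  · rw [← h3]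
    norm_num
  · rcases h1.2.eq_or_lt with h4 | h4
    · rw [h4]
      norm_num
    · exact absurd ⟨h3, h4⟩ h2

theorem EntersAt.sqrt_ne_zero {lam C c : ℝ} (h : EntersAt lam C c) {s : ℝ} (hs : c < s) :
    √(1 - xFun lam C s ^ 2) ≠ 0 :=
  have h1 := (h.mem_Ioo s (h.pos.trans hs)).mpr hs
  sqrt_one_sub_sq_ne_zero h1.1 h1.2

theorem EntersAt.le {lam C c : ℝ} (h : EntersAt lam C c) (d : Param lam C) : c ≤ d.1.2 :=
  (h.mem_Icc _ d.2.2.1).mp d.2.2.2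

/-- The parameters with a given direction and a given distance from the entry. -/
def EntersAt.param {lam C c : ℝ} (h : EntersAt lam C c) {w : Fin 4 → ℝ} (hw : w ⬝ᵥ w = 1) {t : ℝ}
    (ht : 0 ≤ t) : Param lam C :=
  have hs : 0 < c + t := add_pos_of_pos_of_nonneg h.pos ht
  ⟨(w, c + t), hw, hs, (h.mem_Icc _ hs).mpr (by linarith)⟩

/-- The point of `ℝ⁴` whose direction is that of the base point and whose norm is the distance of
the parameter from `c`. -/
noncomputable def radialVec (c : ℝ) (p : Amb) : EuclideanSpace ℝ (Fin 4) :=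
  WithLp.toLp 2 (((sPar p - c) * (√(1 - p.1 4 ^ 2))⁻¹) • baseCoord p)

theorem EntersAt.radialVec_paramPt {lam C c : ℝ} (h : EntersAt lam C c) (d : Param lam C) :
    radialVec c (paramPt lam C d) = WithLp.toLp 2 ((d.1.2 - c) • d.1.1) := by
  rw [radialVec, sPar_paramPt]
  simp only [paramPt, orbitPt_fst_four, baseCoord_orbitPt, smul_smul]
  -- At the entry √(1 - x²) is zero and its inverse takes the default value, but the factor `d.1.2 -
  -- c` vanishes as well.
  rcases (h.le d).eq_or_lt with h1 | h1
  · simp [← h1]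
  · rw [inv_mul_cancel_right₀ (h.sqrt_ne_zero h1)]

theorem EntersAt.continuousOn_radialVec {lam C c : ℝ} (h : EntersAt lam C c) :
    ContinuousOn (radialVec c) (Set.range (paramPt lam C)) := by
  refine continuousOn_of_norm_eq (ν := fun p => sPar p - c)
    (continuous_sPar.sub continuous_const).continuousOn ?_ ?_
  · rintro _ ⟨d, rfl⟩
    rw [h.radialVec_paramPt, sPar_paramPt]
    exact norm_toLp_smul d.2.1 (sub_nonneg.mpr (h.le d))
  · rintro _ ⟨d, rfl⟩ h0
    rw [sPar_paramPt] at h0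
    have h1 : c < d.1.2 := lt_of_le_of_ne (h.le d) fun h2 => h0 (by rw [← h2, sub_self])
    refine ContinuousAt.continuousWithinAt ?_
    refine (PiLp.continuous_toLp 2 _).continuousAt.comp (ContinuousAt.smul (ContinuousAt.mul
      (continuous_sPar.sub continuous_const).continuousAt (ContinuousAt.inv₀ ?_
        (h.sqrt_ne_zero h1))) continuous_baseCoord.continuousAt)
    fun_prop

/-- The base coordinates of the point with given radial vector. -/
noncomputable def baseVec (lam C c : ℝ) (u : EuclideanSpace ℝ (Fin 4)) :
    EuclideanSpace ℝ (Fin 4) :=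
  (√(1 - xFun lam C (c + ‖u‖) ^ 2) * ‖u‖⁻¹) • u

theorem EntersAt.baseVec_smul {lam C c : ℝ} (h : EntersAt lam C c) (d : Param lam C) :
    baseVec lam C c (WithLp.toLp 2 ((d.1.2 - c) • d.1.1)) =
      WithLp.toLp 2 (√(1 - xFun lam C d.1.2 ^ 2) • d.1.1) := by
  have h1 := sub_nonneg.mpr (h.le d)
  rw [baseVec, norm_toLp_smul d.2.1 h1, add_sub_cancel, ← WithLp.toLp_smul, smul_smul]
  rcases h1.eq_or_lt with h2 | h2
  · have h3 : d.1.2 = c := by linarith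
    rw [h3, h.sqrt_eq_zero]
    simp
  · rw [inv_mul_cancel_right₀ h2.ne']

theorem EntersAt.continuous_xFun {lam C c : ℝ} (hlam : 0 < lam) (h : EntersAt lam C c) :
    Continuous fun u : EuclideanSpace ℝ (Fin 4) => xFun lam C (c + ‖u‖) :=
  (continuousOn_xFun hlam C).comp_continuous (by fun_prop) fun u =>
    add_pos_of_pos_of_nonneg h.pos (norm_nonneg u)

theorem EntersAt.continuous_baseVec {lam C c : ℝ} (hlam : 0 < lam) (h : EntersAt lam C c) :
    Continuous (baseVec lam C c) := by
  have hs : Continuous fun u : EuclideanSpace ℝ (Fin 4) => √(1 - xFun lam C (c + ‖u‖) ^ 2) :=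
    (continuous_const.sub ((h.continuous_xFun hlam).pow 2)).sqrt
  rw [← continuousOn_univ]
  refine continuousOn_of_norm_eq hs.continuousOn (fun u _ => ?_) fun u _ h0 => ?_
  · by_cases hu : u = 0
    · subst hu
      simp [baseVec, h.sqrt_eq_zero]
    · rw [baseVec, norm_smul, Real.norm_of_nonneg (by positivity),
        inv_mul_cancel_right₀ (norm_ne_zero_iff.mpr hu)]
  · have hu : u ≠ 0 := by
      rintro rfl
      rw [norm_zero, add_zero] at h0
      exact h0 h.sqrt_eq_zero
    exact ((hs.continuousAt.mul (continuous_norm.continuousAt.inv₀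
      (norm_ne_zero_iff.mpr hu))).smul continuousAt_id).continuousWithinAt

/-- The point with parameters (w, s) corresponds to (s - c) w in ℝ⁴; the point orbit s = c becomes
the origin. The inverse uses the form of `orbitPt_eq_pt`, whose denominator 2 (1 - x) does not
vanish because the curve stays below x = 1. -/
theorem setM_pos_homeo {lam C : ℝ} (hlam : 0 < lam) (hC : 0 < C) :
    Nonempty ((setM lam C vRef \ zeroSection : Set Amb) ≃ₜ EuclideanSpace ℝ (Fin 4)) := by
  obtain ⟨c, hc, -, hc2⟩ := exists_threshold_of_pos hlam hC
  have hlt : ∀ s, 0 < s → xFun lam C s < 1 := fun s hs => xFun_lt_one hlam hC.le hs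
  have h : EntersAt lam C c :=
    ⟨hc, fun s hs => (and_iff_left (hlt s hs).le).trans (hc2 s hs).1,
      fun s hs => (and_iff_left (hlt s hs)).trans (hc2 s hs).2⟩
  obtain ⟨e⟩ : Nonempty ((setM lam C vRef \ zeroSection : Set Amb) ≃ₜ
      (Set.univ : Set (EuclideanSpace ℝ (Fin 4)))) := by
    refine nonempty_homeomorph_of_parametrizations (α := paramPt lam C)
      (β := fun d => WithLp.toLp 2 ((d.1.2 - c) • d.1.1)) (f := radialVec c)
      (g := fun u => pt (baseVec lam C c u).ofLp (xFun lam C (c + ‖u‖)) ((c + ‖u‖) ^ 2)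
        ((2 * (1 - xFun lam C (c + ‖u‖)))⁻¹ • hopf (baseVec lam C c u).ofLp))
      (setM_diff_eq_range hlam C) ?_ h.radialVec_paramPt ?_ ?_ ?_
    · refine (Set.range_eq_univ.mpr fun u => ?_).symm
      by_cases hu : u = 0
      · refine ⟨h.param (w := ![1, 0, 0, 0]) (by simp) le_rfl, ?_⟩
        simp [EntersAt.param, hu]
      · refine ⟨h.param (dot_inv_norm_smul hu) (norm_nonneg u), ?_⟩
        simp [EntersAt.param, smul_smul, hu]
    · intro d
      have h1 := norm_toLp_smul d.2.1 (sub_nonneg.mpr (h.le d))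
      simp only [h.baseVec_smul, h1, add_sub_cancel]
      exact (orbitPt_eq_pt d.2.2.2.1 (hlt _ d.2.2.1) rfl _).symm
    · rw [setM_diff_eq_range hlam]
      exact h.continuousOn_radialVec
    · have hx := h.continuous_xFun hlam
      have hb := (PiLp.continuous_ofLp 2 _).comp (h.continuous_baseVec hlam)
      refine (continuous_pt.comp (hb.prodMk (hx.prodMk (Continuous.prodMk (by fun_prop)
        (Continuous.smul (Continuous.inv₀ (continuous_const.mul (continuous_const.sub hx)) ?_)
          (continuous_hopf.comp hb)))))).continuousOn
      intro u
      have := hlt (c + ‖u‖) (add_pos_of_pos_of_nonneg h.pos (norm_nonneg u))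
      exact mul_ne_zero two_ne_zero (sub_pos.mpr this).ne'
  exact ⟨e.trans (Homeomorph.Set.univ _)⟩

end CoassS4

namespace CoassS4

open Filter Topology

/-! ### The tautological line bundle -/

/-- A vector of `ℝ⁴` as a vector of `ℂ²`. -/
def toComplex (w : Fin 4 → ℝ) : Fin 2 → ℂ := ![⟨w 0, w 1⟩, ⟨w 2, w 3⟩]

/-- A vector of `ℂ²` as a vector of `ℝ⁴`. -/
def ofComplex (z : Fin 2 → ℂ) : Fin 4 → ℝ := ![(z 0).re, (z 0).im, (z 1).re, (z 1).im]

theorem ofComplex_toComplex (w : Fin 4 → ℝ) : ofComplex (toComplex w) = w := by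
  ext i
  fin_cases i <;> rfl

theorem toComplex_ofComplex (z : Fin 2 → ℂ) : toComplex (ofComplex z) = z := by
  ext i
  fin_cases i <;> rfl

theorem toComplex_smul (t : ℝ) (w : Fin 4 → ℝ) : toComplex (t • w) = (t : ℂ) • toComplex w := by
  ext i
  fin_cases i <;> apply Complex.ext <;> simp [toComplex]

theorem continuous_ofComplex : Continuous ofComplex := by
  refine continuous_pi fun i => ?_
  fin_cases i
  · exact Complex.continuous_re.comp (continuous_apply 0)
  · exact Complex.continuous_im.comp (continuous_apply 0)
  · exact Complex.continuous_re.comp (continuous_apply 1)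
  · exact Complex.continuous_im.comp (continuous_apply 1)

theorem continuous_toComplex : Continuous toComplex := by
  refine continuous_pi fun i => ?_
  fin_cases i
  · exact Complex.equivRealProdCLM.symm.continuous.comp
      (f := fun w : Fin 4 → ℝ => (w 0, w 1)) (by fun_prop)
  · exact Complex.equivRealProdCLM.symm.continuous.comp
      (f := fun w : Fin 4 → ℝ => (w 2, w 3)) (by fun_prop)

theorem dot_ne_zero_iff {w : Fin 4 → ℝ} : w ⬝ᵥ w ≠ 0 ↔ w ≠ 0 := dotProduct_self_eq_zero.not

theorem ofComplex_ne_zero {z : Fin 2 → ℂ} (hz : z ≠ 0) : ofComplex z ≠ 0 := by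
  intro h
  apply hz
  rw [← toComplex_ofComplex z, h]
  ext i
  fin_cases i <;> rfl

theorem toComplex_ne_zero {w : Fin 4 → ℝ} (hw : w ⬝ᵥ w = 1) : toComplex w ≠ 0 := by
  intro h
  have : w = 0 := by
    rw [← ofComplex_toComplex w, h]
    ext i
    fin_cases i <;> rfl
  simp [this] at hw

theorem dot_ofComplex_smul (t : ℂ) (z : Fin 2 → ℂ) :
    ofComplex (t • z) ⬝ᵥ ofComplex (t • z) =
      (t.re ^ 2 + t.im ^ 2) * (ofComplex z ⬝ᵥ ofComplex z) := by
  simp only [dot_four]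
  simp [ofComplex]
  ring

theorem hopf_ofComplex_smul (t : ℂ) (z : Fin 2 → ℂ) :
    hopf (ofComplex (t • z)) = (t.re ^ 2 + t.im ^ 2) • hopf (ofComplex z) := by
  ext i
  fin_cases i <;> simp [hopf, ofComplex] <;> ring

/-- The point of `ℂP¹` under a unit vector of `ℝ⁴`. -/
noncomputable def cpPoint (w : Fin 4 → ℝ) (hw : w ⬝ᵥ w = 1) : Projectivization ℂ (Fin 2 → ℂ) :=
  Projectivization.mk ℂ (toComplex w) (toComplex_ne_zero hw)

/-- The Hopf map on `ℂP¹`, a homeomorphism onto the unit sphere. -/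
noncomputable def hopfProj : Projectivization ℂ (Fin 2 → ℂ) → Fin 3 → ℝ :=
  Projectivization.lift
    (fun z => (ofComplex z.1 ⬝ᵥ ofComplex z.1)⁻¹ • hopf (ofComplex z.1)) (by
      rintro ⟨a, ha⟩ ⟨b, hb⟩ t hab
      change a = t • b at hab
      subst hab
      have h := dot_ne_zero_iff.mpr (ofComplex_ne_zero ha)
      rw [dot_ofComplex_smul] at h
      simp only [dot_ofComplex_smul, hopf_ofComplex_smul, smul_smul]
      congr 1
      have h1 := left_ne_zero_of_mul h
      have h2 := right_ne_zero_of_mul h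
      field_simp)

theorem hopfProj_cpPoint {w : Fin 4 → ℝ} (hw : w ⬝ᵥ w = 1) : hopfProj (cpPoint w hw) = hopf w := by
  change (ofComplex (toComplex w) ⬝ᵥ ofComplex (toComplex w))⁻¹ • hopf (ofComplex (toComplex w)) = _
  rw [ofComplex_toComplex, hw, inv_one, one_smul]

theorem continuous_hopfProj : Continuous hopfProj := by
  refine continuous_coinduced_dom.mpr ?_
  have h : Continuous fun z : {w : Fin 2 → ℂ // w ≠ 0} => ofComplex z.1 :=
    continuous_ofComplex.comp continuous_subtype_val
  exact ((h.dotProduct h).inv₀ fun z => dot_ne_zero_iff.mpr (ofComplex_ne_zero z.2)).smul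
    (continuous_hopf.comp h)

theorem exists_cpPoint (l : Projectivization ℂ (Fin 2 → ℂ)) :
    ∃ (w : Fin 4 → ℝ) (hw : w ⬝ᵥ w = 1), l = cpPoint w hw := by
  induction l using Projectivization.ind with
  | h z hz =>
    set u : EuclideanSpace ℝ (Fin 4) := WithLp.toLp 2 (ofComplex z) with hu
    have hu0 : u ≠ 0 := fun h => ofComplex_ne_zero hz (congrArg WithLp.ofLp h)
    refine ⟨‖u‖⁻¹ • u.ofLp, dot_inv_norm_smul hu0, ?_⟩
    refine (Projectivization.mk_eq_mk_iff' ℂ _ _ _ _).mpr ⟨(‖u‖ : ℂ), ?_⟩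
    rw [← toComplex_smul, smul_inv_smul₀ (norm_ne_zero_iff.mpr hu0)]
    exact toComplex_ofComplex z

theorem injective_hopfProj : Function.Injective hopfProj := by
  intro l l' h
  obtain ⟨w, hw, rfl⟩ := exists_cpPoint l
  obtain ⟨v, hv, rfl⟩ := exists_cpPoint l'
  rw [hopfProj_cpPoint, hopfProj_cpPoint] at h
  have h0 := congrFun h 0
  have h1 := congrFun h 1
  have h2 := congrFun h 2
  simp [hopf] at h0 h1 h2
  rw [dot_four] at hw hv
  -- The two squares are those of the real and imaginary parts of the complex determinant of the two
  -- vectors. For unit vectors with the same Hopf image it vanishes, so they span the same line; the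
  -- scalar supplied below is their Hermitian product.
  have key : (w 0 * v 2 - w 1 * v 3 - w 2 * v 0 + w 3 * v 1) ^ 2 +
      (w 0 * v 3 + w 1 * v 2 - w 2 * v 1 - w 3 * v 0) ^ 2 = 0 := by
    linear_combination (1 / 2) * (v 0 * v 0 + v 1 * v 1 + v 2 * v 2 + v 3 * v 3) * (hw - hv) -
      (1 / 2) * (v 0 ^ 2 + v 1 ^ 2 - v 2 ^ 2 - v 3 ^ 2) * h0 -
      2 * (v 0 * v 2 + v 1 * v 3) * h1 - 2 * (v 0 * v 3 - v 1 * v 2) * h2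
  have r1 : w 0 * v 2 - w 1 * v 3 - w 2 * v 0 + w 3 * v 1 = 0 := by nlinarith
  have r2 : w 0 * v 3 + w 1 * v 2 - w 2 * v 1 - w 3 * v 0 = 0 := by nlinarith
  refine (Projectivization.mk_eq_mk_iff' ℂ _ _ _ _).mpr
    ⟨⟨w 0 * v 0 + w 1 * v 1 + w 2 * v 2 + w 3 * v 3,
      w 1 * v 0 - w 0 * v 1 + w 3 * v 2 - w 2 * v 3⟩, ?_⟩
  ext i
  fin_cases i <;> apply Complex.ext <;> simp [toComplex]
  · linear_combination w 0 * hv - v 2 * r1 - v 3 * r2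
  · linear_combination w 1 * hv - v 2 * r2 + v 3 * r1
  · linear_combination w 2 * hv + v 0 * r1 + v 1 * r2
  · linear_combination w 3 * hv + v 0 * r2 - v 1 * r1

instance compactSpace_cpOne : CompactSpace (Projectivization ℂ (Fin 2 → ℂ)) := by
  have hd : ∀ w : Metric.sphere (0 : EuclideanSpace ℝ (Fin 4)) 1, w.1.ofLp ⬝ᵥ w.1.ofLp = 1 := by
    intro w
    rw [← norm_sq_eq_dot, mem_sphere_zero_iff_norm.mp w.2, one_pow]
  have hc : Continuous fun w : Metric.sphere (0 : EuclideanSpace ℝ (Fin 4)) 1 =>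
      cpPoint w.1.ofLp (hd w) := by
    have h1 : Continuous fun z : {z : Fin 2 → ℂ // z ≠ 0} => Projectivization.mk ℂ z.1 z.2 :=
      continuous_coinduced_rng
    exact h1.comp ((continuous_toComplex.comp ((PiLp.continuous_ofLp 2 _).comp
      continuous_subtype_val)).subtype_mk fun w => toComplex_ne_zero (hd w))
  refine ⟨?_⟩
  have hr := isCompact_range hc
  rw [Set.range_eq_univ.mpr fun l => ?_] at hr
  · exact hr
  · obtain ⟨w, hw, rfl⟩ := exists_cpPoint l
    have h1 := norm_toLp_smul hw zero_le_one
    rw [one_smul] at h1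
    exact ⟨⟨WithLp.toLp 2 w, mem_sphere_zero_iff_norm.mpr h1⟩, rfl⟩

/-- A continuous injection from a compact to a Hausdorff space. It lets continuity of maps into the
quotient ℂP¹ be tested on Hopf coordinates. -/
theorem isClosedEmbedding_hopfProj : IsClosedEmbedding hopfProj :=
  continuous_hopfProj.isClosedEmbedding injective_hopfProj

/-- The image under the Hopf map, as a function of the point of the bundle. -/
noncomputable def fibreDir (p : Amb) : Fin 3 → ℝ :=
  (2 * (1 + p.1 4)⁻¹ * (sPar p ^ 2)⁻¹) • ![(p.2 2 3 - p.2 0 1) / 2, p.2 1 2, p.2 1 3]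

theorem fibreDir_paramPt {lam C : ℝ} (d : Param lam C) (h : -1 < xFun lam C d.1.2) :
    fibreDir (paramPt lam C d) = hopf d.1.1 := by
  have h1 : 1 + xFun lam C d.1.2 ≠ 0 := by linarith
  have h2 : d.1.2 ≠ 0 := d.2.2.1.ne'
  obtain ⟨e1, e2, e3⟩ := skew5_coords (d.1.2 ^ 2) (√(1 - xFun lam C d.1.2 ^ 2) • d.1.1)
    (xFun lam C d.1.2) (((1 + xFun lam C d.1.2) / 2) • hopf d.1.1)
  rw [fibreDir, sPar_paramPt]
  simp only [paramPt, orbitPt_fst_four]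
  simp only [orbitPt, e1, e2, e3]
  ext i
  fin_cases i <;> simp <;> field_simp

theorem continuousAt_fibreDir {lam C : ℝ} (d : Param lam C) (h : -1 < xFun lam C d.1.2) :
    ContinuousAt fibreDir (paramPt lam C d) := by
  have h1 : (1 : ℝ) + (paramPt lam C d).1 4 ≠ 0 := by
    simp only [paramPt, orbitPt_fst_four]
    linarith
  have h2 : sPar (paramPt lam C d) ^ 2 ≠ 0 := by
    rw [sPar_paramPt]
    exact (pow_pos d.2.2.1 2).ne'
  have h3 : ContinuousAt (fun p : Amb => (1 + p.1 4)⁻¹) (paramPt lam C d) :=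
    ContinuousAt.inv₀ (by fun_prop) h1
  have h4 : ContinuousAt (fun p : Amb => (sPar p ^ 2)⁻¹) (paramPt lam C d) :=
    (continuous_sPar.pow 2).continuousAt.inv₀ h2
  refine ((continuousAt_const.mul h3).mul h4).smul ?_
  refine continuousAt_pi.mpr fun i => Continuous.continuousAt ?_
  have hA : ∀ j k, Continuous fun p : Amb => p.2 j k := fun j k =>
    (continuous_apply_apply j k).comp continuous_snd
  fin_cases i
  · exact ((hA 2 3).sub (hA 0 1)).div_const 2
  · exact hA 1 2
  · exact hA 1 3

/-- The point with parameters (w, s) corresponds to the line of w with the vector (s - c) w in it.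
At s = c the vector is zero, but the line is still visible in the fibre: since x₅ > -1 throughout,
`fibreDir` recovers the Hopf image of w. -/
theorem setM_neg_homeo {lam C : ℝ} (hlam : 0 < lam) (hC : C < 0) :
    Nonempty ((setM lam C vRef \ zeroSection : Set Amb) ≃ₜ TautBundle) := by
  obtain ⟨c, hc, -, hc2⟩ := exists_threshold_of_neg hlam hC
  have hlt : ∀ s, 0 < s → -1 < xFun lam C s := fun s hs => neg_one_lt_xFun hlam hC.le hs
  have h : EntersAt lam C c :=
    ⟨hc, fun s hs => (and_iff_right (hlt s hs).le).trans (hc2 s hs).1,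
      fun s hs => (and_iff_right (hlt s hs)).trans (hc2 s hs).2⟩
  have : Nonempty (Projectivization ℂ (Fin 2 → ℂ)) :=
    ⟨cpPoint ![1, 0, 0, 0] (by simp)⟩
  have hinv : ∀ l, Function.invFun hopfProj (hopfProj l) = l :=
    Function.leftInverse_invFun injective_hopfProj
  let vec : (Fin 2 → ℂ) → EuclideanSpace ℝ (Fin 4) := fun z => WithLp.toLp 2 (ofComplex z)
  have hvec : Continuous vec := (PiLp.continuous_toLp 2 _).comp continuous_ofComplex
  refine nonempty_homeomorph_of_parametrizations (α := paramPt lam C)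
    (β := fun d => (cpPoint d.1.1 d.2.1, toComplex ((d.1.2 - c) • d.1.1)))
    (T := {q : Projectivization ℂ (Fin 2 → ℂ) × (Fin 2 → ℂ) | q.2 ∈ q.1.submodule})
    (f := fun p => (Function.invFun hopfProj (fibreDir p), toComplex (radialVec c p).ofLp))
    (g := fun q => pt (baseVec lam C c (vec q.2)).ofLp (xFun lam C (c + ‖vec q.2‖))
      ((c + ‖vec q.2‖) ^ 2) (((1 + xFun lam C (c + ‖vec q.2‖)) / 2) • hopfProj q.1))
    (setM_diff_eq_range hlam C) ?_ ?_ ?_ ?_ ?_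
  · ext ⟨l, z⟩
    constructor
    · intro hq
      obtain ⟨w, hw, rfl⟩ := exists_cpPoint l
      obtain ⟨a, rfl⟩ := Submodule.mem_span_singleton.mp hq
      by_cases ha : a = 0
      -- The zero vector of a line comes from the entry parameter s = c, with w any unit vector of
      -- that line.
      · refine ⟨h.param hw le_rfl, ?_⟩
        have h0 : toComplex 0 = 0 := by simpa using toComplex_smul 0 0
        simp [EntersAt.param, ha, h0]
      · have hz : a • toComplex w ≠ 0 := smul_ne_zero ha (toComplex_ne_zero hw)
        have hu0 : vec (a • toComplex w) ≠ 0 := fun h =>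
          ofComplex_ne_zero hz (congrArg WithLp.ofLp h)
        have hn : ‖vec (a • toComplex w)‖ ≠ 0 := norm_ne_zero_iff.mpr hu0
        refine ⟨h.param (dot_inv_norm_smul hu0) (norm_nonneg (vec (a • toComplex w))), ?_⟩
        refine Prod.ext ?_ ?_
        · refine (Projectivization.mk_eq_mk_iff' ℂ _ _ _ _).mpr
            ⟨((‖vec (a • toComplex w)‖⁻¹ : ℝ) : ℂ) * a, ?_⟩
          simp only [EntersAt.param]
          rw [toComplex_smul, mul_smul]
          congr 1
          exact (toComplex_ofComplex _).symm
        · simp only [EntersAt.param, add_sub_cancel_left]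
          rw [smul_inv_smul₀ hn]
          exact toComplex_ofComplex _
    · rintro ⟨d, hd⟩
      obtain ⟨rfl, rfl⟩ := Prod.mk.inj hd
      refine Submodule.mem_span_singleton.mpr ⟨((d.1.2 - c : ℝ) : ℂ), ?_⟩
      rw [toComplex_smul]
  · intro d
    refine Prod.ext ?_ ?_
    · simp only
      rw [fibreDir_paramPt d (hlt _ d.2.2.1), ← hopfProj_cpPoint d.2.1, hinv]
    · simp only
      rw [h.radialVec_paramPt]
  · intro d
    have h1 := norm_toLp_smul d.2.1 (sub_nonneg.mpr (h.le d))
    simp only [vec, ofComplex_toComplex, h.baseVec_smul, h1, add_sub_cancel, hopfProj_cpPoint]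
    rfl
  · rw [setM_diff_eq_range hlam]
    refine ContinuousOn.prodMk ?_ (continuous_toComplex.comp_continuousOn
      ((PiLp.continuous_ofLp 2 _).comp_continuousOn h.continuousOn_radialVec))
    -- After composition with `hopfProj` the first component becomes `fibreDir`, so no continuity of
    -- the chosen inverse is needed.
    rw [isClosedEmbedding_hopfProj.isInducing.continuousOn_iff]
    refine ContinuousOn.congr (f := fibreDir) ?_ ?_
    · rintro _ ⟨d, rfl⟩
      exact (continuousAt_fibreDir d (hlt _ d.2.2.1)).continuousWithinAt
    · rintro _ ⟨d, rfl⟩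
      simp only [Function.comp_apply]
      rw [fibreDir_paramPt d (hlt _ d.2.2.1), ← hopfProj_cpPoint d.2.1, hinv]
  · have hv : Continuous fun q : Projectivization ℂ (Fin 2 → ℂ) × (Fin 2 → ℂ) => vec q.2 :=
      hvec.comp continuous_snd
    have hx := (h.continuous_xFun hlam).comp hv
    have hb := (PiLp.continuous_ofLp 2 _).comp ((h.continuous_baseVec hlam).comp hv)
    exact (continuous_pt.comp (hb.prodMk (hx.prodMk (((continuous_const.add hv.norm).pow 2).prodMk
      (((continuous_const.add hx).div_const 2).smul
        (continuous_hopfProj.comp continuous_fst)))))).continuousOn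

/-! ### General directions -/

theorem nonempty_homeo_turned {n : Fin 3 → ℝ} (hn : n ⬝ᵥ n = 1) (lam C : ℝ) :
    Nonempty ((setM lam C (turned n) \ zeroSection : Set Amb) ≃ₜ
      (setM lam C vRef \ zeroSection : Set Amb)) :=
  ⟨((Homeomorph.image (isRot_rightMul hn).homeo _).trans
    (Homeomorph.setCongr (image_rightMul_diff hn lam C))).symm⟩

theorem nonempty_homeo_vRef (lam C : ℝ) {v : Fin 3 → ℝ} (hv : v ⬝ᵥ v = 1) :
    Nonempty ((setM lam C v \ zeroSection : Set Amb) ≃ₜ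
      (setM lam C vRef \ zeroSection : Set Amb)) := by
  obtain ⟨n, hn, rfl⟩ := exists_turned hv
  exact nonempty_homeo_turned hn lam C

end CoassS4


theorem mainTheorem3 (lam : ℝ) (hlam : 0 < lam) (C : ℝ) (v : Fin 3 → ℝ) (hv : v ⬝ᵥ v = 1) :
    (C ≠ 0 → IsCoassociative lam (setM lam C v)) ∧
    (0 < C → Nonempty (setM lam C v ≃ₜ EuclideanSpace ℝ (Fin 4))) ∧
    (C < 0 → Nonempty (setM lam C v ≃ₜ TautBundle)) ∧
    (C = 0 →
      zeroSection ⊆ setM lam C v ∧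
      IsCoassociative lam zeroSection ∧
      IsCoassociative lam (setM lam C v \ zeroSection) ∧
      Nonempty (zeroSection ≃ₜ Metric.sphere (0 : EuclideanSpace ℝ (Fin 5)) 1) ∧
      Nonempty ((setM lam C v \ zeroSection : Set Amb) ≃ₜ
        Metric.sphere (0 : EuclideanSpace ℝ (Fin 4)) 1 × Set.Ioi (0 : ℝ))) := by
  refine ⟨fun hC => ?_, fun hC => ?_, fun hC => ?_, ?_⟩
  · rw [← setM_diff_eq hC v hv]
    exact isCoassociative_setM_diff hlam C hv
  · obtain ⟨e⟩ := nonempty_homeo_vRef lam C hv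
    obtain ⟨e'⟩ := setM_pos_homeo hlam hC
    rw [setM_diff_eq hC.ne' v hv] at e
    exact ⟨e.trans e'⟩
  · obtain ⟨e⟩ := nonempty_homeo_vRef lam C hv
    obtain ⟨e'⟩ := setM_neg_homeo hlam hC
    rw [setM_diff_eq hC.ne v hv] at e
    exact ⟨e.trans e'⟩
  · rintro rfl
    obtain ⟨e⟩ := nonempty_homeo_vRef lam 0 hv
    obtain ⟨e'⟩ := setM_zero_homeo hlam
    exact ⟨zeroSection_subset_setM v, isCoassociative_zeroSection hlam,
      isCoassociative_setM_diff hlam 0 hv, zeroSection_homeo, ⟨e.trans e'⟩⟩
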